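/- Conventions. A translation surface of type $\vec\alpha=(\alpha_1,\dots,\alpha_k)$ ($k\ge 1$, integers $\alpha_i\ge 0$) is a compact connected surface $M$ with $k$ distinct labelled points $\xi_1,\dots,\xi_k$ (the singularities; those with $\alpha_i=0$ are marked points) and an atlas of charts $M\smallsetminus\{\xi_1,\dots,\xi_k\}\supset U\to\mathbb C$ whose transition maps are (locally) translations, such that $\xi_i$ is a cone point of angle $2\pi(\alpha_i+1)$. Two such surfaces are identified if there is a homeomorphism between them that respects the labels of the singularities and is a translation in charts. The set of equivalence classes is the stratum $\mathcal H(\vec\alpha)$. It carries the topology given by period coordinates: neighbourhoods of $M$ are obtained by choosing a geodesic triangulation of $M$ with vertex set $\{\xi_1,\dots,\xi_k\}$ and varying slightly the holonomy vectors in $\mathbb C$ of its edges. The group $G=\mathrm{SL}(2,\mathbb R)$ acts on $\mathcal H(\vec\alpha)$ by postcomposition of charts, with $\mathbb C\cong\mathbb R^2$. A straight-line trajectory from $x\in M$ to $y\in M$ is a continuous path $\gamma:[0,1]\to M$ with $\gamma(0)=x$, $\gamma(1)=y$ that has no singularity in its interior and constant nonzero velocity in charts. A blocking set for $(x,y)$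 is a finite set $B\subset M$ with $x,y\notin B$ that meets every straight-line trajectory from $x$ to $y$; if such a set exists, $(x,y)$ is finitely blocked and its blocking cardinality is the minimal cardinality of a blocking set. For an integer $n\ge 0$, let $\mathrm{BB}_n$ be the set of translation surfaces $M$ on which every pair $(x,y)\in M\times M$ (including $x=y$ and singular points) is finitely blocked with blocking cardinality at most $n$. Statement. For all integers $n\ge 0$ and $a\ge 0$ there is $\ell\in\mathbb N$ such that for every stratum $\mathcal H(\vec\alpha)$ with $k\ge 1$ and all $\alpha_i\le a$, and every $M\in\mathcal H(\vec\alpha)$: if $M\in\mathrm{BB}_n$, then $\overline{GM}\subset\mathrm{BB}_\ell$, where the closure of the orbit $GM$ is taken in $\mathcal H(\vec\alpha)$. (So $\ell$ depends only on $n$ and on a bound for the cone angles; in particular it can be chosen uniformly on each stratum.) -/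

import Mathlib

open Topology

/-- The linear map of the plane `ℂ = ℝ²` given by a matrix `g ∈ SL(2, ℝ)`. -/
def planeFun (g : Matrix.SpecialLinearGroup (Fin 2) ℝ) (z : ℂ) : ℂ :=
  ⟨g 0 0 * z.re + g 0 1 * z.im, g 1 0 * z.re + g 1 1 * z.im⟩

theorem planeFun_one (z : ℂ) : planeFun 1 z = z := by
  apply Complex.ext <;> simp [planeFun]

theorem planeFun_mul (g h : Matrix.SpecialLinearGroup (Fin 2) ℝ) (z : ℂ) :
    planeFun (g * h) z = planeFun g (planeFun h z) := by
  apply Complex.ext <;>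
    simp [planeFun, Matrix.mul_apply, Fin.sum_univ_two] <;> ring

theorem planeFun_add (g : Matrix.SpecialLinearGroup (Fin 2) ℝ) (z w : ℂ) :
    planeFun g (z + w) = planeFun g z + planeFun g w := by
  apply Complex.ext <;> simp [planeFun] <;> ring

theorem continuous_planeFun (g : Matrix.SpecialLinearGroup (Fin 2) ℝ) :
    Continuous (planeFun g) := by
  have : planeFun g = fun z : ℂ => ((g 0 0 * z.re + g 0 1 * z.im : ℝ) : ℂ)
      + ((g 1 0 * z.re + g 1 1 * z.im : ℝ) : ℂ) * Complex.I := by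
    funext z
    apply Complex.ext <;> simp [planeFun]
  rw [this]
  fun_prop

/-- `planeFun g` as a homeomorphism of the plane. -/
def planeHomeo (g : Matrix.SpecialLinearGroup (Fin 2) ℝ) : ℂ ≃ₜ ℂ where
  toFun := planeFun g
  invFun := planeFun g⁻¹
  left_inv z := by rw [← planeFun_mul, inv_mul_cancel, planeFun_one]
  right_inv z := by rw [← planeFun_mul, mul_inv_cancel, planeFun_one]
  continuous_toFun := continuous_planeFun g
  continuous_invFun := continuous_planeFun g⁻¹

@[simp] theorem planeHomeo_apply (g : Matrix.SpecialLinearGroup (Fin 2) ℝ) (z : ℂ) :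
    planeHomeo g z = planeFun g z := rfl

theorem exists_continuous_root (g : Matrix.SpecialLinearGroup (Fin 2) ℝ) {m : ℕ} (hm : m ≠ 0) :
    ∃ ψ : ℂ → ℂ, Continuous ψ ∧ ∀ z, ψ z ^ m = planeFun g (z ^ m) := by
  have hdet : g 0 0 * g 1 1 - g 0 1 * g 1 0 = 1 := by
    have := g.det_coe
    rwa [Matrix.det_fin_two] at this
  obtain ⟨A, hA⟩ : ∃ A : ℂ, A = ⟨(g 0 0 + g 1 1) / 2, (g 1 0 - g 0 1) / 2⟩ := ⟨_, rfl⟩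
  obtain ⟨B, hB⟩ : ∃ B : ℂ, B = ⟨(g 0 0 - g 1 1) / 2, (g 1 0 + g 0 1) / 2⟩ := ⟨_, rfl⟩
  have hg : ∀ w, planeFun g w = A * w + B * (starRingEnd ℂ) w := by
    intro w
    apply Complex.ext <;> simp [planeFun, hA, hB] <;> ring
  have hAB : ‖B‖ ^ 2 + 1 = ‖A‖ ^ 2 := by
    rw [← Complex.normSq_eq_norm_sq, ← Complex.normSq_eq_norm_sq]
    simp only [Complex.normSq_apply, hA, hB]
    linarith
  have hA0 : 0 < ‖A‖ := by
    rcases (norm_nonneg A).lt_or_eq with h | h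
    · exact h
    · rw [← h] at hAB; nlinarith [sq_nonneg ‖B‖]
  have hlt : ‖B / A‖ < 1 := by
    rw [norm_div, div_lt_one hA0]
    exact lt_of_pow_lt_pow_left₀ 2 hA0.le (by linarith)
  have hAne : A ≠ 0 := norm_pos_iff.1 hA0
  have hslit : ∀ w : ℂ, 1 + B / A * ((starRingEnd ℂ) w / w) ∈ Complex.slitPlane := by
    intro w
    left
    have h1 : ‖B / A * ((starRingEnd ℂ) w / w)‖ < 1 := by
      rw [norm_mul, norm_div ((starRingEnd ℂ) w), RCLike.norm_conj]
      calc _ ≤ ‖B / A‖ * 1 := by gcongr; exact div_self_le_one _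
        _ < 1 := by simpa using hlt
    have h2 := Complex.abs_re_le_norm (B / A * ((starRingEnd ℂ) w / w))
    have h3 := (abs_le.1 h2).1
    simp only [Complex.add_re, Complex.one_re]
    linarith
  let ψ : ℂ → ℂ := fun z => A ^ ((m : ℂ)⁻¹) *
    (1 + B / A * ((starRingEnd ℂ) (z ^ m) / z ^ m)) ^ ((m : ℂ)⁻¹) * z
  have hψ : ∀ z, ψ z ^ m = planeFun g (z ^ m) := by
    intro z
    simp only [ψ, mul_pow, Complex.cpow_nat_inv_pow _ hm, hg]
    by_cases hz : z ^ m = 0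
    · simp [hz]
    · field_simp
  refine ⟨ψ, continuous_iff_continuousAt.2 fun z => ?_, hψ⟩
  by_cases hz : z = 0
  · subst hz
    have h0 : ψ 0 = 0 := by simp [ψ]
    unfold ContinuousAt
    rw [h0, tendsto_zero_iff_norm_tendsto_zero]
    have hn : ∀ z, ‖ψ z‖ = ‖planeFun g (z ^ m)‖ ^ ((m : ℝ)⁻¹) := by
      intro z
      rw [← hψ, norm_pow, Real.pow_rpow_inv_natCast (norm_nonneg _) hm]
    have hc : Continuous fun z => ‖planeFun g (z ^ m)‖ ^ ((m : ℝ)⁻¹) :=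
      ((continuous_planeFun g).comp (continuous_pow m)).norm.rpow_const
        fun _ => Or.inr (by positivity)
    have := hc.tendsto 0
    rw [← hn 0, h0, norm_zero] at this
    simpa only [hn] using this
  · have hzm : z ^ m ≠ 0 := pow_ne_zero m hz
    refine ContinuousAt.mul (ContinuousAt.mul continuousAt_const ?_) continuousAt_id
    refine ContinuousAt.cpow ?_ continuousAt_const (hslit _)
    have hc : ContinuousAt (fun z : ℂ => (starRingEnd ℂ) (z ^ m) / z ^ m) z :=
      ((RCLike.continuous_conj.comp (continuous_pow m)).continuousAt).div
        (continuous_pow m).continuousAt hzm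
    exact continuousAt_const.add (continuousAt_const.mul hc)

theorem eq_mul_of_pow_eq_pow {m : ℕ} (hm : m ≠ 0) {χ : ℂ → ℂ} (hχ : Continuous χ)
    (h : ∀ z, χ z ^ m = z ^ m) : ∃ ζ : ℂ, ζ ≠ 0 ∧ ∀ z, χ z = ζ * z := by
  have hconn : IsPreconnected ({0}ᶜ : Set ℂ) :=
    (isConnected_compl_singleton_of_one_lt_rank (by simp) 0).isPreconnected
  have hcont : ContinuousOn (fun z => χ z / z) ({0}ᶜ : Set ℂ) :=
    hχ.continuousOn.div continuousOn_id fun z hz => hz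
  have hfin : Set.Finite {w : ℂ | w ^ m = 1} := by
    refine ((Polynomial.nthRoots m (1 : ℂ)).toFinset.finite_toSet).subset ?_
    intro w hw
    simpa [Polynomial.mem_nthRoots (Nat.pos_of_ne_zero hm)] using hw
  have hmaps : Set.MapsTo (fun z => χ z / z) ({0}ᶜ : Set ℂ) {w : ℂ | w ^ m = 1} := by
    intro z hz
    have hz : z ≠ 0 := hz
    simp only [Set.mem_ofPred_eq, div_pow, h z]
    exact div_self (pow_ne_zero m hz)
  have himg := (hconn.image _ hcont)
  have hsub : ((fun z => χ z / z) '' ({0}ᶜ : Set ℂ)).Subsingleton :=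
    (hfin.subset hmaps.image_subset).countable.isTotallyDisconnected _ subset_rfl himg
  refine ⟨χ 1, fun h1 => by simpa [h1, hm] using h 1, fun z => ?_⟩
  by_cases hz : z = 0
  · subst hz
    have := h 0
    rw [zero_pow hm] at this
    simpa using pow_eq_zero_iff hm |>.1 this
  · have := hsub (Set.mem_image_of_mem (fun z => χ z / z) (show z ∈ ({0}ᶜ : Set ℂ) from hz))
      (Set.mem_image_of_mem (fun z => χ z / z) (show (1 : ℂ) ∈ ({0}ᶜ : Set ℂ) by simp))
    simp only [div_one] at this
    rw [← this, div_mul_cancel₀ _ hz]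

/-- A linear map in `SL(2, ℝ)` lifts to a homeomorphism under the branched cover `z ↦ z ^ m`. -/
theorem exists_root_homeo (g : Matrix.SpecialLinearGroup (Fin 2) ℝ) {m : ℕ} (hm : m ≠ 0) :
    ∃ ψ : ℂ ≃ₜ ℂ, ψ 0 = 0 ∧ ∀ z, ψ z ^ m = planeFun g (z ^ m) := by
  obtain ⟨ψ, hψc, hψ⟩ := exists_continuous_root g hm
  obtain ⟨χ, hχc, hχ⟩ := exists_continuous_root g⁻¹ hm
  obtain ⟨ζ, hζ, h1⟩ := eq_mul_of_pow_eq_pow hm (hχc.comp hψc) (fun z => by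
    simp only [Function.comp, hχ, hψ, ← planeFun_mul, inv_mul_cancel, planeFun_one])
  obtain ⟨ξ, hξ, h2⟩ := eq_mul_of_pow_eq_pow hm (hψc.comp hχc) (fun z => by
    simp only [Function.comp, hχ, hψ, ← planeFun_mul, mul_inv_cancel, planeFun_one])
  simp only [Function.comp] at h1 h2
  have hinj : Function.Injective ψ := by
    intro a b hab
    have := h1 a
    rw [hab, h1 b] at this
    exact (mul_left_cancel₀ hζ this).symm
  have hleft : Function.LeftInverse (fun w => ζ⁻¹ * χ w) ψ := by
    intro z
    simp only [h1, inv_mul_cancel_left₀ hζ]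
  have hright : Function.RightInverse (fun w => ζ⁻¹ * χ w) ψ := by
    intro w
    have hw : ψ (χ (ξ⁻¹ * w)) = w := by rw [h2, mul_inv_cancel_left₀ hξ]
    have := hleft (χ (ξ⁻¹ * w))
    rw [hw] at this
    simp only [this, hw]
  refine ⟨⟨⟨ψ, fun w => ζ⁻¹ * χ w, hleft, hright⟩, hψc, continuous_const.mul hχc⟩, ?_, hψ⟩
  have h0 := hψ 0
  rw [zero_pow hm] at h0
  have : planeFun g 0 = 0 := by apply Complex.ext <;> simp [planeFun]
  rw [this] at h0
  exact (pow_eq_zero_iff hm).1 h0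

/-- A translation surface of type `α = (α₁, …, αₖ)`: a compact connected Hausdorff space with `k`
distinct labelled points (the singularities) and an atlas of planar charts on their complement,
with transition maps that are locally translations, and with a cone point of angle
`2π (αᵢ + 1)` at the `i`-th singularity. Such a space is automatically an oriented closed surface,
of the genus `g` with `∑ αᵢ = 2g - 2`. The value `αᵢ = 0` (a marked point) is allowed. -/
structure TranslationSurface {k : ℕ} (α : Fin k → ℕ) where
  carrier : Type
  [top : TopologicalSpace carrier]
  [t2 : T2Space carrier]
  [compact : CompactSpace carrier]
  [connected : ConnectedSpace carrier]
  sing : Fin k → carrier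
  sing_injective : Function.Injective sing
  charts : Set (OpenPartialHomeomorph carrier ℂ)
  chart_nonsingular : ∀ e ∈ charts, ∀ i, sing i ∉ e.source
  chart_cover : ∀ p, p ∉ Set.range sing → ∃ e ∈ charts, p ∈ e.source
  transition : ∀ e ∈ charts, ∀ e' ∈ charts, ∀ p ∈ e.source, p ∈ e'.source →
    ∃ c : ℂ, ∀ᶠ q in 𝓝 p, e' q = e q + c
  /-- Near the `i`-th singularity the surface is the branched cover `z ↦ z ^ (αᵢ + 1)` of a
  neighbourhood of the origin of the flat plane. -/
  cone : ∀ i, ∃ φ : OpenPartialHomeomorph carrier ℂ, sing i ∈ φ.source ∧ φ (sing i) = 0 ∧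
    ∀ p ∈ φ.source, p ≠ sing i → ∀ e ∈ charts, p ∈ e.source →
      ∃ c : ℂ, ∀ᶠ q in 𝓝 p, e q = φ q ^ (α i + 1) + c

namespace TranslationSurface

attribute [instance] top t2 compact connected

variable {k : ℕ} {α : Fin k → ℕ}

/-- The singular set (marked points included). -/
def singSet (M : TranslationSurface α) : Set M.carrier := Set.range M.sing

/-- A homeomorphism that respects the labelled singularities. -/
def PreservesLabels (M N : TranslationSurface α) (f : M.carrier ≃ₜ N.carrier) : Prop :=
  ∀ i, f (M.sing i) = N.sing i

/-- A homeomorphism that respects the labels and is a translation in charts. -/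
structure IsTranslationIso (M N : TranslationSurface α) (f : M.carrier ≃ₜ N.carrier) : Prop where
  labels : PreservesLabels M N f
  translation : ∀ e ∈ M.charts, ∀ e' ∈ N.charts, ∀ p ∈ e.source, f p ∈ e'.source →
    ∃ c : ℂ, ∀ᶠ q in 𝓝 p, e' (f q) = e q + c

theorem PreservesLabels.nonsing {M N : TranslationSurface α} {f : M.carrier ≃ₜ N.carrier}
    (h : PreservesLabels M N f) {p : M.carrier} (hp : p ∉ Set.range M.sing) :
    f p ∉ Set.range N.sing := by
  rintro ⟨i, hi⟩
  rw [← h i] at hi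
  exact hp ⟨i, f.injective hi⟩

theorem nonsing_of_chart (M : TranslationSurface α) {e} (he : e ∈ M.charts) {p : M.carrier}
    (hp : p ∈ e.source) : p ∉ Set.range M.sing := by
  rintro ⟨i, rfl⟩
  exact M.chart_nonsingular e he i hp

theorem IsTranslationIso.refl (M : TranslationSurface α) :
    IsTranslationIso M M (Homeomorph.refl _) :=
  ⟨fun _ => rfl, fun e he e' he' p hp hp' => M.transition e he e' he' p hp hp'⟩

theorem IsTranslationIso.symm {M N : TranslationSurface α} {f : M.carrier ≃ₜ N.carrier}
    (h : IsTranslationIso M N f) : IsTranslationIso N M f.symm := by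
  refine ⟨fun i => by rw [← h.labels i, f.symm_apply_apply], fun e he e' he' p hp hp' => ?_⟩
  obtain ⟨c, hc⟩ := h.translation e' he' e he (f.symm p) hp' (by simpa using hp)
  refine ⟨-c, ?_⟩
  filter_upwards [f.symm.continuous.continuousAt.eventually hc] with q hq
  rw [f.apply_symm_apply] at hq
  rw [hq]
  ring

theorem IsTranslationIso.trans {M N P : TranslationSurface α} {f : M.carrier ≃ₜ N.carrier}
    {f' : N.carrier ≃ₜ P.carrier} (h : IsTranslationIso M N f) (h' : IsTranslationIso N P f') :
    IsTranslationIso M P (f.trans f') := by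
  refine ⟨fun i => by rw [Homeomorph.trans_apply, h.labels i, h'.labels i],
    fun e he e' he' p hp hp' => ?_⟩
  obtain ⟨e₁, he₁, hp₁⟩ := N.chart_cover (f p) (h.labels.nonsing (M.nonsing_of_chart he hp))
  obtain ⟨c, hc⟩ := h.translation e he e₁ he₁ p hp hp₁
  obtain ⟨c', hc'⟩ := h'.translation e₁ he₁ e' he' (f p) hp₁ hp'
  refine ⟨c + c', ?_⟩
  filter_upwards [hc, f.continuous.continuousAt.eventually hc'] with q hq hq'
  rw [Homeomorph.trans_apply, hq', hq]
  ring

/-- Two translation surfaces are equivalent if there is a label-preserving homeomorphism between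
them which is a translation in charts. -/
instance setoid (α : Fin k → ℕ) : Setoid (TranslationSurface α) where
  r M N := ∃ f, IsTranslationIso M N f
  iseqv := ⟨fun M => ⟨_, IsTranslationIso.refl M⟩, fun ⟨_, h⟩ => ⟨_, h.symm⟩,
    fun ⟨_, h⟩ ⟨_, h'⟩ => ⟨_, h.trans h'⟩⟩

/-- The surface `g M`: the charts of `M` are postcomposed with the linear map `g`. -/
def act (g : Matrix.SpecialLinearGroup (Fin 2) ℝ) (M : TranslationSurface α) :
    TranslationSurface α where
  carrier := M.carrier
  sing := M.sing
  sing_injective := M.sing_injective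
  charts := (fun e => e.transHomeomorph (planeHomeo g)) '' M.charts
  chart_nonsingular := by
    rintro _ ⟨e, he, rfl⟩ i
    exact M.chart_nonsingular e he i
  chart_cover p hp := by
    obtain ⟨e, he, h⟩ := M.chart_cover p hp
    exact ⟨_, ⟨e, he, rfl⟩, h⟩
  transition := by
    rintro _ ⟨e, he, rfl⟩ _ ⟨e', he', rfl⟩ p hp hp'
    obtain ⟨c, hc⟩ := M.transition e he e' he' p hp hp'
    refine ⟨planeFun g c, ?_⟩
    filter_upwards [hc] with q hq
    simp [hq, planeFun_add]
  cone i := by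
    obtain ⟨φ, h1, h2, h3⟩ := M.cone i
    obtain ⟨ψ, hψ0, hψ⟩ := exists_root_homeo g (Nat.succ_ne_zero (α i))
    refine ⟨φ.transHomeomorph ψ, h1, by simp [h2, hψ0], ?_⟩
    rintro p hp hpi _ ⟨e, he, rfl⟩ hpe
    obtain ⟨c, hc⟩ := h3 p hp hpi e he hpe
    refine ⟨planeFun g c, ?_⟩
    filter_upwards [hc] with q hq
    have := hψ (φ q)
    simp only [Nat.succ_eq_add_one] at this
    simp [hq, planeFun_add, this]

theorem act_congr (g : Matrix.SpecialLinearGroup (Fin 2) ℝ) {M N : TranslationSurface α}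
    {f : M.carrier ≃ₜ N.carrier} (h : IsTranslationIso M N f) :
    IsTranslationIso (act g M) (act g N) f := by
  refine ⟨h.labels, ?_⟩
  rintro _ ⟨e, he, rfl⟩ _ ⟨e', he', rfl⟩ p hp hp'
  obtain ⟨c, hc⟩ := h.translation e he e' he' p hp hp'
  refine ⟨planeFun g c, ?_⟩
  filter_upwards [hc] with q hq
  change planeFun g (e' (f q)) = planeFun g (e q) + planeFun g c
  rw [hq, planeFun_add]

theorem act_one (M : TranslationSurface α) :
    IsTranslationIso (act 1 M) M (Homeomorph.refl M.carrier) := by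
  refine ⟨fun _ => rfl, ?_⟩
  rintro _ ⟨e, he, rfl⟩ e' he' p hp hp'
  obtain ⟨c, hc⟩ := M.transition e he e' he' p hp hp'
  refine ⟨c, ?_⟩
  filter_upwards [hc] with q hq
  change e' q = planeFun 1 (e q) + c
  rw [planeFun_one, hq]

theorem act_mul (g h : Matrix.SpecialLinearGroup (Fin 2) ℝ) (M : TranslationSurface α) :
    IsTranslationIso (act (g * h) M) (act g (act h M)) (Homeomorph.refl M.carrier) := by
  refine ⟨fun _ => rfl, ?_⟩
  rintro _ ⟨e, he, rfl⟩ _ ⟨_, ⟨e', he', rfl⟩, rfl⟩ p hp hp'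
  obtain ⟨c, hc⟩ := M.transition e he e' he' p hp hp'
  refine ⟨planeFun (g * h) c, ?_⟩
  filter_upwards [hc] with q hq
  change planeFun g (planeFun h (e' q)) = planeFun (g * h) (e q) + planeFun (g * h) c
  rw [← planeFun_mul, ← planeFun_add, hq]

/-- A finite family of parametrized triangles `τ j` (in barycentric coordinates) which is a
geodesic triangulation of `M` with vertex set in the singular set: the triangles cover `M`, their
interiors are embedded and disjoint from all the rest, their vertices are singularities and no
other points are, and in the charts `τ j` is the affine map of the triangle with vertices
`w j 0`, `w j 1`, `w j 2`, up to translation. The numbers `w j b - w j a` are then the periods of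
the edges, that is the period coordinates of `M` with respect to the triangulation. -/
structure IsGeodesicTriangulation (M : TranslationSurface α) {N : ℕ}
    (τ : Fin N → stdSimplex ℝ (Fin 3) → M.carrier) (w : Fin N → Fin 3 → ℂ) : Prop where
  continuous : ∀ j, Continuous (τ j)
  cover : ∀ p, ∃ j b, τ j b = p
  interior_inj : ∀ j b j' b', (∀ i, 0 < b.1 i) → τ j b = τ j' b' → j = j' ∧ b = b'
  sing_iff : ∀ j b, τ j b ∈ M.singSet ↔ ∃ i, b.1 i = 1
  geodesic : ∀ j b, ∀ e ∈ M.charts, τ j b ∈ e.source →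
    ∃ c : ℂ, ∀ᶠ b' in 𝓝 b, e (τ j b') = (∑ i, (b'.1 i : ℂ) * w j i) + c

/-- A straight-line trajectory from `x` to `y`: it has constant velocity `v ≠ 0` in each chart and
no singularity in its interior. -/
structure IsTrajectory (M : TranslationSurface α) (x y : M.carrier) (γ : ℝ → M.carrier) :
    Prop where
  continuousOn : ContinuousOn γ (Set.Icc 0 1)
  source : γ 0 = x
  target : γ 1 = y
  nonsingular : ∀ t ∈ Set.Ioo (0 : ℝ) 1, γ t ∉ M.singSet
  straight : ∃ v : ℂ, v ≠ 0 ∧ ∀ t ∈ Set.Ioo (0 : ℝ) 1, ∀ e ∈ M.charts, γ t ∈ e.source →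
    ∃ c : ℂ, ∀ᶠ s in 𝓝 t, e (γ s) = (s : ℂ) * v + c

/-- `B` is a (finite) blocking set for `(x, y)`. -/
structure IsBlockingSet (M : TranslationSurface α) (x y : M.carrier) (B : Finset M.carrier) :
    Prop where
  left_notMem : x ∉ B
  right_notMem : y ∉ B
  meets : ∀ γ, M.IsTrajectory x y γ → ∃ t ∈ Set.Icc (0 : ℝ) 1, γ t ∈ B

def FinitelyBlocked (M : TranslationSurface α) (x y : M.carrier) : Prop :=
  ∃ B, M.IsBlockingSet x y B

/-- The minimal cardinality of a blocking set (meaningful for finitely blocked pairs). -/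
noncomputable def blockingCard (M : TranslationSurface α) (x y : M.carrier) : ℕ :=
  sInf {m | ∃ B, M.IsBlockingSet x y B ∧ B.card = m}

/-- The bounded blocking property with blocking cardinality at most `n`. -/
def BoundedBlocking (M : TranslationSurface α) (n : ℕ) : Prop :=
  ∀ x y, M.FinitelyBlocked x y ∧ M.blockingCard x y ≤ n

end TranslationSurface

/-- The stratum `H(α)`: translation surfaces of type `α` up to equivalence. -/
def Stratum {k : ℕ} (α : Fin k → ℕ) : Type 1 := Quotient (TranslationSurface.setoid α)

namespace Stratum

variable {k : ℕ} {α : Fin k → ℕ}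

/-- The point of the stratum represented by a surface. -/
def mk (M : TranslationSurface α) : Stratum α := Quotient.mk _ M

/-- The topology given by period coordinates. A set is open if, for each surface `M` in it and each
geodesic triangulation of `M`, it contains all surfaces that carry the same triangulation
(transported by a label-preserving homeomorphism `f`, straightened in the new flat structure) with
periods of the edges close enough to those of `M`. -/
instance : TopologicalSpace (Stratum α) where
  IsOpen U := ∀ M : TranslationSurface α, mk M ∈ U →
    ∀ (N : ℕ) (τ : Fin N → stdSimplex ℝ (Fin 3) → M.carrier) (w : Fin N → Fin 3 → ℂ),
      M.IsGeodesicTriangulation τ w → ∃ ε : ℝ, 0 < ε ∧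
        ∀ (M' : TranslationSurface α) (f : M.carrier ≃ₜ M'.carrier) (w' : Fin N → Fin 3 → ℂ),
          M.PreservesLabels M' f → M'.IsGeodesicTriangulation (fun j b => f (τ j b)) w' →
          (∀ j a b, ‖(w' j b - w' j a) - (w j b - w j a)‖ < ε) → mk M' ∈ U
  isOpen_univ := fun _ _ _ _ _ _ => ⟨1, one_pos, fun _ _ _ _ _ _ => trivial⟩
  isOpen_inter := by
    intro U V hU hV M hM N τ w h
    obtain ⟨ε, hε, h1⟩ := hU M hM.1 N τ w h
    obtain ⟨δ, hδ, h2⟩ := hV M hM.2 N τ w h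
    refine ⟨min ε δ, lt_min hε hδ, fun M' f w' hf hw' hd => ⟨?_, ?_⟩⟩
    · exact h1 M' f w' hf hw' fun j a b => (hd j a b).trans_le (min_le_left _ _)
    · exact h2 M' f w' hf hw' fun j a b => (hd j a b).trans_le (min_le_right _ _)
  isOpen_sUnion := by
    intro S hS M hM N τ w h
    obtain ⟨U, hU, hMU⟩ := hM
    obtain ⟨ε, hε, h1⟩ := hS U hU M hMU N τ w h
    exact ⟨ε, hε, fun M' f w' hf hw' hd => ⟨U, hU, h1 M' f w' hf hw' hd⟩⟩

/-- The action of `SL(2, ℝ)` on the stratum by postcomposition of charts. -/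
instance : MulAction (Matrix.SpecialLinearGroup (Fin 2) ℝ) (Stratum α) where
  smul g := Quotient.map (TranslationSurface.act g)
    fun _ _ ⟨f, hf⟩ => ⟨f, TranslationSurface.act_congr g hf⟩
  one_smul := by
    rintro ⟨M⟩
    exact Quotient.sound ⟨_, TranslationSurface.act_one M⟩
  mul_smul := by
    rintro g h ⟨M⟩
    exact Quotient.sound ⟨_, TranslationSurface.act_mul g h M⟩

end Stratum

/-! Blocking by at most `n` points does not pass to limits directly, because a blocking point may
run into an endpoint. The proof replaces it by a property that does pass to limits, `ClassBlocking`.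
Call a trajectory primitive if it does not return to its endpoints. The primitive trajectories from
`x` to `y` should be covered by `n` classes, each of which either is blocked by one point or has at
most two members. A blocking set of at most `n` points gives such classes, one for each point
(`BoundedBlocking.classBlocking`). Conversely, every trajectory contains a primitive one, and two
midpoints block a class with at most two members, so `2 n` points always suffice
(`ClassBlocking.boundedBlocking`). The action of `SL(2, ℝ)` preserves trajectories, so it remains to
show that `ClassBlocking n` is closed.

Let `N` be a limit of surfaces `M i`, compared by maps that are translations up to a relative error
tending to zero (`IsGeodesicTriangulation.exists_isNearTranslation`). A primitive trajectory of `N`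
lies in an immersed flat rhombus that avoids its endpoints (`IsPrimitive.exists_isDiamond`), and a
fixed point argument straightens it to a primitive trajectory of `M i`
(`IsDiamond.exists_transfer`). Along an ultrafilter each trajectory of `N` receives a definite
class, and the blocking points `b i` of a class, pulled back to `N`, converge to some `b₀`.

If `b₀` is neither `x` nor `y`, it blocks the limit class. Otherwise every member of the class meets
the point over `b i` at a parameter tending to `0` or to `1`. Two members that do so at the same end
leave that endpoint in the same direction, because the deviation is small relative to the distance
from it; being primitive, they coincide (`IsPrimitive.eqOn_of_tendsto`). There are two ends, hence
at most two members. This is `ClassBlocking.of_isNearTranslation`. -/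

namespace TranslationSurface

/-! ### Cone charts, developments into the plane, and unique continuation. -/

open Filter Set

variable {k : ℕ} {α : Fin k → ℕ}

/-- A chart centred at `p` in which the flat structure is the pullback of the plane under
`z ↦ z ^ m`, with no singularity other than possibly `p`. -/
structure IsConeChart (M : TranslationSurface α) (p : M.carrier)
    (φ : OpenPartialHomeomorph M.carrier ℂ) (m : ℕ) : Prop where
  ne_zero : m ≠ 0
  mem_source : p ∈ φ.source
  map_self : φ p = 0
  nonsingular : ∀ q ∈ φ.source, q ≠ p → q ∉ M.singSet
  local_eq : ∀ q ∈ φ.source, ∀ e ∈ M.charts, q ∈ e.source →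
    ∃ c : ℂ, ∀ᶠ r in 𝓝 q, e r = φ r ^ m + c

/-- Treats regular and singular endpoints uniformly: a recentred flat chart is a cone chart with `m
= 1`, and a chart at a singularity is shrunk to avoid the finitely many others. -/
theorem exists_isConeChart (M : TranslationSurface α) (p : M.carrier) :
    ∃ φ m, M.IsConeChart p φ m := by
  by_cases hp : p ∈ M.singSet
  · obtain ⟨i, rfl⟩ := hp
    obtain ⟨φ, h1, h2, h3⟩ := M.cone i
    have hcl : IsClosed (M.singSet \ {M.sing i}) := ((Set.finite_range _).subset sdiff_subset).isClosed
    refine ⟨φ.restrOpen _ hcl.isOpen_compl, α i + 1, Nat.succ_ne_zero _, ?_, h2, ?_, ?_⟩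
    · rw [OpenPartialHomeomorph.restrOpen_source]
      exact ⟨h1, fun h => h.2 rfl⟩
    · intro q hq hqp hqs
      rw [OpenPartialHomeomorph.restrOpen_source] at hq
      exact hq.2 ⟨hqs, hqp⟩
    · intro q hq e he hqe
      rw [OpenPartialHomeomorph.restrOpen_source] at hq
      exact h3 q hq.1 (fun h => M.chart_nonsingular e he i (h ▸ hqe)) e he hqe
  · obtain ⟨e, he, hpe⟩ := M.chart_cover p hp
    refine ⟨e.transHomeomorph (Homeomorph.addRight (-(e p))), 1, one_ne_zero, hpe, ?_, ?_, ?_⟩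
    · simp
    · intro q hq _
      exact M.nonsing_of_chart he hq
    · intro q hq e' he' hqe'
      obtain ⟨c, hc⟩ := M.transition e he e' he' q hq hqe'
      refine ⟨c + e p, ?_⟩
      filter_upwards [hc] with r hr
      rw [hr]
      simp
      ring

/-- Near `u` the map `G` to the surface is nonsingular and is developed in the plane by `D`. -/
structure IsDevAt {X : Type*} [TopologicalSpace X] (M : TranslationSurface α) (D : X → ℂ)
    (G : X → M.carrier) (u : X) : Prop where
  nonsingular : G u ∉ M.singSet
  continuousAt : ContinuousAt G u
  local_eq : ∀ e ∈ M.charts, G u ∈ e.source → ∃ c : ℂ, ∀ᶠ w in 𝓝 u, e (G w) = D w + c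

section Dev

variable {X : Type*} [TopologicalSpace X] {M : TranslationSurface α} {D D' : X → ℂ}
  {G G' : X → M.carrier} {u : X}

theorem IsDevAt.congr (h : M.IsDevAt D G u) (hG : G =ᶠ[𝓝 u] G')
    (hD : ∃ c : ℂ, ∀ᶠ w in 𝓝 u, D w = D' w + c) : M.IsDevAt D' G' u := by
  obtain ⟨h1, h2, h3⟩ := h
  obtain ⟨d, hd⟩ := hD
  refine ⟨hG.eq_of_nhds ▸ h1, h2.congr hG, fun e he hu => ?_⟩
  obtain ⟨c, hc⟩ := h3 e he (hG.eq_of_nhds ▸ hu)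
  refine ⟨d + c, ?_⟩
  filter_upwards [hc, hG, hd] with w h1 h2 h3
  rw [← h2, h1, h3]
  ring

theorem IsDevAt.congr_map (h : M.IsDevAt D G u) (hG : G =ᶠ[𝓝 u] G') : M.IsDevAt D G' u :=
  h.congr hG ⟨0, by simp⟩

theorem IsDevAt.exists_chart (h : M.IsDevAt D G u) : ∃ e ∈ M.charts, G u ∈ e.source :=
  M.chart_cover _ h.nonsingular

theorem IsDevAt.comp {Y : Type*} [TopologicalSpace Y] {s : Y → X} {y : Y}
    (h : M.IsDevAt D G (s y)) (hs : ContinuousAt s y) : M.IsDevAt (D ∘ s) (G ∘ s) y := by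
  refine ⟨h.nonsingular, h.continuousAt.comp hs, fun e he hu => ?_⟩
  obtain ⟨c, hc⟩ := h.local_eq e he hu
  exact ⟨c, hs.eventually hc⟩

/-- Two developments of the same map differ locally by a constant. -/
theorem IsDevAt.locally_const (h : M.IsDevAt D G u) (h' : M.IsDevAt D' G u) :
    ∃ c : ℂ, ∀ᶠ w in 𝓝 u, D w = D' w + c := by
  obtain ⟨e, he, hu⟩ := h.exists_chart
  obtain ⟨c, hc⟩ := h.local_eq e he hu
  obtain ⟨c', hc'⟩ := h'.local_eq e he hu
  refine ⟨c' - c, ?_⟩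
  filter_upwards [hc, hc'] with w h1 h2
  rw [h1] at h2
  linear_combination h2

theorem eq_add_of_locally_const {A : Set X} (hA : IsPreconnected A)
    (h : ∀ u ∈ A, ∃ c : ℂ, ∀ᶠ w in 𝓝 u, D w = D' w + c) :
    ∃ c : ℂ, ∀ u ∈ A, D u = D' u + c := by
  rcases A.eq_empty_or_nonempty with rfl | ⟨a, ha⟩
  · exact ⟨0, by simp⟩
  have : PreconnectedSpace A := isPreconnected_iff_preconnectedSpace.1 hA
  have hl : IsLocallyConstant fun x : A => D x - D' x := by
    rw [IsLocallyConstant.iff_eventually_eq]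
    rintro ⟨x, hx⟩
    obtain ⟨c, hc⟩ := h x hx
    have h0 := hc.self_of_nhds
    filter_upwards [continuous_subtype_val.continuousAt.eventually hc] with y hy
    rw [hy, h0]
    ring
  refine ⟨D a - D' a, fun u hu => ?_⟩
  have := hl.apply_eq_of_preconnectedSpace ⟨u, hu⟩ ⟨a, ha⟩
  simp only at this
  rw [← this]
  ring

/-- Maps with the same development on a preconnected set agree if they agree at a point. -/
theorem eqOn_of_isDevAt {A : Set X} (hA : IsPreconnected A)
    (h : ∀ u ∈ A, M.IsDevAt D G u) (h' : ∀ u ∈ A, M.IsDevAt D G' u) {a : X} (ha : a ∈ A)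
    (haa : G a = G' a) : EqOn G G' A := by
  have key : ∀ u ∈ A, G u = G' u → ∀ᶠ w in 𝓝 u, G w = G' w := by
    intro u hu huu
    obtain ⟨e, he, hue⟩ := (h u hu).exists_chart
    have hue' : G' u ∈ e.source := huu ▸ hue
    obtain ⟨c, hc⟩ := (h u hu).local_eq e he hue
    obtain ⟨c', hc'⟩ := (h' u hu).local_eq e he hue'
    have hcc : c = c' := by
      have h1 := hc.self_of_nhds
      have h2 := hc'.self_of_nhds
      rw [huu, h2] at h1
      exact (add_left_cancel h1).symm
    filter_upwards [hc, hc', (h u hu).continuousAt.eventually (e.open_source.mem_nhds hue),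
      (h' u hu).continuousAt.eventually (e.open_source.mem_nhds hue')] with w h1 h2 h3 h4
    exact e.injOn h3 h4 (by rw [h1, h2, hcc])
  by_contra hne
  simp only [EqOn, not_forall] at hne
  obtain ⟨b, hb, hbb⟩ := hne
  -- Local agreement is open by `key`, and local disagreement is open by the Hausdorff property; a
  -- connected set cannot meet both.
  obtain ⟨z, hz, hz1, hz2⟩ := hA {u | ∀ᶠ w in 𝓝 u, G w = G' w} {u | ∀ᶠ w in 𝓝 u, G w ≠ G' w}
    isOpen_setOfPred_eventually_nhds isOpen_setOfPred_eventually_nhds (fun u hu => by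
      by_cases huu : G u = G' u
      · exact Or.inl (key u hu huu)
      · refine Or.inr ?_
        have hc := (h u hu).continuousAt.prodMk (h' u hu).continuousAt
        exact hc.eventually (isClosed_diagonal.isOpen_compl.mem_nhds huu)) ⟨a, ha, key a ha haa⟩
      ⟨b, hb, ((h b hb).continuousAt.prodMk (h' b hb).continuousAt).eventually
        (isClosed_diagonal.isOpen_compl.mem_nhds hbb)⟩
  have h1 : G z = G' z := Eventually.self_of_nhds (p := fun w => G w = G' w) hz1
  exact (Eventually.self_of_nhds (p := fun w => G w ≠ G' w) hz2) h1

theorem IsDevAt.of_isConeChart {p : M.carrier} {φ : OpenPartialHomeomorph M.carrier ℂ} {m : ℕ}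
    (hφ : M.IsConeChart p φ m) (hG : ContinuousAt G u) (hu : G u ∈ φ.source)
    (hs : G u ∉ M.singSet) : M.IsDevAt (fun w => φ (G w) ^ m) G u := by
  refine ⟨hs, hG, fun e he hue => ?_⟩
  obtain ⟨c, hc⟩ := hφ.local_eq _ hu e he hue
  exact ⟨c, hG.eventually hc⟩

end Dev

/-- Two `m`-th roots of proportional functions on a preconnected set are proportional. -/
theorem eq_mul_of_pow_eq_mul_pow {X : Type*} [TopologicalSpace X] {A : Set X}
    (hA : IsPreconnected A) {m : ℕ} (hm : m ≠ 0) {g r : X → ℂ} (hg : ContinuousOn g A)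
    (hr : ContinuousOn r A) (hr0 : ∀ a ∈ A, r a ≠ 0) {κ : ℂ}
    (h : ∀ a ∈ A, g a ^ m = κ * r a ^ m) : ∃ l : ℂ, ∀ a ∈ A, g a = l * r a := by
  have hfin : Set.Finite {w : ℂ | w ^ m = κ} := by
    refine ((Polynomial.nthRoots m κ).toFinset.finite_toSet).subset ?_
    intro w hw
    simpa [Polynomial.mem_nthRoots (Nat.pos_of_ne_zero hm)] using hw
  have hmaps : Set.MapsTo (fun z => g z / r z) A {w : ℂ | w ^ m = κ} := by
    intro z hz
    have := hr0 z hz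
    simp only [Set.mem_ofPred_eq, div_pow, h z hz]
    field_simp
  have hsub : ((fun z => g z / r z) '' A).Subsingleton :=
    (hfin.subset hmaps.image_subset).countable.isTotallyDisconnected _ subset_rfl
      (hA.image _ (hg.div hr hr0))
  rcases A.eq_empty_or_nonempty with rfl | ⟨a, ha⟩
  · exact ⟨0, by simp⟩
  refine ⟨g a / r a, fun z hz => ?_⟩
  have h1 := hsub (mem_image_of_mem _ ha) (mem_image_of_mem _ hz)
  change g a / r a = g z / r z at h1
  rw [h1, div_mul_cancel₀ _ (hr0 z hz)]

/-- Induction along an interval. -/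
theorem interval_chain {P : ℝ → ℝ → Prop} {a b : ℝ} (hab : a < b)
    (mono : ∀ s s' t t', s ≤ s' → t' ≤ t → P s t → P s' t')
    (glue : ∀ s s' t t', s ≤ s' → s' < t → t ≤ t' → P s t → P s' t' → P s t')
    (loc : ∀ t ∈ Icc a b, ∃ ε > 0, P (max a (t - ε)) (min b (t + ε))) : P a b := by
  -- The supremum of `S` must be `b`: gluing on the local piece around it would otherwise reach
  -- strictly further.
  let S := {c | c ∈ Icc a b ∧ ∃ ε > 0, P a (min b (c + ε))}
  have haS : a ∈ S := by
    refine ⟨⟨le_rfl, hab.le⟩, ?_⟩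
    obtain ⟨ε, hε, h⟩ := loc a ⟨le_rfl, hab.le⟩
    exact ⟨ε, hε, by rwa [max_eq_left (by linarith)] at h⟩
  have hbdd : BddAbove S := ⟨b, fun c hc => hc.1.2⟩
  obtain ⟨c, hc⟩ : ∃ c, c = sSup S := ⟨_, rfl⟩
  have hca : a ≤ c := hc ▸ le_csSup hbdd haS
  have hcb : c ≤ b := hc ▸ csSup_le ⟨a, haS⟩ fun x hx => hx.1.2
  obtain ⟨ε, hε, hP⟩ := loc c ⟨hca, hcb⟩
  obtain ⟨c', hc'S, hc'⟩ : ∃ c' ∈ S, c - ε < c' :=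
    exists_lt_of_lt_csSup ⟨a, haS⟩ (by rw [← hc]; linarith)
  obtain ⟨ε', hε', hP'⟩ := hc'S.2
  have hPc : P a (min b (c + ε)) := by
    rcases le_total (min b (c' + ε')) (min b (c + ε)) with h | h
    · refine glue _ _ _ _ (le_max_left _ _) ?_ h hP' hP
      rw [max_lt_iff, lt_min_iff, lt_min_iff]
      exact ⟨⟨hab, by linarith [hc'S.1.1]⟩, by linarith, by linarith⟩
    · exact mono _ _ _ _ le_rfl h hP'
  rcases hcb.lt_or_eq with hlt | heq
  · exfalso
    have : min b (c + ε / 2) ∈ S := by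
      refine ⟨⟨le_min hab.le (by linarith), min_le_left _ _⟩, ε / 2, by positivity, ?_⟩
      refine mono _ _ _ _ le_rfl (le_min (min_le_left _ _) ?_) hPc
      exact (min_le_right _ _).trans (by linarith [min_le_right b (c + ε / 2)])
    have h2 := hc ▸ le_csSup hbdd this
    rcases min_le_iff.1 h2 with h | h <;> linarith
  · rwa [min_eq_left (by linarith)] at hPc

end TranslationSurface

/-! ### Flat strips around a trajectory. -/

namespace TranslationSurface

open Filter Set

variable {k : ℕ} {α : Fin k → ℕ}

theorem convex_box (a b c d : ℝ) : Convex ℝ (Ioo a b ×ℂ Ioo c d) :=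
  ((convex_Ioo a b).linear_preimage Complex.reLm).inter
    ((convex_Ioo c d).linear_preimage Complex.imLm)

theorem isOpen_box (a b c d : ℝ) : IsOpen (Ioo a b ×ℂ Ioo c d) := isOpen_Ioo.reProdIm isOpen_Ioo

theorem exists_box_subset {p : ℂ} {V : Set ℂ} (hV : V ∈ 𝓝 p) : ∃ ε > 0,
    Ioo (p.re - ε) (p.re + ε) ×ℂ Ioo (p.im - ε) (p.im + ε) ⊆ V := by
  obtain ⟨r, hr, h⟩ := Metric.mem_nhds_iff.1 hV
  refine ⟨r / 2, by positivity, fun u hu => h ?_⟩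
  rw [Complex.mem_reProdIm, mem_Ioo, mem_Ioo] at hu
  rw [Metric.mem_ball, dist_eq_norm]
  have h1 : |(u - p).re| < r / 2 := by rw [abs_lt]; simp; constructor <;> linarith
  have h2 : |(u - p).im| < r / 2 := by rw [abs_lt]; simp; constructor <;> linarith
  linarith [Complex.norm_le_abs_re_add_abs_im (u - p)]

/-- Induction along `(0, 1)` for conditions on rectangles `(s, t) × (-δ, δ)`. -/
theorem box_glue {P : ℝ → ℝ → ℝ → Prop} (h0 : ∃ ε > 0, P 0 ε ε) (h1 : ∃ ε > 0, P (1 - ε) 1 ε)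
    (mid : ∀ t ∈ Ioo (0 : ℝ) 1, ∃ ε > 0, P (t - ε) (t + ε) ε)
    (mono : ∀ s s' t t' δ δ', s ≤ s' → t' ≤ t → δ' ≤ δ → P s t δ → P s' t' δ')
    (glue : ∀ s s' t t' δ, 0 < δ → s ≤ s' → s' < t → t ≤ t' → P s t δ → P s' t' δ → P s t' δ) : ∃ δ > 0, P 0 1 δ := by
  let Q : ℝ → ℝ → Prop := fun s t => ∃ δ > 0, P (max 0 s) (min 1 t) δ
  have hQ : Q 0 1 := by
    refine interval_chain one_pos ?_ ?_ ?_
    · rintro s s' t t' hs ht ⟨δ, hδ, h⟩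
      exact ⟨δ, hδ, mono _ _ _ _ _ _ (max_le_max le_rfl hs) (min_le_min le_rfl ht) le_rfl h⟩
    · rintro s s' t t' hs hst ht ⟨δ, hδ, h⟩ ⟨δ', hδ', h'⟩
      refine ⟨min δ δ', lt_min hδ hδ', ?_⟩
      have h2 := mono _ _ _ _ _ _ le_rfl le_rfl (min_le_left δ δ') h
      have h2' := mono _ _ _ _ _ _ le_rfl le_rfl (min_le_right δ δ') h'
      rcases lt_or_ge (max 0 s') (min 1 t) with hlt | hge
      · exact glue _ _ _ _ _ (lt_min hδ hδ')
          (max_le_max le_rfl hs) hlt (min_le_min le_rfl ht) h2 h2'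
      · rcases le_or_gt t 0 with h3 | h3
        · refine mono _ _ _ _ _ _ ?_ le_rfl le_rfl h2'
          rw [max_eq_left (by linarith)]
          exact le_max_left _ _
        · have h4 : 1 ≤ s' := by
            by_contra hcon
            rw [not_le] at hcon
            exact absurd hge (not_le.2 (max_lt (lt_min one_pos h3) (lt_min hcon hst)))
          refine mono _ _ _ _ _ _ le_rfl ?_ le_rfl h2
          rw [min_eq_left (by linarith : (1 : ℝ) ≤ t)]
          exact min_le_left _ _
    · rintro t ⟨ht0, ht1⟩
      rcases ht0.eq_or_lt with rfl | ht0
      · obtain ⟨ε, hε, h⟩ := h0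
        exact ⟨ε, hε, ε, hε, mono _ _ _ _ _ _ (le_max_left _ _)
          ((min_le_right _ _).trans ((min_le_right _ _).trans (by simp))) le_rfl h⟩
      rcases ht1.eq_or_lt with rfl | ht1
      · obtain ⟨ε, hε, h⟩ := h1
        exact ⟨ε, hε, ε, hε, mono _ _ _ _ _ _ ((le_max_right _ _).trans (le_max_right _ _))
          (min_le_left _ _) le_rfl h⟩
      · obtain ⟨ε, hε, h⟩ := mid t ⟨ht0, ht1⟩
        exact ⟨ε, hε, ε, hε, mono _ _ _ _ _ _ ((le_max_right _ _).trans (le_max_right _ _))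
          ((min_le_right _ _).trans (min_le_right _ _)) le_rfl h⟩
  obtain ⟨δ, hδ, h⟩ := hQ
  exact ⟨δ, hδ, by simpa using h⟩

/-- A condition that holds near `(0, 1) ⊂ ℂ`, uniformly at the ends, holds on a thin rectangle. -/
theorem exists_box_forall {S : ℂ → Prop}
    (h0 : ∃ ε > 0, ∀ u ∈ Ioo (0 : ℝ) ε ×ℂ Ioo (-ε) ε, S u)
    (h1 : ∃ ε > 0, ∀ u ∈ Ioo (0 : ℝ) ε ×ℂ Ioo (-ε) ε, S (1 - u))
    (mid : ∀ t ∈ Ioo (0 : ℝ) 1, ∀ᶠ u in 𝓝 (t : ℂ), S u) :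
    ∃ δ > 0, ∀ u ∈ Ioo (0 : ℝ) 1 ×ℂ Ioo (-δ) δ, S u := by
  refine box_glue (P := fun s t δ => ∀ u ∈ Ioo s t ×ℂ Ioo (-δ) δ, S u) h0 ?_ ?_ ?_ ?_
  · obtain ⟨ε, hε, h⟩ := h1
    refine ⟨ε, hε, fun u hu => ?_⟩
    rw [← sub_sub_cancel 1 u]
    refine h _ ?_
    simp only [Complex.mem_reProdIm, mem_Ioo, Complex.sub_re, Complex.sub_im, Complex.one_re,
      Complex.one_im] at hu ⊢
    refine ⟨⟨?_, ?_⟩, ?_, ?_⟩ <;> linarith [hu.1.1, hu.1.2, hu.2.1, hu.2.2]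
  · intro t ht
    obtain ⟨ε, hε, h⟩ := exists_box_subset (mid t ht)
    exact ⟨ε, hε, fun u hu => h (by simpa using hu)⟩
  · intro s s' t t' δ δ' hs ht hδ h u hu
    refine h u ?_
    simp only [Complex.mem_reProdIm, mem_Ioo] at hu ⊢
    refine ⟨⟨?_, ?_⟩, ?_, ?_⟩ <;> linarith [hu.1.1, hu.1.2, hu.2.1, hu.2.2]
  · intro s s' t t' δ _ hs hst ht h h' u hu
    simp only [Complex.mem_reProdIm, mem_Ioo] at hu h h'
    rcases lt_or_ge u.re t with hut | hut
    · exact h u ⟨⟨hu.1.1, hut⟩, hu.2⟩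
    · exact h' u ⟨⟨by linarith, hu.1.2⟩, hu.2⟩

variable {M : TranslationSurface α}

theorem IsTrajectory.exists_isDevAt {x y : M.carrier} {γ : ℝ → M.carrier}
    (h : M.IsTrajectory x y γ) :
    ∃ v : ℂ, v ≠ 0 ∧ ∀ t ∈ Ioo (0 : ℝ) 1, M.IsDevAt (fun s : ℝ => (s : ℂ) * v) γ t := by
  obtain ⟨v, hv, hs⟩ := h.straight
  exact ⟨v, hv, fun t ht => ⟨h.nonsingular t ht,
    h.continuousOn.continuousAt (Icc_mem_nhds ht.1 ht.2), hs t ht⟩⟩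

theorem IsDevAt.reverse {v : ℂ} {γ : ℝ → M.carrier} {t : ℝ}
    (h : M.IsDevAt (fun s : ℝ => (s : ℂ) * v) γ (1 - t)) :
    M.IsDevAt (fun s : ℝ => (s : ℂ) * -v) (fun s => γ (1 - s)) t := by
  refine (IsDevAt.comp (s := fun s : ℝ => 1 - s) h (by fun_prop)).congr (EventuallyEq.refl _ _)
    ⟨v, Eventually.of_forall fun s => ?_⟩
  simp
  ring

theorem IsDevAt.reverse_complex {v : ℂ} {G : ℂ → M.carrier} {u : ℂ}
    (h : M.IsDevAt (fun w => w * v) G (1 - u)) :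
    M.IsDevAt (fun w => w * -v) (fun w => G (1 - w)) u := by
  refine (IsDevAt.comp (s := fun s : ℂ => 1 - s) h (by fun_prop)).congr (EventuallyEq.refl _ _)
    ⟨v, Eventually.of_forall fun s => ?_⟩
  simp
  ring

/-- The `m`-th power of the cone coordinate develops the path, so it equals `t * v`. Its quotient by
the principal root of `t` takes values in a finite set and is therefore constant; this constant `l`
records the direction of departure on the cone. -/
theorem exists_root_of_isDevAt {x : M.carrier} {γ : ℝ → M.carrier} {v : ℂ}
    (hdev : ∀ t ∈ Ioo (0 : ℝ) 1, M.IsDevAt (fun s : ℝ => (s : ℂ) * v) γ t)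
    (h0 : Tendsto γ (𝓝[>] 0) (𝓝 x)) {φ : OpenPartialHomeomorph M.carrier ℂ} {m : ℕ}
    (hφ : M.IsConeChart x φ m) :
    ∃ ε > 0, ∃ l : ℂ, l ^ m = v ∧ ∀ t ∈ Ioo (0 : ℝ) ε, t < 1 ∧ γ t ∈ φ.source ∧
      φ (γ t) = l * (t : ℂ) ^ ((m : ℂ)⁻¹) := by
  have hev : ∀ᶠ t in 𝓝[>] (0 : ℝ), t < 1 ∧ γ t ∈ φ.source :=
    (eventually_nhdsWithin_of_eventually_nhds (eventually_lt_nhds one_pos)).and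
      (h0.eventually (φ.open_source.mem_nhds hφ.mem_source))
  obtain ⟨ε, hε, hs⟩ := mem_nhdsGT_iff_exists_Ioo_subset.1 hev
  have hε : 0 < ε := hε
  have hγc : ∀ t ∈ Ioo 0 ε, ContinuousAt (fun t => φ (γ t)) t := fun t ht =>
    (φ.continuousAt (hs ht).2).comp (hdev t ⟨ht.1, (hs ht).1⟩).continuousAt
  obtain ⟨c, hc⟩ := eq_add_of_locally_const (D := fun t => φ (γ t) ^ m)
    (D' := fun s : ℝ => (s : ℂ) * v) (isPreconnected_Ioo (a := 0) (b := ε)) (fun t ht => by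
      have hd := hdev t ⟨ht.1, (hs ht).1⟩
      exact (IsDevAt.of_isConeChart hφ hd.continuousAt (hs ht).2 hd.nonsingular).locally_const hd)
  have hIoo : Ioo 0 ε ∈ 𝓝[>] (0 : ℝ) := Ioo_mem_nhdsGT hε
  -- Both sides are compared as `t` tends to `0`, where the path tends to the centre of the chart.
  have hc0 : c = 0 := by
    have l1 : Tendsto (fun t => φ (γ t) ^ m) (𝓝[>] (0 : ℝ)) (𝓝 0) := by
      have := ((φ.continuousAt hφ.mem_source).tendsto.comp h0).pow m
      rwa [hφ.map_self, zero_pow hφ.ne_zero] at this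
    have l2 : Tendsto (fun t : ℝ => (t : ℂ) * v + c) (𝓝[>] (0 : ℝ)) (𝓝 c) := by
      have : Continuous fun t : ℝ => (t : ℂ) * v + c := by fun_prop
      have := this.tendsto 0
      simp only [Complex.ofReal_zero, zero_mul, zero_add] at this
      exact this.mono_left nhdsWithin_le_nhds
    refine (tendsto_nhds_unique (l1.congr' ?_) l2).symm
    filter_upwards [hIoo] with t ht using hc t ht
  subst hc0
  have hroot : ∀ t : ℝ, ((t : ℂ) ^ ((m : ℂ)⁻¹)) ^ m = t := fun t =>
    Complex.cpow_nat_inv_pow _ hφ.ne_zero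
  have hne : ∀ t ∈ Ioo 0 ε, (t : ℂ) ^ ((m : ℂ)⁻¹) ≠ 0 := by
    intro t ht h
    have := hroot t
    rw [h, zero_pow hφ.ne_zero] at this
    exact ht.1.ne (by exact_mod_cast this)
  obtain ⟨l, hl⟩ := eq_mul_of_pow_eq_mul_pow (isPreconnected_Ioo (a := 0) (b := ε)) hφ.ne_zero
    (g := fun t => φ (γ t)) (r := fun t : ℝ => (t : ℂ) ^ ((m : ℂ)⁻¹)) (κ := v)
    (fun t ht => (hγc t ht).continuousWithinAt)
    (fun t ht => by
      refine ContinuousAt.continuousWithinAt ?_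
      exact ContinuousAt.cpow (by fun_prop) continuousAt_const
        (Complex.ofReal_mem_slitPlane.2 ht.1)) hne (fun t ht => by
      simp only [hroot, hc t ht]
      ring)
  refine ⟨ε, hε, l, ?_, fun t ht => ⟨(hs ht).1, (hs ht).2, hl t ht⟩⟩
  have hmem : ε / 2 ∈ Ioo 0 ε := ⟨by linarith, by linarith⟩
  have h1 := hc _ hmem
  simp only [hl _ hmem, mul_pow, hroot, add_zero] at h1
  have : ((ε / 2 : ℝ) : ℂ) ≠ 0 := by exact_mod_cast hmem.1.ne'
  rw [mul_comm] at h1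
  exact mul_left_cancel₀ this h1

/-- The sector map `u ↦ φ⁻¹ (l u ^ (1 / m))` near the centre of a cone chart. -/
theorem IsConeChart.exists_sector {x : M.carrier} {φ : OpenPartialHomeomorph M.carrier ℂ} {m : ℕ}
    (hφ : M.IsConeChart x φ m) {l : ℂ} (hl : l ≠ 0) :
    ∃ ε > 0, ∀ u ∈ Ioo (0 : ℝ) ε ×ℂ Ioo (-ε) ε, l * u ^ ((m : ℂ)⁻¹) ∈ φ.target ∧
      M.IsDevAt (fun w => w * l ^ m) (fun w => φ.symm (l * w ^ ((m : ℂ)⁻¹))) u := by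
  have hm : 0 < ((m : ℂ)⁻¹).re := by
    rw [← Complex.ofReal_natCast, ← Complex.ofReal_inv, Complex.ofReal_re]
    have := Nat.pos_of_ne_zero hφ.ne_zero
    positivity
  -- The principal root is continuous on the closed right half-plane, the origin included; this is
  -- why the boxes lie to the right of the apex.
  have hc : ∀ u : ℂ, 0 ≤ u.re → ContinuousAt (fun w : ℂ => l * w ^ ((m : ℂ)⁻¹)) u := fun u hu =>
    continuousAt_const.mul (Complex.continuousAt_cpow_const_of_re_pos (Or.inl hu) hm)
  have h0 : (0 : ℂ) ∈ φ.target := hφ.map_self ▸ φ.map_source hφ.mem_source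
  have hev : ∀ᶠ u in 𝓝 (0 : ℂ), l * u ^ ((m : ℂ)⁻¹) ∈ φ.target := by
    refine (hc 0 le_rfl).eventually (φ.open_target.mem_nhds ?_)
    have hm0 : (m : ℂ)⁻¹ ≠ 0 := fun h => by rw [h] at hm; exact hm.ne rfl
    simpa only [Complex.zero_cpow hm0, mul_zero] using h0
  obtain ⟨ε, hε, h⟩ := exists_box_subset hev
  refine ⟨ε, hε, fun u hu => ?_⟩
  have hut : l * u ^ ((m : ℂ)⁻¹) ∈ φ.target := h (by
    simp only [Complex.mem_reProdIm, mem_Ioo, Complex.zero_re, Complex.zero_im] at hu ⊢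
    refine ⟨⟨?_, ?_⟩, ?_, ?_⟩ <;> linarith [hu.1.1, hu.1.2, hu.2.1, hu.2.2])
  have hre : 0 < u.re := hu.1.1
  have hu0 : u ≠ 0 := by rintro rfl; simp at hre
  have hcu := hc u hre.le
  have hcont : ContinuousAt (fun w => φ.symm (l * w ^ ((m : ℂ)⁻¹))) u :=
    ContinuousAt.comp (f := fun w : ℂ => l * w ^ ((m : ℂ)⁻¹)) (φ.symm.continuousAt hut) hcu
  refine ⟨hut, (IsDevAt.of_isConeChart hφ hcont (φ.map_target hut) ?_).congr (EventuallyEq.refl _ _)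
    ⟨0, ?_⟩⟩
  · refine hφ.nonsingular _ (φ.map_target hut) fun h => ?_
    have := congrArg φ h
    rw [φ.right_inv hut, hφ.map_self] at this
    rcases mul_eq_zero.1 this with h | h
    · exact hl h
    · exact hu0 ((Complex.cpow_eq_zero_iff _ _).1 h).1
  · filter_upwards [hcu.eventually (φ.open_target.mem_nhds hut)] with w hw
    rw [φ.right_inv hw, mul_pow, Complex.cpow_nat_inv_pow _ hφ.ne_zero]
    ring

theorem exists_strip_start {x : M.carrier} {γ : ℝ → M.carrier} {v : ℂ} (hv : v ≠ 0)
    (hdev : ∀ t ∈ Ioo (0 : ℝ) 1, M.IsDevAt (fun s : ℝ => (s : ℂ) * v) γ t)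
    (h0 : Tendsto γ (𝓝[>] 0) (𝓝 x)) {φ : OpenPartialHomeomorph M.carrier ℂ} {m : ℕ}
    (hφ : M.IsConeChart x φ m) :
    ∃ l : ℂ, l ^ m = v ∧ ∃ ε > 0, (∀ u ∈ Ioo (0 : ℝ) ε ×ℂ Ioo (-ε) ε,
      l * u ^ ((m : ℂ)⁻¹) ∈ φ.target ∧
      M.IsDevAt (fun w => w * v) (fun w => φ.symm (l * w ^ ((m : ℂ)⁻¹))) u) ∧
      ∀ t ∈ Ioo (0 : ℝ) ε, φ.symm (l * (t : ℂ) ^ ((m : ℂ)⁻¹)) = γ t := by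
  obtain ⟨ε, hε, l, hl, h⟩ := exists_root_of_isDevAt hdev h0 hφ
  have hl0 : l ≠ 0 := by
    rintro rfl
    rw [zero_pow hφ.ne_zero] at hl
    exact hv hl.symm
  obtain ⟨ε', hε', h'⟩ := hφ.exists_sector hl0
  refine ⟨l, hl, min ε ε', lt_min hε hε', fun u hu => ?_, fun t ht => ?_⟩
  · rw [hl] at h'
    refine h' u ?_
    have := min_le_right ε ε'
    simp only [Complex.mem_reProdIm, mem_Ioo] at hu ⊢
    refine ⟨⟨?_, ?_⟩, ?_, ?_⟩ <;> linarith [hu.1.1, hu.1.2, hu.2.1, hu.2.2]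
  · obtain ⟨h1, h2, h3⟩ := h t ⟨ht.1, ht.2.trans_le (min_le_left _ _)⟩
    rw [← h3, φ.left_inv h2]

/-- Sector maps at the two ends give pieces of strip whose width does not shrink towards the
endpoint, and charts give pieces in between. Overlapping pieces have the same development and agree
on the core, so they glue. -/
theorem exists_strip {x y : M.carrier} {γ : ℝ → M.carrier} {v : ℂ} (hv : v ≠ 0)
    (hdev : ∀ t ∈ Ioo (0 : ℝ) 1, M.IsDevAt (fun s : ℝ => (s : ℂ) * v) γ t)
    (h0 : Tendsto γ (𝓝[>] 0) (𝓝 x)) (h1 : Tendsto (fun t => γ (1 - t)) (𝓝[>] 0) (𝓝 y)) :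
    ∃ δ > 0, ∃ G : ℂ → M.carrier,
      (∀ u ∈ Ioo (0 : ℝ) 1 ×ℂ Ioo (-δ) δ, M.IsDevAt (fun w => w * v) G u) ∧
      ∀ t ∈ Ioo (0 : ℝ) 1, G t = γ t := by
  refine box_glue (P := fun s t δ => ∃ G : ℂ → M.carrier,
      (∀ u ∈ Ioo s t ×ℂ Ioo (-δ) δ, M.IsDevAt (fun w => w * v) G u) ∧
      ∀ r ∈ Ioo s t, G r = γ r) ?_ ?_ ?_ ?_ ?_
  · obtain ⟨φ, m, hφ⟩ := M.exists_isConeChart x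
    obtain ⟨l, -, ε, hε, h, h'⟩ := exists_strip_start hv hdev h0 hφ
    exact ⟨ε, hε, _, fun u hu => (h u hu).2, h'⟩
  · obtain ⟨φ, m, hφ⟩ := M.exists_isConeChart y
    obtain ⟨l, -, ε, hε, h, h'⟩ := exists_strip_start (neg_ne_zero.2 hv) (fun t ht =>
      (hdev (1 - t) ⟨by linarith [ht.2], by linarith [ht.1]⟩).reverse) h1 hφ
    refine ⟨ε, hε, fun w => φ.symm (l * (1 - w) ^ ((m : ℂ)⁻¹)), fun u hu => ?_, fun r hr => ?_⟩
    · have := (h (1 - u) (by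
        simp only [Complex.mem_reProdIm, mem_Ioo, Complex.sub_re, Complex.sub_im, Complex.one_re,
          Complex.one_im] at hu ⊢
        refine ⟨⟨?_, ?_⟩, ?_, ?_⟩ <;> linarith [hu.1.1, hu.1.2, hu.2.1, hu.2.2])).2.reverse_complex
      rwa [neg_neg] at this
    · have := h' (1 - r) ⟨by linarith [hr.2], by linarith [hr.1]⟩
      rw [sub_sub_cancel] at this
      rw [← this]
      push_cast
      rfl
  · intro t ht
    obtain ⟨e, he, hte⟩ := (hdev t ht).exists_chart
    obtain ⟨c, hc⟩ := (hdev t ht).local_eq e he hte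
    have hct := hc.self_of_nhds
    have hmap : ContinuousAt (fun w : ℂ => w * v + c) t := by fun_prop
    have htar : ∀ᶠ w in 𝓝 (t : ℂ), w * v + c ∈ e.target :=
      hmap.eventually (e.open_target.mem_nhds (by simpa only [← hct] using e.map_source hte))
    obtain ⟨ε, hε, h⟩ := exists_box_subset htar
    obtain ⟨ε', hε', h'⟩ := Metric.eventually_nhds_iff.1
      (hc.and ((hdev t ht).continuousAt.eventually (e.open_source.mem_nhds hte)))
    have hsub : ∀ u ∈ Ioo (t - min ε ε') (t + min ε ε') ×ℂ Ioo (-min ε ε') (min ε ε'),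
        u * v + c ∈ e.target := fun u hu => h (by
      have := min_le_left ε ε'
      simp only [Complex.mem_reProdIm, mem_Ioo, Complex.ofReal_re, Complex.ofReal_im] at hu ⊢
      refine ⟨⟨?_, ?_⟩, ?_, ?_⟩ <;> linarith [hu.1.1, hu.1.2, hu.2.1, hu.2.2])
    refine ⟨min ε ε', lt_min hε hε', fun w => e.symm (w * v + c), fun u hu => ?_, fun r hr => ?_⟩
    · have hut := hsub u hu
      have hmap : ContinuousAt (fun w : ℂ => w * v + c) u := by fun_prop
      refine ⟨M.nonsing_of_chart he (e.map_target hut),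
        ContinuousAt.comp (f := fun w : ℂ => w * v + c) (e.symm.continuousAt hut) hmap,
        fun e' he' hue' => ?_⟩
      obtain ⟨c', hc'⟩ := M.transition e he e' he' _ (e.map_target hut) hue'
      refine ⟨c + c', ?_⟩
      filter_upwards [(ContinuousAt.comp (f := fun w : ℂ => w * v + c)
        (e.symm.continuousAt hut) hmap).eventually hc',
        hmap.eventually (e.open_target.mem_nhds hut)] with w h1 h2
      simp only [Function.comp] at h1
      rw [h1, e.right_inv h2]
      ring
    · have hd : dist r t < ε' := by
        rw [Real.dist_eq, abs_lt]
        have := min_le_right ε ε'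
        constructor <;> linarith [hr.1, hr.2]
      simp only [← (h' hd).1, e.left_inv (h' hd).2]
  · rintro s s' t t' δ δ' hs ht hδ ⟨G, hG, hr⟩
    refine ⟨G, fun u hu => hG u ?_, fun r h => hr r ⟨by linarith [h.1], by linarith [h.2]⟩⟩
    simp only [Complex.mem_reProdIm, mem_Ioo] at hu ⊢
    refine ⟨⟨?_, ?_⟩, ?_, ?_⟩ <;> linarith [hu.1.1, hu.1.2, hu.2.1, hu.2.2]
  · rintro s s' t t' δ hδ hs hst ht ⟨G, hG, hr⟩ ⟨G', hG', hr'⟩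
    have heq : EqOn G G' (Ioo s' t ×ℂ Ioo (-δ) δ) := by
      have hmem : ((s' + t) / 2) ∈ Ioo s' t := ⟨by linarith, by linarith⟩
      refine eqOn_of_isDevAt (convex_box _ _ _ _).isPreconnected
        (D := fun w => w * v) (a := (((s' + t) / 2 : ℝ) : ℂ)) ?_ ?_ ?_ ?_
      · exact fun u hu => hG u ⟨⟨hs.trans_lt hu.1.1, hu.1.2⟩, hu.2⟩
      · exact fun u hu => hG' u ⟨⟨hu.1.1, hu.1.2.trans_le ht⟩, hu.2⟩
      · rw [Complex.mem_reProdIm]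
        exact ⟨hmem, by simpa using hδ⟩
      · rw [hr _ ⟨hs.trans_lt hmem.1, hmem.2⟩, hr' _ ⟨hmem.1, hmem.2.trans_le ht⟩]
    classical
    refine ⟨fun u => if u.re < t then G u else G' u, fun u hu => ?_, fun r h => ?_⟩
    · rcases lt_or_ge u.re t with hut | hut
      · refine (hG u ⟨⟨hu.1.1, hut⟩, hu.2⟩).congr_map ?_
        filter_upwards [Complex.continuous_re.continuousAt.eventually (eventually_lt_nhds hut)]
          with w hw
        rw [if_pos hw]
      · refine (hG' u ⟨⟨hst.trans_le hut, hu.1.2⟩, hu.2⟩).congr_map ?_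
        filter_upwards [(isOpen_box s' t' (-δ) δ).mem_nhds ⟨⟨hst.trans_le hut, hu.1.2⟩, hu.2⟩]
          with w hw
        split_ifs with h
        · exact (heq ⟨⟨hw.1.1, h⟩, hw.2⟩).symm
        · rfl
    · simp only [Complex.ofReal_re]
      split_ifs with h2
      · exact hr r ⟨h.1, h2⟩
      · exact hr' r ⟨hst.trans_le (not_lt.1 h2), h.2⟩

/-- By unique continuation from the core, the glued strip is still the sector map near its end,
whichever cone chart is used. -/
theorem strip_start_eq {x : M.carrier} {γ : ℝ → M.carrier} {v : ℂ} (hv : v ≠ 0)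
    (hdev : ∀ t ∈ Ioo (0 : ℝ) 1, M.IsDevAt (fun s : ℝ => (s : ℂ) * v) γ t)
    (h0 : Tendsto γ (𝓝[>] 0) (𝓝 x)) {φ : OpenPartialHomeomorph M.carrier ℂ} {m : ℕ}
    (hφ : M.IsConeChart x φ m) {δ : ℝ} (hδ : 0 < δ) {G : ℂ → M.carrier}
    (hG : ∀ u ∈ Ioo (0 : ℝ) 1 ×ℂ Ioo (-δ) δ, M.IsDevAt (fun w => w * v) G u)
    (hr : ∀ t ∈ Ioo (0 : ℝ) 1, G t = γ t) :
    ∃ l : ℂ, l ^ m = v ∧ ∃ ε > 0, ∀ u ∈ Ioo (0 : ℝ) ε ×ℂ Ioo (-ε) ε,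
      G u ∈ φ.source ∧ φ (G u) = l * u ^ ((m : ℂ)⁻¹) := by
  obtain ⟨l, hl, ε, hε, h1, h2⟩ := exists_strip_start hv hdev h0 hφ
  obtain ⟨ρ, hρ, hρε, hρδ, hρ1⟩ : ∃ ρ > 0, ρ ≤ ε ∧ ρ ≤ δ ∧ ρ ≤ 1 :=
    ⟨min ε (min δ 1), by positivity, min_le_left _ _, (min_le_right _ _).trans (min_le_left _ _),
      (min_le_right _ _).trans (min_le_right _ _)⟩
  have hs1 : ∀ u ∈ Ioo 0 ρ ×ℂ Ioo (-ρ) ρ, u ∈ Ioo 0 ε ×ℂ Ioo (-ε) ε := fun u hu => by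
    simp only [Complex.mem_reProdIm, mem_Ioo] at hu ⊢
    refine ⟨⟨?_, ?_⟩, ?_, ?_⟩ <;> linarith [hu.1.1, hu.1.2, hu.2.1, hu.2.2]
  have hs2 : ∀ u ∈ Ioo 0 ρ ×ℂ Ioo (-ρ) ρ, u ∈ Ioo 0 1 ×ℂ Ioo (-δ) δ := fun u hu => by
    simp only [Complex.mem_reProdIm, mem_Ioo] at hu ⊢
    refine ⟨⟨?_, ?_⟩, ?_, ?_⟩ <;> linarith [hu.1.1, hu.1.2, hu.2.1, hu.2.2]
  have heq := eqOn_of_isDevAt (convex_box 0 ρ (-ρ) ρ).isPreconnected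
    (fun u hu => hG u (hs2 u hu)) (fun u hu => (h1 u (hs1 u hu)).2)
    (a := ((ρ / 2 : ℝ) : ℂ)) (by
      simp only [Complex.mem_reProdIm, mem_Ioo, Complex.ofReal_re, Complex.ofReal_im]
      refine ⟨⟨?_, ?_⟩, ?_, ?_⟩ <;> linarith) (by
      rw [hr _ ⟨by linarith, by linarith⟩, h2 _ ⟨by linarith, by linarith⟩])
  refine ⟨l, hl, ρ, hρ, fun u hu => ?_⟩
  rw [heq hu]
  exact ⟨φ.map_target (h1 u (hs1 u hu)).1, φ.right_inv (h1 u (hs1 u hu)).1⟩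

end TranslationSurface

/-! ### Primitive trajectories and immersed rhombi. -/

namespace TranslationSurface

open Filter Set

variable {k : ℕ} {α : Fin k → ℕ}

/-- The open rhombus with diagonal `[0, 1]` and slope `κ`. -/
def rhombus (κ : ℝ) : Set ℂ := {u | |u.im| < κ * u.re ∧ |u.im| < κ * (1 - u.re)}

theorem re_of_mem_rhombus {κ : ℝ} (hκ : 0 < κ) {u : ℂ} (hu : u ∈ rhombus κ) :
    0 < u.re ∧ u.re < 1 := by
  have h1 := (abs_nonneg _).trans_lt hu.1
  have h2 := (abs_nonneg _).trans_lt hu.2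
  constructor
  · exact pos_of_mul_pos_right h1 hκ.le
  · linarith [pos_of_mul_pos_right h2 hκ.le]

theorem rhombus_subset_box {κ : ℝ} (hκ : 0 < κ) : rhombus κ ⊆ Ioo 0 1 ×ℂ Ioo (-κ) κ := by
  intro u hu
  obtain ⟨h1, h2⟩ := re_of_mem_rhombus hκ hu
  exact ⟨⟨h1, h2⟩, abs_lt.1 (hu.1.trans (by nlinarith))⟩

theorem isOpen_rhombus (κ : ℝ) : IsOpen (rhombus κ) :=
  (isOpen_lt Complex.continuous_im.abs (continuous_const.mul Complex.continuous_re)).inter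
    (isOpen_lt Complex.continuous_im.abs
      (continuous_const.mul (continuous_const.sub Complex.continuous_re)))

theorem convex_rhombus (κ : ℝ) : Convex ℝ (rhombus κ) := by
  intro u hu w hw a b ha hb hab
  have him : |(a • u + b • w).im| ≤ a * |u.im| + b * |w.im| := by
    have := abs_add_le (a * u.im) (b * w.im)
    rw [abs_mul, abs_mul, abs_of_nonneg ha, abs_of_nonneg hb] at this
    simpa using this
  obtain rfl : b = 1 - a := by linarith
  obtain ⟨hu1, hu2⟩ := hu
  obtain ⟨hw1, hw2⟩ := hw
  have hre : (a • u + (1 - a) • w).re = a * u.re + (1 - a) * w.re := by simp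
  rcases ha.eq_or_lt with rfl | ha
  · exact ⟨by simpa using hw1, by simpa using hw2⟩
  constructor
  · refine him.trans_lt ?_
    rw [hre]
    nlinarith [mul_lt_mul_of_pos_left hu1 ha, mul_le_mul_of_nonneg_left hw1.le hb]
  · refine him.trans_lt ?_
    rw [hre]
    nlinarith [mul_lt_mul_of_pos_left hu2 ha, mul_le_mul_of_nonneg_left hw2.le hb]

theorem one_sub_mem_rhombus {κ : ℝ} {u : ℂ} (hu : u ∈ rhombus κ) : 1 - u ∈ rhombus κ := by
  obtain ⟨h1, h2⟩ := hu
  constructor <;> simpa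

theorem ofReal_mem_rhombus {κ : ℝ} (hκ : 0 < κ) {t : ℝ} (ht : t ∈ Ioo (0 : ℝ) 1) :
    (t : ℂ) ∈ rhombus κ := by
  constructor
  · simpa using mul_pos hκ ht.1
  · simpa using mul_pos hκ (sub_pos.2 ht.2)

/-- A trajectory which does not return to its endpoints. -/
structure IsPrimitive (M : TranslationSurface α) (x y : M.carrier) (γ : ℝ → M.carrier) :
    Prop where
  isTrajectory : M.IsTrajectory x y γ
  ne_left : ∀ t ∈ Ioo (0 : ℝ) 1, γ t ≠ x
  ne_right : ∀ t ∈ Ioo (0 : ℝ) 1, γ t ≠ y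

/-- A flat immersed rhombus around a trajectory. -/
structure IsDiamond (M : TranslationSurface α) (x y : M.carrier) (γ : ℝ → M.carrier) (v : ℂ)
    (κ : ℝ) (G : ℂ → M.carrier) : Prop where
  ne_zero : v ≠ 0
  pos : 0 < κ
  isDevAt : ∀ u ∈ rhombus κ, M.IsDevAt (fun w => w * v) G u
  ne_left : ∀ u ∈ rhombus κ, G u ≠ x
  ne_right : ∀ u ∈ rhombus κ, G u ≠ y
  real : ∀ t ∈ Icc (0 : ℝ) 1, G t = γ t
  left : ∀ φ m, M.IsConeChart x φ m → ∃ l : ℂ, l ^ m = v ∧ ∀ᶠ u in 𝓝[rhombus κ] 0,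
    G u ∈ φ.source ∧ φ (G u) = l * u ^ ((m : ℂ)⁻¹)
  right : ∀ φ m, M.IsConeChart y φ m → ∃ l : ℂ, l ^ m = -v ∧ ∀ᶠ u in 𝓝[rhombus κ] 0,
    G (1 - u) ∈ φ.source ∧ φ (G (1 - u)) = l * u ^ ((m : ℂ)⁻¹)

variable {M : TranslationSurface α} {x y : M.carrier} {γ : ℝ → M.carrier}

theorem IsTrajectory.tendsto_left (h : M.IsTrajectory x y γ) : Tendsto γ (𝓝[>] 0) (𝓝 x) := by
  have := h.continuousOn 0 ⟨le_rfl, zero_le_one⟩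
  rw [ContinuousWithinAt, h.source] at this
  exact this.mono_left (nhdsWithin_le_iff.2 (mem_of_superset (Ioo_mem_nhdsGT one_pos)
    Ioo_subset_Icc_self))

theorem IsTrajectory.reverse (h : M.IsTrajectory x y γ) :
    M.IsTrajectory y x (fun t => γ (1 - t)) := by
  obtain ⟨v, hv, hd⟩ := h.exists_isDevAt
  have hrev : ∀ t ∈ Ioo (0 : ℝ) 1, M.IsDevAt (fun s : ℝ => (s : ℂ) * -v) (fun t => γ (1 - t)) t :=
    fun t ht => (hd (1 - t) ⟨by linarith [ht.2], by linarith [ht.1]⟩).reverse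
  refine ⟨h.continuousOn.comp (by fun_prop) ?_, by simp [h.target], by simp [h.source],
    fun t ht => (hrev t ht).nonsingular, -v, neg_ne_zero.2 hv, fun t ht => (hrev t ht).local_eq⟩
  intro t ht
  exact ⟨by linarith [ht.2], by linarith [ht.1]⟩

theorem IsTrajectory.tendsto_right (h : M.IsTrajectory x y γ) :
    Tendsto (fun t => γ (1 - t)) (𝓝[>] 0) (𝓝 y) := h.reverse.tendsto_left

theorem IsPrimitive.reverse (h : M.IsPrimitive x y γ) : M.IsPrimitive y x (fun t => γ (1 - t)) :=
  ⟨h.isTrajectory.reverse, fun _ ht => h.ne_right _ ⟨by linarith [ht.2], by linarith [ht.1]⟩,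
    fun _ ht => h.ne_left _ ⟨by linarith [ht.2], by linarith [ht.1]⟩⟩

theorem tendsto_root {m : ℕ} (hm : m ≠ 0) (l : ℂ) :
    Tendsto (fun u : ℂ => l * u ^ ((m : ℂ)⁻¹)) (𝓝 0) (𝓝 0) := by
  have hm' : 0 < ((m : ℂ)⁻¹).re := by
    rw [← Complex.ofReal_natCast, ← Complex.ofReal_inv, Complex.ofReal_re]
    have := Nat.pos_of_ne_zero hm
    positivity
  have h : ContinuousAt (fun w : ℂ => l * w ^ ((m : ℂ)⁻¹)) 0 :=
    continuousAt_const.mul (Complex.continuousAt_cpow_const_of_re_pos (Or.inl le_rfl) hm')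
  have hm0 : (m : ℂ)⁻¹ ≠ 0 := fun h => by rw [h] at hm'; exact hm'.ne rfl
  simpa only [ContinuousAt, Complex.zero_cpow hm0, mul_zero] using h

theorem IsConeChart.tendsto_of_eventually {φ : OpenPartialHomeomorph M.carrier ℂ} {m : ℕ}
    (hφ : M.IsConeChart x φ m) {G : ℂ → M.carrier} {l : ℂ} {F : Filter ℂ} (hF : F ≤ 𝓝 0)
    (h : ∀ᶠ u in F, G u ∈ φ.source ∧ φ (G u) = l * u ^ ((m : ℂ)⁻¹)) : Tendsto G F (𝓝 x) := by
  have h0 : (0 : ℂ) ∈ φ.target := hφ.map_self ▸ φ.map_source hφ.mem_source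
  have h1 := (φ.symm.continuousAt h0).tendsto.comp ((tendsto_root hφ.ne_zero l).mono_left hF)
  have h2 : φ.symm 0 = x := by rw [← hφ.map_self, φ.left_inv hφ.mem_source]
  rw [h2] at h1
  refine h1.congr' ?_
  filter_upwards [h] with u hu
  rw [Function.comp, ← hu.2, φ.left_inv hu.1]

theorem box_mem_nhdsWithin {ε : ℝ} (hε : 0 < ε) :
    Ioo (0 : ℝ) ε ×ℂ Ioo (-ε) ε ∈ 𝓝[{u : ℂ | 0 < u.re}] 0 := by
  refine mem_nhdsWithin.2 ⟨Ioo (-ε) ε ×ℂ Ioo (-ε) ε, isOpen_box _ _ _ _, ?_, ?_⟩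
  · simp [Complex.mem_reProdIm, hε]
  · rintro u ⟨hu, hre⟩
    exact ⟨⟨hre, hu.1.2⟩, hu.2⟩

theorem exists_box_of_mem_nhdsWithin {V : Set ℂ} (hV : V ∈ 𝓝[{u : ℂ | 0 < u.re}] 0) :
    ∃ ε > 0, Ioo (0 : ℝ) ε ×ℂ Ioo (-ε) ε ⊆ V := by
  obtain ⟨U, hU, hUV⟩ := mem_nhdsWithin_iff_exists_mem_nhds_inter.1 hV
  obtain ⟨ε, hε, h⟩ := exists_box_subset hU
  refine ⟨ε, hε, fun u hu => hUV ⟨h ?_, hu.1.1⟩⟩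
  simp only [Complex.mem_reProdIm, mem_Ioo, Complex.zero_re, Complex.zero_im] at hu ⊢
  refine ⟨⟨?_, ?_⟩, ?_, ?_⟩ <;> linarith [hu.1.1, hu.1.2, hu.2.1, hu.2.2]

/-- Near the left end, a strip avoids the endpoints. -/
theorem strip_left_ne {φ : OpenPartialHomeomorph M.carrier ℂ} {m : ℕ}
    (hφ : M.IsConeChart x φ m) {G : ℂ → M.carrier} {l : ℂ} (hl : l ≠ 0)
    (h : ∃ ε > 0, ∀ u ∈ Ioo (0 : ℝ) ε ×ℂ Ioo (-ε) ε,
      G u ∈ φ.source ∧ φ (G u) = l * u ^ ((m : ℂ)⁻¹)) (z : M.carrier) :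
    ∃ ε > 0, ∀ u ∈ Ioo (0 : ℝ) ε ×ℂ Ioo (-ε) ε, G u ≠ z := by
  obtain ⟨ε, hε, h⟩ := h
  by_cases hz : z = x
  · subst hz
    refine ⟨ε, hε, fun u hu hGu => ?_⟩
    have h1 := (h u hu).2
    rw [hGu, hφ.map_self] at h1
    rcases mul_eq_zero.1 h1.symm with h2 | h2
    · exact hl h2
    · have h3 := ((Complex.cpow_eq_zero_iff _ _).1 h2).1
      have h4 := hu.1.1
      simp [h3] at h4
  · have ht : Tendsto G (𝓝[{u : ℂ | 0 < u.re}] 0) (𝓝 x) :=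
      hφ.tendsto_of_eventually nhdsWithin_le_nhds (mem_of_superset (box_mem_nhdsWithin hε) h)
    exact exists_box_of_mem_nhdsWithin (ht.eventually_ne (Ne.symm hz))

/-- Primitivity keeps the core off `x` and `y`, and near the ends the sector form does, so a thin
strip avoids both. A rhombus is then cut from it, since the later perturbations move points by an
amount proportional to the distance from the nearer tip. -/
theorem IsPrimitive.exists_isDiamond (h : M.IsPrimitive x y γ) :
    ∃ v κ G, M.IsDiamond x y γ v κ G := by
  obtain ⟨v, hv, hdev⟩ := h.isTrajectory.exists_isDevAt
  have h0 := h.isTrajectory.tendsto_left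
  have h1 := h.isTrajectory.tendsto_right
  obtain ⟨δ, hδ, G, hG, hr⟩ := exists_strip hv hdev h0 h1
  have hleft := fun φ m (hφ : M.IsConeChart x φ m) => strip_start_eq hv hdev h0 hφ hδ hG hr
  have hright := fun φ m (hφ : M.IsConeChart y φ m) =>
    strip_start_eq (γ := fun t => γ (1 - t)) (neg_ne_zero.2 hv) (fun t ht =>
      (hdev (1 - t) ⟨by linarith [ht.2], by linarith [ht.1]⟩).reverse) h1 hφ hδ
      (G := fun u => G (1 - u)) (fun u hu => (hG (1 - u) (by
        simp only [Complex.mem_reProdIm, mem_Ioo, Complex.sub_re, Complex.sub_im, Complex.one_re,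
          Complex.one_im] at hu ⊢
        refine ⟨⟨?_, ?_⟩, ?_, ?_⟩ <;>
          linarith [hu.1.1, hu.1.2, hu.2.1, hu.2.2])).reverse_complex)
      (fun t ht => by
        have := hr (1 - t) ⟨by linarith [ht.2], by linarith [ht.1]⟩
        push_cast at this
        exact this)
  have hne : ∀ z, (∀ t ∈ Ioo (0 : ℝ) 1, γ t ≠ z) →
      ∃ δ > 0, ∀ u ∈ Ioo (0 : ℝ) 1 ×ℂ Ioo (-δ) δ, G u ≠ z := by
    intro z hz
    refine exists_box_forall ?_ ?_ ?_
    · obtain ⟨φ, m, hφ⟩ := M.exists_isConeChart x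
      obtain ⟨l, hl, h⟩ := hleft φ m hφ
      exact strip_left_ne hφ (fun h => by rw [h, zero_pow hφ.ne_zero] at hl; exact hv hl.symm) h z
    · obtain ⟨φ, m, hφ⟩ := M.exists_isConeChart y
      obtain ⟨l, hl, h⟩ := hright φ m hφ
      exact strip_left_ne (G := fun u => G (1 - u)) hφ (fun h => by
        rw [h, zero_pow hφ.ne_zero] at hl; exact neg_ne_zero.2 hv hl.symm) h z
    · intro t ht
      have hc := (hG t (by simp [Complex.mem_reProdIm, ht.1, ht.2, hδ])).continuousAt
      exact hc.eventually_ne (by rw [hr t ht]; exact hz t ht)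
  obtain ⟨δ₁, hδ₁, hx⟩ := hne x h.ne_left
  obtain ⟨δ₂, hδ₂, hy⟩ := hne y h.ne_right
  classical
  -- The strip is controlled only over the open interval; its values at the two tips are set by
  -- hand.
  let G' : ℂ → M.carrier := Function.update (Function.update G 0 x) 1 y
  have hG' : ∀ u : ℂ, u ≠ 0 → u ≠ 1 → G' u = G u := fun u h0 h1 => by
    simp [G', Function.update_of_ne h1, Function.update_of_ne h0]
  obtain ⟨κ, hκ, hκδ, hκ1, hκ2⟩ : ∃ κ > 0, κ ≤ δ ∧ κ ≤ δ₁ ∧ κ ≤ δ₂ :=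
    ⟨min δ (min δ₁ δ₂), by positivity, min_le_left _ _, (min_le_right _ _).trans (min_le_left _ _),
      (min_le_right _ _).trans (min_le_right _ _)⟩
  have hsub : ∀ δ, κ ≤ δ → ∀ u ∈ rhombus κ, u ∈ Ioo (0 : ℝ) 1 ×ℂ Ioo (-δ) δ := by
    intro δ hδ u hu
    obtain ⟨h1, h2, h3⟩ := rhombus_subset_box hκ hu
    exact ⟨h1, by linarith, by linarith⟩
  have hGr : ∀ u ∈ rhombus κ, G' u = G u := fun u hu => by
    obtain ⟨h1, h2⟩ := re_of_mem_rhombus hκ hu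
    exact hG' u (fun h => by simp [h] at h1) (fun h => by simp [h] at h2)
  have hbox : ∀ ε > 0, Ioo (0 : ℝ) ε ×ℂ Ioo (-ε) ε ∈ 𝓝[rhombus κ] 0 := fun ε hε =>
    nhdsWithin_mono _ (fun u hu => (re_of_mem_rhombus hκ hu).1) (box_mem_nhdsWithin hε)
  refine ⟨v, κ, G', hv, hκ, fun u hu => ?_, fun u hu => ?_, fun u hu => ?_, fun t ht => ?_,
    fun φ m hφ => ?_, fun φ m hφ => ?_⟩
  · refine (hG u (hsub _ hκδ u hu)).congr_map ?_
    filter_upwards [(isOpen_rhombus κ).mem_nhds hu] with w hw using (hGr w hw).symm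
  · rw [hGr u hu]
    exact hx u (hsub _ hκ1 u hu)
  · rw [hGr u hu]
    exact hy u (hsub _ hκ2 u hu)
  · rcases ht.1.eq_or_lt with rfl | ht0
    · simp [G', h.isTrajectory.source]
    rcases ht.2.eq_or_lt with rfl | ht1
    · simp [G', h.isTrajectory.target]
    · rw [hGr _ (ofReal_mem_rhombus hκ ⟨ht0, ht1⟩), hr t ⟨ht0, ht1⟩]
  · obtain ⟨l, hl, ε, hε, h⟩ := hleft φ m hφ
    refine ⟨l, hl, ?_⟩
    filter_upwards [hbox ε hε, self_mem_nhdsWithin] with u hu hur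
    rw [hGr u hur]
    exact h u hu
  · obtain ⟨l, hl, ε, hε, h⟩ := hright φ m hφ
    refine ⟨l, hl, ?_⟩
    filter_upwards [hbox ε hε, self_mem_nhdsWithin] with u hu hur
    rw [hGr _ (one_sub_mem_rhombus hur)]
    exact h u hu

section Diamond

variable {v : ℂ} {κ : ℝ} {G : ℂ → M.carrier}

theorem IsDiamond.reverse (h : M.IsDiamond x y γ v κ G) :
    M.IsDiamond y x (fun t => γ (1 - t)) (-v) κ (fun u => G (1 - u)) := by
  refine ⟨neg_ne_zero.2 h.ne_zero, h.pos,
    fun u hu => (h.isDevAt _ (one_sub_mem_rhombus hu)).reverse_complex,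
    fun u hu => h.ne_right _ (one_sub_mem_rhombus hu),
    fun u hu => h.ne_left _ (one_sub_mem_rhombus hu), fun t ht => ?_, h.right, fun φ m hφ => ?_⟩
  · have := h.real (1 - t) ⟨by linarith [ht.2], by linarith [ht.1]⟩
    push_cast at this
    exact this
  · simpa using h.left φ m hφ

theorem IsDiamond.tendsto_left (h : M.IsDiamond x y γ v κ G) :
    Tendsto G (𝓝[rhombus κ] 0) (𝓝 x) := by
  obtain ⟨φ, m, hφ⟩ := M.exists_isConeChart x
  obtain ⟨l, -, hl⟩ := h.left φ m hφ
  exact hφ.tendsto_of_eventually nhdsWithin_le_nhds hl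

theorem IsDiamond.tendsto_right (h : M.IsDiamond x y γ v κ G) :
    Tendsto G (𝓝[rhombus κ] 1) (𝓝 y) := by
  have h1 := h.reverse.tendsto_left
  have h2 : Tendsto (fun u : ℂ => 1 - u) (𝓝[rhombus κ] 1) (𝓝[rhombus κ] 0) := by
    refine tendsto_nhdsWithin_iff.2 ⟨?_, ?_⟩
    · have : Continuous fun u : ℂ => 1 - u := by fun_prop
      have := this.tendsto 1
      rw [sub_self] at this
      exact this.mono_left nhdsWithin_le_nhds
    · filter_upwards [self_mem_nhdsWithin] with u hu using one_sub_mem_rhombus hu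
  simpa [Function.comp_def] using h1.comp h2

theorem IsDiamond.map_zero (h : M.IsDiamond x y γ v κ G) (hγ : γ 0 = x) : G 0 = x := by
  simpa [hγ] using h.real 0 ⟨le_rfl, zero_le_one⟩

theorem IsDiamond.map_one (h : M.IsDiamond x y γ v κ G) (hγ : γ 1 = y) : G 1 = y := by
  simpa [hγ] using h.real 1 ⟨zero_le_one, le_rfl⟩

theorem IsDiamond.continuousOn (h : M.IsDiamond x y γ v κ G) (h0 : γ 0 = x) (h1 : γ 1 = y) :
    ContinuousOn G (insert 0 (insert 1 (rhombus κ))) := by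
  have key : ∀ u, Tendsto G (𝓝[rhombus κ] u) (𝓝 (G u)) →
      Tendsto G (𝓝[insert 0 (insert 1 (rhombus κ))] u) (𝓝 (G u)) := by
    intro u hu
    have hp : ∀ z, Tendsto G (𝓝[{z}] u) (𝓝 (G u)) := by
      intro z
      by_cases hz : u = z
      · subst hz
        exact continuousWithinAt_singleton
      · have : 𝓝[{z}] u = ⊥ := by
          rw [← not_neBot, ← mem_closure_iff_nhdsWithin_neBot, closure_singleton]
          exact hz
        rw [this]
        exact tendsto_bot
    rw [insert_eq, insert_eq, nhdsWithin_union, nhdsWithin_union, tendsto_sup, tendsto_sup]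
    exact ⟨hp _, hp _, hu⟩
  rintro u (rfl | rfl | hu) <;> refine key _ ?_
  · rw [h.map_zero h0]
    exact h.tendsto_left
  · rw [h.map_one h1]
    exact h.tendsto_right
  · exact (h.isDevAt u hu).continuousAt.tendsto.mono_left nhdsWithin_le_nhds

end Diamond

end TranslationSurface

/-! ### Near-translations and persistence of primitive trajectories. -/

namespace TranslationSurface

open Filter Set

variable {k : ℕ} {α : Fin k → ℕ}

/-- A label-preserving homeomorphism which infinitesimally is a translation in charts up to a
relative error of at most `η`. -/
structure IsNearTranslation (M N : TranslationSurface α) (η : ℝ) (f : M.carrier ≃ₜ N.carrier) :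
    Prop where
  labels : PreservesLabels M N f
  near : ∀ e ∈ M.charts, ∀ e' ∈ N.charts, ∀ p ∈ e.source, f p ∈ e'.source →
    ∀ᶠ q in 𝓝 p, ‖(e' (f q) - e' (f p)) - (e q - e p)‖ ≤ η * ‖e q - e p‖

theorem IsDevAt.of_chart {X : Type*} [TopologicalSpace X] {N : TranslationSurface α}
    {F : X → N.carrier} {u : X} {e : OpenPartialHomeomorph N.carrier ℂ} (he : e ∈ N.charts)
    (hu : F u ∈ e.source) (hF : ContinuousAt F u) : N.IsDevAt (fun w => e (F w)) F u := by
  refine ⟨N.nonsing_of_chart he hu, hF, fun e' he' hue' => ?_⟩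
  obtain ⟨c, hc⟩ := N.transition e he e' he' _ hu hue'
  exact ⟨c, hF.eventually hc⟩

/-- On the connected overlap the two developments differ by a constant, which is absorbed into the
second one. -/
theorem exists_development_union {N : TranslationSurface α} {F : ℂ → N.carrier} {A B D : Set ℂ}
    (hA : IsOpen A) (hB : IsOpen B) (hD : IsOpen D) (hABD : IsPreconnected (A ∩ B ∩ D))
    (h₁ : ∃ h, ∀ u ∈ A ∩ D, N.IsDevAt h F u) (h₂ : ∃ h, ∀ u ∈ B ∩ D, N.IsDevAt h F u) :
    ∃ h, ∀ u ∈ (A ∪ B) ∩ D, N.IsDevAt h F u := by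
  classical
  obtain ⟨h₁, H₁⟩ := h₁
  obtain ⟨h₂, H₂⟩ := h₂
  obtain ⟨c, hc⟩ := eq_add_of_locally_const hABD
    (fun u hu => (H₁ u ⟨hu.1.1, hu.2⟩).locally_const (H₂ u ⟨hu.1.2, hu.2⟩))
  refine ⟨fun u => if u ∈ A then h₁ u else h₂ u + c, ?_⟩
  rintro u ⟨huAB, huD⟩
  by_cases huA : u ∈ A
  · refine (H₁ u ⟨huA, huD⟩).congr (EventuallyEq.refl _ _) ⟨0, ?_⟩
    filter_upwards [hA.mem_nhds huA] with w hw
    rw [if_pos hw, add_zero]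
  · have huB := huAB.resolve_left huA
    refine (H₂ u ⟨huB, huD⟩).congr (EventuallyEq.refl _ _) ⟨-c, ?_⟩
    filter_upwards [hB.mem_nhds huB, hD.mem_nhds huD] with w hw hwD
    split_ifs with hwA
    · rw [hc w ⟨⟨hwA, hw⟩, hwD⟩]
      ring
    · ring

theorem box_union_re {a a' b b' : ℝ} {s : Set ℝ} (ha : a ≤ a') (h : a' < b) (hb : b ≤ b') :
    Ioo a b ×ℂ s ∪ Ioo a' b' ×ℂ s = Ioo a b' ×ℂ s := by
  ext u
  simp only [mem_union, Complex.mem_reProdIm, mem_Ioo]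
  constructor
  · rintro (⟨⟨h1, h2⟩, h3⟩ | ⟨⟨h1, h2⟩, h3⟩)
    · exact ⟨⟨h1, by linarith⟩, h3⟩
    · exact ⟨⟨by linarith, h2⟩, h3⟩
  · rintro ⟨⟨h1, h2⟩, h3⟩
    rcases lt_or_ge u.re b with h4 | h4
    · exact Or.inl ⟨⟨h1, h4⟩, h3⟩
    · exact Or.inr ⟨⟨by linarith, h2⟩, h3⟩

theorem box_union_im {a a' b b' : ℝ} {s : Set ℝ} (ha : a ≤ a') (h : a' < b) (hb : b ≤ b') :
    s ×ℂ Ioo a b ∪ s ×ℂ Ioo a' b' = s ×ℂ Ioo a b' := by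
  ext u
  simp only [mem_union, Complex.mem_reProdIm, mem_Ioo]
  constructor
  · rintro (⟨h3, ⟨h1, h2⟩⟩ | ⟨h3, ⟨h1, h2⟩⟩)
    · exact ⟨h3, ⟨h1, by linarith⟩⟩
    · exact ⟨h3, ⟨by linarith, h2⟩⟩
  · rintro ⟨h3, ⟨h1, h2⟩⟩
    rcases lt_or_ge u.im b with h4 | h4
    · exact Or.inl ⟨h3, ⟨h1, h4⟩⟩
    · exact Or.inr ⟨h3, ⟨by linarith, h2⟩⟩

/-- A map from a bounded convex open set of the plane to the surface which can be developed near
each point of the closure can be developed. -/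
theorem exists_development {N : TranslationSurface α} {F : ℂ → N.carrier} {D : Set ℂ}
    (hD : IsOpen D) (hconv : Convex ℝ D) {a b c d : ℝ} (hab : a < b) (hcd : c < d)
    (hbox : D ⊆ Ioo a b ×ℂ Ioo c d)
    (hloc : ∀ p ∈ closure D, ∃ V ∈ 𝓝 p, ∃ h, ∀ u ∈ V ∩ D, N.IsDevAt h F u) :
    ∃ h, ∀ u ∈ D, N.IsDevAt h F u := by
  have hloc' : ∀ p, ∃ V ∈ 𝓝 p, ∃ h, ∀ u ∈ V ∩ D, N.IsDevAt h F u := by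
    intro p
    by_cases hp : p ∈ closure D
    · exact hloc p hp
    · exact ⟨(closure D)ᶜ, isClosed_closure.isOpen_compl.mem_nhds hp, 0,
        fun u hu => absurd (subset_closure hu.2) hu.1⟩
  have hpre : ∀ a b c d a' b' c' d' : ℝ,
      IsPreconnected (Ioo a b ×ℂ Ioo c d ∩ Ioo a' b' ×ℂ Ioo c' d' ∩ D) := fun a b c d a' b' c' d' =>
    (((convex_box a b c d).inter (convex_box a' b' c' d')).inter hconv).isPreconnected
  have hmono : ∀ {a b c d a' b' c' d' : ℝ}, a ≤ a' → b' ≤ b → c ≤ c' → d' ≤ d →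
      (∃ h, ∀ u ∈ Ioo a b ×ℂ Ioo c d ∩ D, N.IsDevAt h F u) →
      ∃ h, ∀ u ∈ Ioo a' b' ×ℂ Ioo c' d' ∩ D, N.IsDevAt h F u := by
    rintro a b c d a' b' c' d' h1 h2 h3 h4 ⟨h, H⟩
    exact ⟨h, fun u hu => H u ⟨⟨⟨h1.trans_lt hu.1.1.1, hu.1.1.2.trans_le h2⟩,
      h3.trans_lt hu.1.2.1, hu.1.2.2.trans_le h4⟩, hu.2⟩⟩
  -- Pieces are chained vertically into a development over a thin column, and the columns are then
  -- chained horizontally; all overlaps with `D` are convex.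
  have hcol : ∀ x : ℝ, ∃ ε > 0, ∃ h, ∀ u ∈ Ioo (x - ε) (x + ε) ×ℂ Ioo c d ∩ D,
      N.IsDevAt h F u := by
    intro x
    refine interval_chain (P := fun s t => ∃ ε > 0, ∃ h, ∀ u ∈ Ioo (x - ε) (x + ε) ×ℂ Ioo s t ∩ D,
      N.IsDevAt h F u) hcd ?_ ?_ ?_
    · rintro s s' t t' hs ht ⟨ε, hε, h⟩
      exact ⟨ε, hε, hmono le_rfl le_rfl hs ht h⟩
    · rintro s s' t t' hs hst ht ⟨ε, hε, h⟩ ⟨ε', hε', h'⟩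
      refine ⟨min ε ε', lt_min hε hε', ?_⟩
      have h1 := min_le_left ε ε'
      have h2 := min_le_right ε ε'
      have := exists_development_union (isOpen_box _ _ _ _) (isOpen_box _ _ _ _) hD
        (hpre _ _ _ _ _ _ _ _)
        (hmono (a' := x - min ε ε') (b' := x + min ε ε') (by linarith) (by linarith) le_rfl le_rfl h)
        (hmono (a' := x - min ε ε') (b' := x + min ε ε') (by linarith) (by linarith) le_rfl le_rfl h')
      rwa [box_union_im hs hst ht] at this
    · intro y _
      obtain ⟨V, hV, h, H⟩ := hloc' ⟨x, y⟩
      obtain ⟨ε, hε, hεV⟩ := exists_box_subset hV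
      exact ⟨ε, hε, ε, hε, hmono le_rfl le_rfl (le_max_right _ _) (min_le_right _ _)
        ⟨h, fun u hu => H u ⟨hεV hu.1, hu.2⟩⟩⟩
  obtain ⟨h, H⟩ : ∃ h, ∀ u ∈ Ioo a b ×ℂ Ioo c d ∩ D, N.IsDevAt h F u := by
    refine interval_chain (P := fun s t => ∃ h, ∀ u ∈ Ioo s t ×ℂ Ioo c d ∩ D,
      N.IsDevAt h F u) hab ?_ ?_ ?_
    · exact fun s s' t t' hs ht h => hmono hs ht le_rfl le_rfl h
    · intro s s' t t' hs hst ht h h'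
      have := exists_development_union (isOpen_box _ _ _ _) (isOpen_box _ _ _ _) hD
        (hpre _ _ _ _ _ _ _ _) h h'
      rwa [box_union_re hs hst ht] at this
    · intro x _
      obtain ⟨ε, hε, h⟩ := hcol x
      exact ⟨ε, hε, hmono (le_max_right _ _) (min_le_right _ _) le_rfl le_rfl h⟩
  exact ⟨h, fun u hu => H u ⟨hbox hu, hu⟩⟩

/-- A mean value inequality without differentiability: the local bound controls the slopes of `g`
along the segment, and the slack `ε` makes the comparison strict. -/
theorem norm_sub_le_of_eventually {E : Type*} [NormedAddCommGroup E] [NormedSpace ℝ E] {D : Set E}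
    (hD : Convex ℝ D) {g : E → E} {η : ℝ}
    (hg : ∀ u ∈ D, ∀ᶠ w in 𝓝 u, ‖g w - g u‖ ≤ η * ‖w - u‖) {u w : E} (hu : u ∈ D) (hw : w ∈ D) :
    ‖g w - g u‖ ≤ η * ‖w - u‖ := by
  let p : ℝ → E := fun t => u + t • (w - u)
  have hp : ∀ t ∈ Icc (0 : ℝ) 1, p t ∈ D := fun t ht => hD.add_smul_sub_mem hu hw ht
  have hpc : Continuous p := by fun_prop
  have hpd : ∀ s t, ‖p s - p t‖ = |s - t| * ‖w - u‖ := by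
    intro s t
    rw [← Real.norm_eq_abs, ← norm_smul]
    congr 1
    simp only [p]
    module
  have hev : ∀ t ∈ Icc (0 : ℝ) 1, ∀ᶠ s in 𝓝 t,
      ‖g (p s) - g (p t)‖ ≤ η * ‖w - u‖ * |s - t| := by
    intro t ht
    filter_upwards [hpc.continuousAt.eventually (hg _ (hp t ht))] with s hs
    rw [hpd] at hs
    linarith
  have hcont : ContinuousOn (fun t => g (p t) - g u) (Icc 0 1) := by
    intro t ht
    refine ContinuousAt.continuousWithinAt (ContinuousAt.sub ?_ continuousAt_const)
    rw [ContinuousAt, tendsto_iff_norm_sub_tendsto_zero]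
    refine squeeze_zero' (Eventually.of_forall fun _ => norm_nonneg _) (hev t ht) ?_
    have : Continuous fun s : ℝ => η * ‖w - u‖ * |s - t| := by fun_prop
    simpa using this.tendsto t
  refine le_of_forall_pos_le_add fun ε hε => ?_
  have := image_norm_le_of_liminf_right_slope_norm_lt_deriv_boundary (f := fun t => g (p t) - g u)
    (f' := fun _ => η * ‖w - u‖) (a := 0) (b := 1) hcont ?_
    (B := fun t => (η * ‖w - u‖ + ε) * t) (B' := fun _ => η * ‖w - u‖ + ε) (by simp [p])
    (by fun_prop) (fun t _ => by
      simpa using ((hasDerivAt_id t).const_mul (η * ‖w - u‖ + ε)).hasDerivWithinAt)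
    (fun _ _ _ => by linarith) (x := 1) ⟨zero_le_one, le_rfl⟩
  · simpa [p] using this
  · intro t ht r hr
    refine Eventually.frequently ?_
    filter_upwards [eventually_nhdsWithin_of_eventually_nhds (hev t ⟨ht.1, ht.2.le⟩),
      self_mem_nhdsWithin] with s hs hst
    have hst : 0 < s - t := sub_pos.2 hst
    rw [slope_def_field, div_lt_iff₀ hst]
    have h1 := norm_sub_norm_le (g (p s) - g u) (g (p t) - g u)
    rw [sub_sub_sub_cancel_right] at h1
    rw [abs_of_pos hst] at hs
    simp only [Function.comp]
    nlinarith [mul_lt_mul_of_pos_right hr hst]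

/-- Supplies limiting values of the perturbation at the tips of the rhombus, which may be singular,
with the Lipschitz estimate intact. -/
theorem exists_limit_of_lipschitz {D : Set ℂ} {g : ℂ → ℂ} {η : ℝ} (hη : 0 ≤ η)
    (hg : ∀ u ∈ D, ∀ w ∈ D, ‖g w - g u‖ ≤ η * ‖w - u‖) {p : ℂ} (hp : p ∈ closure D) :
    ∃ l, ∀ u ∈ D, ‖g u - l‖ ≤ η * ‖u - p‖ := by
  have hL : LipschitzOnWith ⟨η, hη⟩ g D := LipschitzOnWith.of_dist_le_mul fun u hu w hw => by
    rw [dist_eq_norm, dist_eq_norm]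
    exact hg w hw u hu
  have : (𝓝[D] p).NeBot := mem_closure_iff_nhdsWithin_neBot.1 hp
  have hc : Cauchy (map g (𝓝[D] p)) :=
    (cauchy_nhds.mono nhdsWithin_le_nhds).map_of_le hL.uniformContinuousOn inf_le_right
  obtain ⟨l, hl⟩ := CompleteSpace.complete hc
  have hl : Tendsto g (𝓝[D] p) (𝓝 l) := hl
  refine ⟨l, fun u hu => ?_⟩
  have h1 : Tendsto (fun w => ‖g u - g w‖) (𝓝[D] p) (𝓝 ‖g u - l‖) :=
    (tendsto_const_nhds.sub hl).norm
  have h2 : Tendsto (fun w => η * ‖u - w‖) (𝓝[D] p) (𝓝 (η * ‖u - p‖)) := by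
    have : Continuous fun w : ℂ => η * ‖u - w‖ := by fun_prop
    exact (this.tendsto p).mono_left nhdsWithin_le_nhds
  refine le_of_tendsto_of_tendsto h1 h2 ?_
  filter_upwards [self_mem_nhdsWithin] with w hw using hg w hw u hu

theorem ofReal_mem_closure_rhombus {κ : ℝ} (hκ : 0 < κ) {t : ℝ} (ht : t ∈ Icc (0 : ℝ) 1) :
    (t : ℂ) ∈ closure (rhombus κ) := by
  rw [← closure_Ioo zero_ne_one] at ht
  exact map_mem_closure Complex.continuous_ofReal ht fun s hs => ofReal_mem_rhombus hκ hs

/-- The straight segment between the images of `0` and `1` under a map close to the identity. -/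
theorem exists_straight_preimage {κ η : ℝ} (hκ : 0 < κ) (hη : 0 ≤ η) (hη3 : 3 * η < 1)
    (hηκ : 3 * η * (1 + κ) < κ) {g : ℂ → ℂ}
    (hg : ∀ u ∈ rhombus κ, ∀ w ∈ rhombus κ, ‖g w - g u‖ ≤ η * ‖w - u‖) :
    ∃ ζ : ℝ → ℂ, ∃ a b : ℂ, b ≠ 0 ∧ ζ 0 = 0 ∧ ζ 1 = 1 ∧ ContinuousOn ζ (Icc 0 1) ∧
      (∀ t ∈ Icc (0 : ℝ) 1, ‖ζ t - t‖ ≤ 3 * η * t ∧ ‖ζ t - t‖ ≤ 3 * η * (1 - t)) ∧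
      ∀ t ∈ Ioo (0 : ℝ) 1, ζ t ∈ rhombus κ ∧ ζ t + g (ζ t) = a + t * b := by
  obtain ⟨l₀, h₀⟩ := exists_limit_of_lipschitz hη hg
    (ofReal_mem_closure_rhombus hκ ⟨le_rfl, zero_le_one⟩)
  obtain ⟨l₁, h₁⟩ := exists_limit_of_lipschitz hη hg
    (ofReal_mem_closure_rhombus hκ ⟨zero_le_one, le_rfl⟩)
  simp only [Complex.ofReal_zero, sub_zero, Complex.ofReal_one] at h₀ h₁
  -- Both limits are compared with the value at the midpoint, at a cost of `η / 2` each.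
  have h₀₁ : ‖l₁ - l₀‖ ≤ η := by
    have hmem := ofReal_mem_rhombus hκ (t := 1 / 2) ⟨by norm_num, by norm_num⟩
    have a1 := h₀ _ hmem
    have a2 := h₁ _ hmem
    have a3 := norm_sub_le (g ((1 / 2 : ℝ) : ℂ) - l₀) (g ((1 / 2 : ℝ) : ℂ) - l₁)
    rw [sub_sub_sub_cancel_left] at a3
    have e1 : ‖((1 / 2 : ℝ) : ℂ)‖ = 1 / 2 := by
      rw [Complex.norm_real]; norm_num
    have e2 : ‖((1 / 2 : ℝ) : ℂ) - 1‖ = 1 / 2 := by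
      rw [← Complex.ofReal_one, ← Complex.ofReal_sub, Complex.norm_real]; norm_num
    rw [e1] at a1
    rw [e2] at a2
    linarith
  -- The map `z + g z` has limits `l₀` and `1 + l₁` at the tips, and `b` spans the segment between
  -- them.
  obtain ⟨b, hb⟩ : ∃ b, b = 1 + (l₁ - l₀) := ⟨_, rfl⟩
  have hfix : ∀ t ∈ Ioo (0 : ℝ) 1, ∃ z ∈ rhombus κ, ‖z - t‖ ≤ 3 * η * t ∧
      ‖z - t‖ ≤ 3 * η * (1 - t) ∧ z + g z = l₀ + t * b := by
    intro t ht
    -- Working at the scale `μ` of the nearer tip keeps the ball of radius `3 * η * μ` inside the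
    -- rhombus and yields the relative estimates at both ends.
    obtain ⟨μ, hμ⟩ : ∃ μ, μ = min t (1 - t) := ⟨_, rfl⟩
    have hμ0 : 0 < μ := hμ ▸ lt_min ht.1 (sub_pos.2 ht.2)
    have hμ1 : μ ≤ t := hμ ▸ min_le_left _ _
    have hμ2 : μ ≤ 1 - t := hμ ▸ min_le_right _ _
    let s := Metric.closedBall (t : ℂ) (3 * η * μ)
    have hs : s ⊆ rhombus κ := by
      intro z hz
      rw [Metric.mem_closedBall, dist_eq_norm] at hz
      have h1 := (Complex.abs_re_le_norm _).trans hz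
      have h2 := (Complex.abs_im_le_norm _).trans hz
      simp only [Complex.sub_re, Complex.ofReal_re, Complex.sub_im, Complex.ofReal_im,
        sub_zero] at h1 h2
      rw [abs_le] at h1
      have key : 3 * η * μ * (1 + κ) < κ * μ := by nlinarith
      constructor
      · refine h2.trans_lt ?_
        nlinarith [mul_le_mul_of_nonneg_left hμ1 hκ.le, mul_le_mul_of_nonneg_left h1.1 hκ.le]
      · refine h2.trans_lt ?_
        nlinarith [mul_le_mul_of_nonneg_left hμ2 hκ.le, mul_le_mul_of_nonneg_left h1.2 hκ.le]
    -- A fixed point of `Φ` is exactly a preimage of the point `l₀ + t * b` of the segment, and `Φ`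
    -- inherits the Lipschitz constant `η` of `g`.
    let Φ : ℂ → ℂ := fun z => l₀ + t * b - g z
    have hnt : ‖(t : ℂ)‖ = t := by rw [Complex.norm_real, Real.norm_of_nonneg ht.1.le]
    have hnt1 : ‖(1 - t : ℂ)‖ = 1 - t := by
      rw [← Complex.ofReal_one, ← Complex.ofReal_sub, Complex.norm_real,
        Real.norm_of_nonneg (sub_nonneg.2 ht.2.le)]
    have hmaps : MapsTo Φ s s := by
      intro z hz
      have hzr := hs hz
      have hz' := hz
      rw [Metric.mem_closedBall, dist_eq_norm] at hz' ⊢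
      have hημ : 3 * η * μ ≤ μ := by nlinarith
      -- Measured from the nearer tip, `l₁ - l₀` contributes at most `η * μ` and `g` at most `2 * η
      -- * μ`; this is the origin of the factor `3`.
      rcases le_total t (1 - t) with hle | hle
      · have hμt : μ = t := by rw [hμ, min_eq_left hle]
        have e1 : Φ z - t = t * (l₁ - l₀) - (g z - l₀) := by
          simp only [Φ, hb]; ring
        have e2 : ‖z‖ ≤ 2 * μ := by
          have := norm_add_le (z - t) t
          rw [sub_add_cancel, hnt] at this
          linarith
        rw [e1]
        refine (norm_sub_le _ _).trans ?_
        rw [norm_mul, hnt]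
        have := h₀ z hzr
        nlinarith [mul_le_mul_of_nonneg_left h₀₁ ht.1.le, mul_le_mul_of_nonneg_left e2 hη]
      · have hμt : μ = 1 - t := by rw [hμ, min_eq_right hle]
        have e1 : Φ z - t = -((1 - t) * (l₁ - l₀)) - (g z - l₁) := by
          simp only [Φ, hb]; ring
        have e2 : ‖z - 1‖ ≤ 2 * μ := by
          have := norm_sub_le (z - t) (1 - t)
          rw [show z - t - (1 - t) = z - 1 by ring, hnt1] at this
          linarith
        rw [e1]
        refine (norm_sub_le _ _).trans ?_
        rw [norm_neg, norm_mul, hnt1]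
        have := h₁ z hzr
        nlinarith [mul_le_mul_of_nonneg_left h₀₁ (sub_nonneg.2 ht.2.le),
          mul_le_mul_of_nonneg_left e2 hη]
    have hcontr : ContractingWith ⟨η, hη⟩ (hmaps.restrict Φ s s) := by
      refine ⟨?_, LipschitzWith.of_dist_le_mul fun z w => ?_⟩
      · exact NNReal.coe_lt_coe.1 (show η < 1 by linarith)
      · rw [Subtype.dist_eq, Subtype.dist_eq, dist_eq_norm, dist_eq_norm]
        simp only [MapsTo.val_restrict_apply, Φ]
        rw [sub_sub_sub_cancel_left, norm_sub_rev (z : ℂ)]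
        exact hg _ (hs z.2) _ (hs w.2)
    have hts : (t : ℂ) ∈ s := Metric.mem_closedBall_self (by positivity)
    obtain ⟨z, hz, hfz, -⟩ := hcontr.exists_fixedPoint' Metric.isClosed_closedBall.isComplete hmaps
      hts (edist_ne_top _ _)
    have hzt := hz
    rw [Metric.mem_closedBall, dist_eq_norm] at hzt
    refine ⟨z, hs hz, hzt.trans (by gcongr), hzt.trans (by gcongr), ?_⟩
    have : Φ z = z := hfz
    simp only [Φ] at this
    linear_combination -this
  classical
  choose! ζ hζ1 hζ2 hζ3 hζ4 using hfix
  let ξ : ℝ → ℂ := fun t => if t ∈ Ioo (0 : ℝ) 1 then ζ t else t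
  have hξ : ∀ t ∈ Ioo (0 : ℝ) 1, ξ t = ζ t := fun t ht => if_pos ht
  have h0 : ξ 0 = 0 := by simp [ξ]
  have h1 : ξ 1 = 1 := by simp [ξ]
  have hest : ∀ t ∈ Icc (0 : ℝ) 1, ‖ξ t - t‖ ≤ 3 * η * t ∧ ‖ξ t - t‖ ≤ 3 * η * (1 - t) := by
    intro t ht
    rcases ht.1.eq_or_lt with rfl | ht0
    · simp [h0, hη]
    rcases ht.2.eq_or_lt with rfl | ht1
    · simp [h1, hη]
    · rw [hξ t ⟨ht0, ht1⟩]
      exact ⟨hζ2 t ⟨ht0, ht1⟩, hζ3 t ⟨ht0, ht1⟩⟩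
  have hbn : ‖b‖ ≤ 1 + η := by
    rw [hb]
    refine (norm_add_le _ _).trans ?_
    simpa using h₀₁
  refine ⟨ξ, l₀, b, ?_, h0, h1, ?_, hest, fun t ht => ?_⟩
  · rintro rfl
    have : l₁ - l₀ = -1 := by linear_combination -hb
    rw [this, norm_neg, norm_one] at h₀₁
    linarith
  · intro t ht
    rw [ContinuousWithinAt, tendsto_iff_norm_sub_tendsto_zero]
    -- The constant `4` is ample: as `3 * η < 1`, the displacement is at most `2 * |s - t|`, both at
    -- the ends and in the interior.
    have hlin : Tendsto (fun s : ℝ => 4 * |s - t|) (𝓝[Icc 0 1] t) (𝓝 0) := by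
      have : Continuous fun s : ℝ => 4 * |s - t| := by fun_prop
      have := this.tendsto t
      simp only [sub_self, abs_zero, mul_zero] at this
      exact this.mono_left nhdsWithin_le_nhds
    refine squeeze_zero' (Eventually.of_forall fun _ => norm_nonneg _) ?_ hlin
    rcases ht.1.eq_or_lt with rfl | ht0
    · filter_upwards [self_mem_nhdsWithin] with s hs
      have a1 := (hest s hs).1
      have a2 := norm_add_le (ξ s - s) s
      rw [sub_add_cancel, Complex.norm_real, Real.norm_of_nonneg hs.1] at a2
      rw [h0, sub_zero, sub_zero, abs_of_nonneg hs.1]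
      nlinarith [hs.1]
    rcases ht.2.eq_or_lt with rfl | ht1
    · filter_upwards [self_mem_nhdsWithin] with s hs
      have a1 := (hest s hs).2
      have a2 := norm_add_le (ξ s - s) (s - 1)
      rw [sub_add_sub_cancel, ← Complex.ofReal_one, ← Complex.ofReal_sub, Complex.norm_real,
        Real.norm_eq_abs] at a2
      rw [h1]
      have a3 : |s - 1| = 1 - s := by rw [abs_sub_comm, abs_of_nonneg (sub_nonneg.2 hs.2)]
      rw [Complex.ofReal_one] at a2
      nlinarith [hs.2]
    · filter_upwards [mem_nhdsWithin_of_mem_nhds (Ioo_mem_nhds ht0 ht1)] with s hs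
      rw [hξ s hs, hξ t ⟨ht0, ht1⟩]
      have e1 := hζ4 s hs
      have e2 := hζ4 t ⟨ht0, ht1⟩
      have e3 := hg _ (hζ1 t ⟨ht0, ht1⟩) _ (hζ1 s hs)
      have e4 : ζ s - ζ t = ((s - t : ℝ) : ℂ) * b - (g (ζ s) - g (ζ t)) := by
        push_cast
        linear_combination e1 - e2
      have e5 : ‖ζ s - ζ t‖ ≤ |s - t| * ‖b‖ + ‖g (ζ s) - g (ζ t)‖ := by
        conv_lhs => rw [e4]
        refine (norm_sub_le _ _).trans ?_
        rw [norm_mul, Complex.norm_real, Real.norm_eq_abs]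
      have e6 := mul_le_mul_of_nonneg_left hbn (abs_nonneg (s - t))
      have hη' : η < 1 / 3 := by linarith
      nlinarith [norm_nonneg (ζ s - ζ t), abs_nonneg (s - t)]
  · rw [hξ t ht]
    exact ⟨hζ1 t ht, hζ4 t ht⟩

theorem closure_rhombus_subset {κ : ℝ} (hκ : 0 < κ) :
    closure (rhombus (κ / 2)) ⊆ insert 0 (insert 1 (rhombus κ)) := by
  have hcl : IsClosed {u : ℂ | |u.im| ≤ κ / 2 * u.re ∧ |u.im| ≤ κ / 2 * (1 - u.re)} :=
    (isClosed_le Complex.continuous_im.abs (continuous_const.mul Complex.continuous_re)).inter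
    (isClosed_le Complex.continuous_im.abs
      (continuous_const.mul (continuous_const.sub Complex.continuous_re)))
  have hsub : rhombus (κ / 2) ⊆ {u : ℂ | |u.im| ≤ κ / 2 * u.re ∧ |u.im| ≤ κ / 2 * (1 - u.re)} :=
    fun u hu => ⟨hu.1.le, hu.2.le⟩
  intro u hu
  obtain ⟨h1, h2⟩ := closure_minimal hsub hcl hu
  have h3 : 0 ≤ u.re := by
    by_contra h
    have := (abs_nonneg _).trans h1
    nlinarith
  have h4 : u.re ≤ 1 := by
    by_contra h
    have := (abs_nonneg _).trans h2
    nlinarith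
  rcases h3.eq_or_lt with h3 | h3
  · left
    rw [← h3, mul_zero] at h1
    exact Complex.ext h3.symm (abs_nonpos_iff.1 h1)
  rcases h4.eq_or_lt with h4 | h4
  · right; left
    rw [h4, sub_self, mul_zero] at h2
    exact Complex.ext h4 (abs_nonpos_iff.1 h2)
  · right; right
    constructor
    · nlinarith
    · nlinarith

theorem rhombus_mono {κ κ' : ℝ} (hκ : 0 < κ) (h : κ ≤ κ') : rhombus κ ⊆ rhombus κ' := by
  intro u hu
  obtain ⟨h1, h2⟩ := re_of_mem_rhombus hκ hu
  exact ⟨hu.1.trans_le (by gcongr), hu.2.trans_le (by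
    have : 0 ≤ 1 - u.re := by linarith
    gcongr)⟩

section Transfer

variable {M N : TranslationSurface α} {x y : M.carrier} {γ : ℝ → M.carrier} {v : ℂ} {κ : ℝ}
  {G : ℂ → M.carrier} {η : ℝ} {f : M.carrier ≃ₜ N.carrier}

theorem PreservesLabels.image_notMem (hf : PreservesLabels M N f) {p : M.carrier}
    (hp : p ∉ M.singSet) : f p ∉ N.singSet := hf.nonsing hp

/-- Near a tip a power of a cone chart at the image of the endpoint develops the map, and elsewhere
a flat chart does. Halving the slope ensures that the closure leaves the original rhombus only at
the tips. -/
theorem IsDiamond.exists_development (h : M.IsDiamond x y γ v κ G) (hf : PreservesLabels M N f) :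
    ∃ D, ∀ u ∈ rhombus (κ / 2), N.IsDevAt D (fun u => f (G u)) u := by
  have hκ := h.pos
  have hcont : ∀ u ∈ rhombus κ, ContinuousAt (fun u => f (G u)) u := fun u hu =>
    f.continuous.continuousAt.comp (h.isDevAt u hu).continuousAt
  have hns : ∀ u ∈ rhombus κ, f (G u) ∉ N.singSet := fun u hu =>
    hf.image_notMem (h.isDevAt u hu).nonsingular
  have hsub : rhombus (κ / 2) ⊆ rhombus κ := rhombus_mono (by linarith) (by linarith)
  have hend : ∀ p z, Tendsto G (𝓝[rhombus κ] p) (𝓝 z) → ∃ V ∈ 𝓝 p, ∃ D,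
      ∀ u ∈ V ∩ rhombus (κ / 2), N.IsDevAt D (fun u => f (G u)) u := by
    intro p z hz
    obtain ⟨φ, m, hφ⟩ := N.exists_isConeChart (f z)
    have h1 := (f.continuous.continuousAt.tendsto.comp hz).eventually
      (φ.open_source.mem_nhds hφ.mem_source)
    obtain ⟨V, hV, hVs⟩ := mem_nhdsWithin_iff_exists_mem_nhds_inter.1 h1
    exact ⟨V, hV, _, fun u hu => IsDevAt.of_isConeChart hφ (hcont u (hsub hu.2))
      (hVs ⟨hu.1, hsub hu.2⟩) (hns u (hsub hu.2))⟩
  refine TranslationSurface.exists_development (isOpen_rhombus _) (convex_rhombus _) one_pos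
    (by linarith : -(κ / 2) < κ / 2) (rhombus_subset_box (by linarith)) fun p hp => ?_
  rcases closure_rhombus_subset hκ hp with rfl | rfl | hp
  · exact hend _ _ h.tendsto_left
  · exact hend _ _ h.tendsto_right
  · obtain ⟨e, he, hpe⟩ := N.chart_cover _ (hns p hp)
    refine ⟨_, inter_mem ((hcont p hp).eventually (e.open_source.mem_nhds hpe))
      ((isOpen_rhombus κ).mem_nhds hp), _, fun u hu => IsDevAt.of_chart he hu.1.1
      (hcont u hu.1.2)⟩

/-- In units of `v` the development of the deformed rhombus is the identity plus `g`. The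
infinitesimal error bound makes `g` Lipschitz with constant `η`, because the rhombus is convex. -/
theorem IsDiamond.exists_near_development (h : M.IsDiamond x y γ v κ G)
    (hf : IsNearTranslation M N η f) :
    ∃ g : ℂ → ℂ, (∀ u ∈ rhombus (κ / 2), N.IsDevAt (fun w => (w + g w) * v) (fun u => f (G u)) u) ∧
      ∀ u ∈ rhombus (κ / 2), ∀ w ∈ rhombus (κ / 2), ‖g w - g u‖ ≤ η * ‖w - u‖ := by
  have hv := h.ne_zero
  obtain ⟨D, hD⟩ := h.exists_development hf.labels
  have hκ := h.pos
  have hsub : rhombus (κ / 2) ⊆ rhombus κ := rhombus_mono (by linarith) (by linarith)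
  refine ⟨fun w => D w / v - w, ?_, fun u hu w hw => ?_⟩
  · convert hD using 4 with w
    field_simp
    ring
  · refine norm_sub_le_of_eventually (convex_rhombus (κ / 2)) (g := fun w => D w / v - w)
      (fun u hu => ?_) hu hw
    have hM := h.isDevAt u (hsub hu)
    obtain ⟨e, he, hue⟩ := hM.exists_chart
    obtain ⟨e', he', hue'⟩ := (hD u hu).exists_chart
    obtain ⟨c, hc⟩ := hM.local_eq e he hue
    obtain ⟨c', hc'⟩ := (hD u hu).local_eq e' he' hue'
    filter_upwards [hM.continuousAt.eventually (hf.near e he e' he' _ hue hue'), hc, hc']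
      with w h1 h2 h3
    rw [h2, h3, hc.self_of_nhds, hc'.self_of_nhds] at h1
    have e1 : D w / v - w - (D u / v - u) = ((D w + c' - (D u + c')) - (w * v + c - (u * v + c))) / v := by
      field_simp
      ring
    have e2 : w * v + c - (u * v + c) = (w - u) * v := by ring
    rw [e1, norm_div, div_le_iff₀ (norm_pos_iff.2 hv)]
    refine h1.trans_eq ?_
    rw [e2, norm_mul, mul_assoc]

/-- A primitive trajectory persists under nearly isometric deformations of the surface. -/
theorem IsDiamond.exists_transfer (h : M.IsDiamond x y γ v κ G) (hγ : M.IsTrajectory x y γ)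
    (hη : 0 ≤ η) (hη3 : 3 * η < 1) (hηκ : 3 * η * (1 + κ / 2) < κ / 2)
    (hf : IsNearTranslation M N η f) :
    ∃ ζ : ℝ → ℂ, ζ 0 = 0 ∧ ζ 1 = 1 ∧ (∀ t ∈ Ioo (0 : ℝ) 1, ζ t ∈ rhombus κ) ∧
      (∀ t ∈ Icc (0 : ℝ) 1, ‖ζ t - t‖ ≤ 3 * η * t ∧ ‖ζ t - t‖ ≤ 3 * η * (1 - t)) ∧
      N.IsPrimitive (f x) (f y) (fun t => f (G (ζ t))) := by
  have hκ := h.pos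
  have hsub : rhombus (κ / 2) ⊆ rhombus κ := rhombus_mono (by linarith) (by linarith)
  obtain ⟨g, hg1, hg2⟩ := h.exists_near_development hf
  obtain ⟨ζ, a, b, hb, h0, h1, hc, hest, hζ⟩ :=
    exists_straight_preimage (by linarith : 0 < κ / 2) hη hη3 hηκ hg2
  have hr : ∀ t ∈ Ioo (0 : ℝ) 1, ζ t ∈ rhombus κ := fun t ht => hsub (hζ t ht).1
  have hdev : ∀ t ∈ Ioo (0 : ℝ) 1,
      N.IsDevAt (fun s : ℝ => (s : ℂ) * (b * v)) (fun t => f (G (ζ t))) t := by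
    intro t ht
    refine (IsDevAt.comp (hg1 _ (hζ t ht).1)
      (hc.continuousAt (Icc_mem_nhds ht.1 ht.2))).congr (EventuallyEq.refl _ _) ⟨a * v, ?_⟩
    filter_upwards [Ioo_mem_nhds ht.1 ht.2] with s hs
    simp only [Function.comp, (hζ s hs).2]
    ring
  refine ⟨ζ, h0, h1, hr, hest, ⟨?_, ?_, ?_, fun t ht => (hdev t ht).nonsingular, b * v,
    mul_ne_zero hb h.ne_zero, fun t ht => (hdev t ht).local_eq⟩, ?_, ?_⟩
  · refine f.continuous.comp_continuousOn ((h.continuousOn hγ.source hγ.target).comp hc ?_)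
    intro t ht
    rcases ht.1.eq_or_lt with rfl | ht0
    · exact Or.inl h0
    rcases ht.2.eq_or_lt with rfl | ht1
    · exact Or.inr (Or.inl h1)
    · exact Or.inr (Or.inr (hr t ⟨ht0, ht1⟩))
  · simp only [h0, h.map_zero hγ.source]
  · simp only [h1, h.map_one hγ.target]
  · exact fun t ht heq => h.ne_left _ (hr t ht) (f.injective heq)
  · exact fun t ht heq => h.ne_right _ (hr t ht) (f.injective heq)

end Transfer

end TranslationSurface

/-! ### From nearby periods to near-translations. -/

namespace TranslationSurface

open Filter Set

variable {k : ℕ} {α : Fin k → ℕ} {M : TranslationSurface α} {T : ℕ}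
  {τ : Fin T → stdSimplex ℝ (Fin 3) → M.carrier} {w : Fin T → Fin 3 → ℂ}

/-- The triangles of a geodesic triangulation are not degenerate. -/
theorem IsGeodesicTriangulation.eq_zero (h : M.IsGeodesicTriangulation τ w) (j : Fin T)
    {d : Fin 3 → ℝ} (hd : ∑ i, d i = 0) (hdw : ∑ i, (d i : ℂ) * w j i = 0) : d = 0 := by
  -- If `d` were nonzero, a small move along it from the barycentre would leave the image unchanged,
  -- against injectivity on the interior.
  let z : Fin 3 → ℝ := fun _ => 1 / 3
  have hz : z ∈ stdSimplex ℝ (Fin 3) := ⟨fun i => by norm_num [z], by norm_num [z]⟩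
  let b : stdSimplex ℝ (Fin 3) := ⟨z, hz⟩
  have hns : τ j b ∉ M.singSet := by
    rw [h.sing_iff]
    rintro ⟨i, hi⟩
    norm_num [b, z] at hi
  obtain ⟨e, he, hbe⟩ := M.chart_cover _ hns
  obtain ⟨c, hc⟩ := h.geodesic j b e he hbe
  have hev := hc.and ((h.continuous j).continuousAt.eventually (e.open_source.mem_nhds hbe))
  rw [nhds_subtype_eq_comap, eventually_comap] at hev
  have hline : Continuous fun s : ℝ => z + s • d := by fun_prop
  have h1 := (hline.tendsto' 0 z (by simp)).eventually hev
  have h2 : ∀ᶠ s : ℝ in 𝓝 0, ∀ i, 0 < (z + s • d) i := by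
    refine eventually_all.2 fun i => ?_
    have : Continuous fun s : ℝ => (z + s • d) i := by fun_prop
    exact this.continuousAt.eventually (lt_mem_nhds (a := 0) (by norm_num [z]))
  obtain ⟨s, ⟨hs1, hs2⟩, hs0⟩ := (((h1.and h2).filter_mono nhdsWithin_le_nhds).and
    (self_mem_nhdsWithin (a := (0 : ℝ)) (s := {0}ᶜ))).exists
  have hs : z + s • d ∈ stdSimplex ℝ (Fin 3) := by
    refine ⟨fun i => (hs2 i).le, ?_⟩
    simp only [Pi.add_apply, Pi.smul_apply, smul_eq_mul, Finset.sum_add_distrib, ← Finset.mul_sum,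
      hd, mul_zero, add_zero]
    exact hz.2
  obtain ⟨h3, h4⟩ := hs1 ⟨_, hs⟩ rfl
  have h5 := hc.self_of_nhds
  have h6 : τ j ⟨_, hs⟩ = τ j b := by
    refine e.injOn h4 hbe ?_
    rw [h3, h5]
    simp only [b, Pi.add_apply, Pi.smul_apply, smul_eq_mul, Complex.ofReal_add, Complex.ofReal_mul,
      add_mul, Finset.sum_add_distrib, mul_assoc, ← Finset.mul_sum, hdw, mul_zero, add_zero]
  have h7 := (h.interior_inj j _ j b hs2 h6).2
  have h8 : s • d = 0 := by simpa [b] using congrArg Subtype.val h7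
  exact (smul_eq_zero.1 h8).resolve_left hs0

/-- Nondegeneracy makes an injective linear map on a finite-dimensional space, hence an
antilipschitz one. -/
theorem IsGeodesicTriangulation.exists_bound (h : M.IsGeodesicTriangulation τ w) (j : Fin T) :
    ∃ C : ℝ, 0 < C ∧ ∀ d : Fin 3 → ℝ, ∑ i, d i = 0 → ∀ i, |d i| ≤ C * ‖∑ i, (d i : ℂ) * w j i‖ := by
  let L : (Fin 3 → ℝ) →ₗ[ℝ] ℝ × ℂ :=
    { toFun := fun d => (∑ i, d i, ∑ i, (d i : ℂ) * w j i)
      map_add' := fun d d' => by simp [Finset.sum_add_distrib, add_mul]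
      map_smul' := fun r d => by simp [Finset.mul_sum, mul_assoc] }
  have hL : LinearMap.ker L = ⊥ := by
    rw [LinearMap.ker_eq_bot']
    intro d hd
    have hd' := Prod.ext_iff.1 hd
    exact h.eq_zero j hd'.1 hd'.2
  obtain ⟨K, hK, hKL⟩ := L.exists_antilipschitzWith hL
  refine ⟨K, by exact_mod_cast hK, fun d hd i => ?_⟩
  have h1 := hKL.le_mul_dist d 0
  rw [map_zero, dist_zero_right, dist_zero_right] at h1
  have h2 : ‖L d‖ = ‖∑ i, (d i : ℂ) * w j i‖ := by
    change ‖((∑ i, d i, ∑ i, (d i : ℂ) * w j i) : ℝ × ℂ)‖ = _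
    rw [hd, Prod.norm_mk, norm_zero, max_eq_right (norm_nonneg _)]
  rw [h2] at h1
  exact (norm_le_pi_norm d i).trans h1

/-- Surfaces with nearby periods are nearly related by a translation. -/
theorem IsGeodesicTriangulation.exists_isNearTranslation (h : M.IsGeodesicTriangulation τ w)
    {η : ℝ} (hη : 0 < η) : ∃ ε : ℝ, 0 < ε ∧ ∀ (M' : TranslationSurface α)
      (f : M.carrier ≃ₜ M'.carrier) (w' : Fin T → Fin 3 → ℂ), M.PreservesLabels M' f →
      M'.IsGeodesicTriangulation (fun j b => f (τ j b)) w' →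
      (∀ j a b, ‖(w' j b - w' j a) - (w j b - w j a)‖ < ε) → IsNearTranslation M M' η f := by
  choose C hC0 hC using h.exists_bound
  obtain ⟨S, hS⟩ : ∃ S, S = 1 + ∑ j, C j := ⟨_, rfl⟩
  have hCS : ∀ j, C j ≤ S := fun j => by
    have := Finset.single_le_sum (f := C) (fun j _ => (hC0 j).le) (Finset.mem_univ j)
    linarith
  have hS0 : 0 < S := by
    have := Finset.sum_nonneg (s := Finset.univ) fun j _ => (hC0 j).le
    linarith
  refine ⟨η / (3 * S), by positivity, fun M' f w' hf h' hw => ⟨hf, ?_⟩⟩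
  intro e he e' he' p hp hp'
  have hev : ∀ j, ∀ᶠ q in 𝓝 p, ∀ b' ∈ τ j ⁻¹' {q}, ∃ b, τ j b = p ∧
      e q - e p = ∑ i, ((b'.1 i - b.1 i : ℝ) : ℂ) * w j i ∧
      e' (f q) - e' (f p) = ∑ i, ((b'.1 i - b.1 i : ℝ) : ℂ) * w' j i := by
    intro j
    -- The map `τ j` is closed, so every preimage of a point `q` near `p` is close to a preimage of
    -- `p`, where both affine formulas hold. This also covers points on edges and triangles that
    -- miss `p`.
    have := ((h.continuous j).isClosedMap).eventually_nhds_fiber (p := fun b' =>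
      ∃ b, τ j b = p ∧ e (τ j b') - e p = ∑ i, ((b'.1 i - b.1 i : ℝ) : ℂ) * w j i ∧
        e' (f (τ j b')) - e' (f p) = ∑ i, ((b'.1 i - b.1 i : ℝ) : ℂ) * w' j i) p ?_
    · filter_upwards [this] with q hq b' hb'
      have hb'q : τ j b' = q := hb'
      have := hq b' hb'
      rwa [hb'q] at this
    · intro b hb
      have hb : τ j b = p := hb
      obtain ⟨c, hc⟩ := h.geodesic j b e he (hb ▸ hp)
      obtain ⟨c', hc'⟩ := h'.geodesic j b e' he' (hb ▸ hp')
      filter_upwards [hc, hc'] with b' h1 h2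
      have h3 := hc.self_of_nhds
      have h4 := hc'.self_of_nhds
      rw [hb] at h3 h4
      refine ⟨b, hb, ?_, ?_⟩
      · rw [h1, h3]
        simp only [Complex.ofReal_sub, sub_mul, Finset.sum_sub_distrib]
        ring
      · rw [h2, h4]
        simp only [Complex.ofReal_sub, sub_mul, Finset.sum_sub_distrib]
        ring
  filter_upwards [eventually_all.2 hev] with q hq
  obtain ⟨j, b', hb'⟩ := h.cover q
  obtain ⟨b, -, h1, h2⟩ := hq j b' hb'
  have hsum : ∑ i, (b'.1 i - b.1 i) = 0 := by
    rw [Finset.sum_sub_distrib, b'.2.2, b.2.2, sub_self]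
  have hb := hC j _ hsum
  rw [← h1] at hb
  have hsumC : ∑ i, ((b'.1 i - b.1 i : ℝ) : ℂ) = 0 := by exact_mod_cast hsum
  -- The coordinate differences sum to zero, so vertex `0` may serve as base point and only edge
  -- periods enter.
  have key : (e' (f q) - e' (f p)) - (e q - e p) = ∑ i, ((b'.1 i - b.1 i : ℝ) : ℂ) *
      ((w' j i - w' j 0) - (w j i - w j 0)) := by
    rw [h1, h2]
    have : ∀ i, ((b'.1 i - b.1 i : ℝ) : ℂ) * ((w' j i - w' j 0) - (w j i - w j 0)) =
        ((b'.1 i - b.1 i : ℝ) : ℂ) * w' j i - ((b'.1 i - b.1 i : ℝ) : ℂ) * w j i -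
        ((b'.1 i - b.1 i : ℝ) : ℂ) * (w' j 0 - w j 0) := fun i => by ring
    simp only [this, Finset.sum_sub_distrib, ← Finset.sum_mul, hsumC, zero_mul, sub_zero]
  rw [key]
  have hterm : ∀ i ∈ Finset.univ, ‖((b'.1 i - b.1 i : ℝ) : ℂ) *
      ((w' j i - w' j 0) - (w j i - w j 0))‖ ≤ C j * ‖e q - e p‖ * (η / (3 * S)) := by
    intro i _
    rw [norm_mul, Complex.norm_real, Real.norm_eq_abs]
    exact mul_le_mul (hb i) (hw j 0 i).le (norm_nonneg _)
      (mul_nonneg (hC0 j).le (norm_nonneg _))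
  refine (norm_sum_le_of_le _ hterm).trans ?_
  rw [Finset.sum_const, Finset.card_univ, Fintype.card_fin, nsmul_eq_mul]
  calc ((3 : ℕ) : ℝ) * (C j * ‖e q - e p‖ * (η / (3 * S)))
      = (C j / S) * (η * ‖e q - e p‖) := by push_cast; field_simp
    _ ≤ 1 * (η * ‖e q - e p‖) := by
        gcongr
        rw [div_le_one hS0]
        exact hCS j
    _ = η * ‖e q - e p‖ := one_mul _

theorem IsTranslationIso.isNearTranslation {N : TranslationSurface α}
    {f : M.carrier ≃ₜ N.carrier} (h : IsTranslationIso M N f) {η : ℝ} (hη : 0 ≤ η) :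
    IsNearTranslation M N η f := by
  refine ⟨h.labels, fun e he e' he' p hp hp' => ?_⟩
  obtain ⟨c, hc⟩ := h.translation e he e' he' p hp hp'
  filter_upwards [hc] with q hq
  rw [hq, hc.self_of_nhds, add_sub_add_right_eq_sub, sub_self, norm_zero]
  positivity

theorem IsNearTranslation.trans {N P : TranslationSurface α} {f : M.carrier ≃ₜ N.carrier}
    {f' : N.carrier ≃ₜ P.carrier} {η : ℝ} (h : IsNearTranslation M N η f)
    (h' : IsTranslationIso N P f') : IsNearTranslation M P η (f.trans f') := by
  refine ⟨fun i => by rw [Homeomorph.trans_apply, h.labels i, h'.labels i],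
    fun e he e' he' p hp hp' => ?_⟩
  obtain ⟨e₁, he₁, hp₁⟩ := N.chart_cover (f p) (h.labels.nonsing (M.nonsing_of_chart he hp))
  obtain ⟨c, hc⟩ := h'.translation e₁ he₁ e' he' (f p) hp₁ hp'
  filter_upwards [h.near e he e₁ he₁ p hp hp₁, f.continuous.continuousAt.eventually hc] with q h1 h2
  rw [Homeomorph.trans_apply, Homeomorph.trans_apply, h2, hc.self_of_nhds,
    add_sub_add_right_eq_sub]
  exact h1

end TranslationSurface

/-! ### Trajectories that meet arbitrarily close to a common endpoint. -/

namespace TranslationSurface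

open Filter Set

variable {k : ℕ} {α : Fin k → ℕ} {M : TranslationSurface α} {x y : M.carrier}

/-- A positive factor leaves the argument unchanged, so no branch cut is crossed. -/
theorem ofReal_mul_cpow {r : ℝ} (hr : 0 < r) (z w : ℂ) :
    ((r : ℂ) * z) ^ w = (r : ℂ) ^ w * z ^ w := by
  have hr' : (r : ℂ) ≠ 0 := by exact_mod_cast hr.ne'
  by_cases hz : z = 0
  · subst hz
    by_cases hw : w = 0
    · simp [hw]
    · simp [Complex.zero_cpow hw]
  · rw [Complex.cpow_def_of_ne_zero (mul_ne_zero hr' hz), Complex.cpow_def_of_ne_zero hr',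
      Complex.cpow_def_of_ne_zero hz, Complex.log_ofReal_mul hr hz, add_mul, Complex.exp_add,
      Complex.ofReal_log hr.le]

section SameDirection

variable {γ₁ γ₂ : ℝ → M.carrier} {v₁ v₂ : ℂ} {κ₁ κ₂ : ℝ} {G₁ G₂ : ℂ → M.carrier}

theorem IsDiamond.isDevAt_real (h : M.IsDiamond x y γ₁ v₁ κ₁ G₁) {t : ℝ}
    (ht : t ∈ Ioo (0 : ℝ) 1) : M.IsDevAt (fun s : ℝ => (s : ℂ) * v₁) γ₁ t := by
  refine (IsDevAt.comp (s := fun s : ℝ => (s : ℂ)) (h.isDevAt t (ofReal_mem_rhombus h.pos ht))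
    Complex.continuous_ofReal.continuousAt).congr_map ?_
  filter_upwards [Icc_mem_nhds ht.1 ht.2] with s hs using h.real s hs

/-- Unique continuation extends the initial agreement to all times. If `σ < 1`, then `γ₂` would
reach `y` at the interior time `σ`, which primitivity excludes. -/
theorem IsPrimitive.eqOn_of_eventually (h₁ : M.IsPrimitive x y γ₁) (h₂ : M.IsPrimitive x y γ₂)
    (d₁ : M.IsDiamond x y γ₁ v₁ κ₁ G₁) (d₂ : M.IsDiamond x y γ₂ v₂ κ₂ G₂) {σ : ℝ} (hσ0 : 0 < σ)
    (hσ1 : σ ≤ 1) (hv : v₁ = σ * v₂) (hev : ∀ᶠ t in 𝓝[>] (0 : ℝ), γ₁ t = γ₂ (σ * t)) :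
    EqOn γ₁ γ₂ (Icc 0 1) := by
  have hmem : ∀ t ∈ Ioo (0 : ℝ) 1, σ * t ∈ Ioo (0 : ℝ) 1 := fun t ht =>
    ⟨mul_pos hσ0 ht.1, by nlinarith [ht.1, ht.2]⟩
  have hdev : ∀ t ∈ Ioo (0 : ℝ) 1,
      M.IsDevAt (fun s : ℝ => (s : ℂ) * v₁) (fun s => γ₂ (σ * s)) t := by
    intro t ht
    refine (IsDevAt.comp (s := fun s : ℝ => σ * s) (d₂.isDevAt_real (hmem t ht))
      (by fun_prop)).congr (EventuallyEq.refl _ _) ⟨0, Eventually.of_forall fun s => ?_⟩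
    simp only [Function.comp, hv]
    push_cast
    ring
  obtain ⟨t₀, ht₀, ht₀m⟩ := (hev.and (Ioo_mem_nhdsGT one_pos)).exists
  have heq : EqOn γ₁ (fun s => γ₂ (σ * s)) (Ioo 0 1) :=
    eqOn_of_isDevAt isPreconnected_Ioo (fun t ht => d₁.isDevAt_real ht) hdev ht₀m ht₀
  have heq' : EqOn γ₁ (fun s => γ₂ (σ * s)) (Icc 0 1) := by
    refine heq.of_subset_closure h₁.isTrajectory.continuousOn ?_ Ioo_subset_Icc_self
      (closure_Ioo zero_ne_one).ge
    exact h₂.isTrajectory.continuousOn.comp (by fun_prop) fun t ht =>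
      ⟨mul_nonneg hσ0.le ht.1, by nlinarith [ht.1, ht.2]⟩
  rcases hσ1.eq_or_lt with rfl | hlt
  · simpa using heq'
  · have h1 := heq' (x := 1) ⟨zero_le_one, le_rfl⟩
    rw [h₁.isTrajectory.target] at h1
    simp only [mul_one] at h1
    exact absurd h1.symm (h₂.ne_right σ ⟨hσ0, hlt⟩)

theorem IsDiamond.eventually_left {γ : ℝ → M.carrier} {v : ℂ} {κ : ℝ} {G : ℂ → M.carrier}
    (h : M.IsDiamond x y γ v κ G) {φ : OpenPartialHomeomorph M.carrier ℂ} {m : ℕ} {l : ℂ}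
    (hl : ∀ᶠ u in 𝓝[rhombus κ] 0, G u ∈ φ.source ∧ φ (G u) = l * u ^ ((m : ℂ)⁻¹)) :
    ∀ᶠ t in 𝓝[>] (0 : ℝ), γ t ∈ φ.source ∧ φ (γ t) = l * (t : ℂ) ^ ((m : ℂ)⁻¹) := by
  have ht : Tendsto (fun t : ℝ => (t : ℂ)) (𝓝[>] 0) (𝓝[rhombus κ] 0) := by
    refine tendsto_nhdsWithin_iff.2 ⟨?_, ?_⟩
    · exact (Complex.continuous_ofReal.tendsto' 0 0 Complex.ofReal_zero).mono_left
        nhdsWithin_le_nhds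
    · filter_upwards [Ioo_mem_nhdsGT one_pos] with t ht using ofReal_mem_rhombus h.pos ht
  filter_upwards [ht.eventually hl, Ioo_mem_nhdsGT one_pos] with t h1 h2
  rwa [h.real t ⟨h2.1.le, h2.2.le⟩] at h1

/-- Here it matters that the error is relative: the direction of `u` seen from the tip converges
even when `u` itself tends to the tip. -/
theorem tendsto_root_div {ι : Type*} {F : Filter ι} {u : ι → ℂ} {s η : ι → ℝ}
    (hη : Tendsto η F (𝓝 0)) (hu : ∀ᶠ i in F, 0 < s i ∧ ‖u i - s i‖ ≤ η i * s i) (m : ℕ) :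
    Tendsto (fun i => (u i / s i) ^ ((m : ℂ)⁻¹)) F (𝓝 1) := by
  have h1 : Tendsto (fun i => u i / s i) F (𝓝 1) := by
    rw [tendsto_iff_norm_sub_tendsto_zero]
    refine squeeze_zero' (Eventually.of_forall fun _ => norm_nonneg _) ?_ hη
    filter_upwards [hu] with i hi
    have hs : (s i : ℂ) ≠ 0 := by exact_mod_cast hi.1.ne'
    rw [div_sub_one hs, norm_div, Complex.norm_real, Real.norm_of_nonneg hi.1.le,
      div_le_iff₀ hi.1]
    exact hi.2
  have h2 : ContinuousAt (fun z : ℂ => z ^ ((m : ℂ)⁻¹)) 1 :=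
    continuousAt_id.cpow continuousAt_const (Or.inl (by simp))
  have h3 := h2.tendsto.comp h1
  simp only [Complex.one_cpow] at h3
  exact h3

theorem tendsto_of_relative {ι : Type*} {F : Filter ι} {u : ι → ℂ} {s η : ι → ℝ} {κ : ℝ}
    (hη : Tendsto η F (𝓝 0)) (hs : Tendsto s F (𝓝 0))
    (hu : ∀ᶠ i in F, 0 < s i ∧ ‖u i - s i‖ ≤ η i * s i) (hr : ∀ᶠ i in F, u i ∈ rhombus κ) :
    Tendsto u F (𝓝[rhombus κ] 0) := by
  refine tendsto_nhdsWithin_iff.2 ⟨?_, hr⟩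
  have h1 : Tendsto (fun i => u i - s i) F (𝓝 0) := by
    rw [tendsto_zero_iff_norm_tendsto_zero]
    refine squeeze_zero' (Eventually.of_forall fun _ => norm_nonneg _) (hu.mono fun i hi => hi.2) ?_
    simpa using hη.mul hs
  have h2 : Tendsto (fun i => (s i : ℂ)) F (𝓝 0) :=
    (Complex.continuous_ofReal.tendsto' 0 0 Complex.ofReal_zero).comp hs
  simpa using h1.add h2

/-- Two primitive trajectories that have nearby deformations meeting at points which approach the
starting point coincide. -/
theorem IsPrimitive.eqOn_of_tendsto (h₁ : M.IsPrimitive x y γ₁) (h₂ : M.IsPrimitive x y γ₂)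
    (d₁ : M.IsDiamond x y γ₁ v₁ κ₁ G₁) (d₂ : M.IsDiamond x y γ₂ v₂ κ₂ G₂)
    {ι : Type*} {F : Filter ι} [F.NeBot] {u₁ u₂ : ι → ℂ} {s₁ s₂ η : ι → ℝ}
    (hη : Tendsto η F (𝓝 0)) (hs₁ : Tendsto s₁ F (𝓝 0)) (hs₂ : Tendsto s₂ F (𝓝 0))
    (hu₁ : ∀ᶠ i in F, 0 < s₁ i ∧ ‖u₁ i - s₁ i‖ ≤ η i * s₁ i)
    (hu₂ : ∀ᶠ i in F, 0 < s₂ i ∧ ‖u₂ i - s₂ i‖ ≤ η i * s₂ i)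
    (hr₁ : ∀ᶠ i in F, u₁ i ∈ rhombus κ₁) (hr₂ : ∀ᶠ i in F, u₂ i ∈ rhombus κ₂)
    (heq : ∀ᶠ i in F, G₁ (u₁ i) = G₂ (u₂ i)) : EqOn γ₁ γ₂ (Icc 0 1) := by
  obtain ⟨φ, m, hφ⟩ := M.exists_isConeChart x
  obtain ⟨l₁, hl₁, hL₁⟩ := d₁.left φ m hφ
  obtain ⟨l₂, hl₂, hL₂⟩ := d₂.left φ m hφ
  have hl0 : ∀ {l v : ℂ}, l ^ m = v → v ≠ 0 → l ≠ 0 := by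
    rintro l v h hv rfl
    rw [zero_pow hφ.ne_zero] at h
    exact hv h.symm
  have hl₁0 := hl0 hl₁ d₁.ne_zero
  have hl₂0 := hl0 hl₂ d₂.ne_zero
  have t₁ := tendsto_of_relative hη hs₁ hu₁ hr₁
  have t₂ := tendsto_of_relative hη hs₂ hu₂ hr₂
  have w₁ := tendsto_root_div hη hu₁ m
  have w₂ := tendsto_root_div hη hu₂ m
  -- At a common point the two root expressions in the cone chart agree, so `l₁ / l₂` times a factor
  -- tending to `1` is a positive real number.
  have hreal : l₁ / l₂ ∈ {z : ℂ | 0 ≤ z.re ∧ z.im = 0} := by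
    have hcl : IsClosed {z : ℂ | 0 ≤ z.re ∧ z.im = 0} :=
      (isClosed_le continuous_const Complex.continuous_re).inter
        (isClosed_eq Complex.continuous_im continuous_const)
    have hlim : Tendsto (fun i => l₁ / l₂ * ((u₁ i / s₁ i) ^ ((m : ℂ)⁻¹) /
        (u₂ i / s₂ i) ^ ((m : ℂ)⁻¹))) F (𝓝 (l₁ / l₂)) := by
      simpa using (tendsto_const_nhds (x := l₁ / l₂)).mul (w₁.div w₂ one_ne_zero)
    refine hcl.mem_of_tendsto hlim ?_
    filter_upwards [t₁.eventually hL₁, t₂.eventually hL₂, hu₁, hu₂, heq,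
      w₂.eventually_ne one_ne_zero] with i a₁ a₂ b₁ b₂ hi hw
    have e₁ : u₁ i ^ ((m : ℂ)⁻¹) = ((s₁ i ^ ((m : ℝ)⁻¹) : ℝ) : ℂ) * (u₁ i / s₁ i) ^ ((m : ℂ)⁻¹) := by
      have hs : (s₁ i : ℂ) ≠ 0 := by exact_mod_cast b₁.1.ne'
      rw [Complex.ofReal_cpow b₁.1.le]
      push_cast
      rw [← ofReal_mul_cpow b₁.1, mul_div_cancel₀ _ hs]
    have e₂ : u₂ i ^ ((m : ℂ)⁻¹) = ((s₂ i ^ ((m : ℝ)⁻¹) : ℝ) : ℂ) * (u₂ i / s₂ i) ^ ((m : ℂ)⁻¹) := by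
      have hs : (s₂ i : ℂ) ≠ 0 := by exact_mod_cast b₂.1.ne'
      rw [Complex.ofReal_cpow b₂.1.le]
      push_cast
      rw [← ofReal_mul_cpow b₂.1, mul_div_cancel₀ _ hs]
    have p₁ : 0 < s₁ i ^ ((m : ℝ)⁻¹) := Real.rpow_pos_of_pos b₁.1 _
    have p₂ : 0 < s₂ i ^ ((m : ℝ)⁻¹) := Real.rpow_pos_of_pos b₂.1 _
    have h3 := a₁.2
    rw [hi, a₂.2, e₁, e₂] at h3
    have p₁' : ((s₁ i ^ ((m : ℝ)⁻¹) : ℝ) : ℂ) ≠ 0 := by exact_mod_cast p₁.ne'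
    have h4 : l₁ / l₂ * ((u₁ i / s₁ i) ^ ((m : ℂ)⁻¹) / (u₂ i / s₂ i) ^ ((m : ℂ)⁻¹)) =
        ((s₂ i ^ ((m : ℝ)⁻¹) / s₁ i ^ ((m : ℝ)⁻¹) : ℝ) : ℂ) := by
      rw [Complex.ofReal_div, div_mul_div_comm, div_eq_div_iff (mul_ne_zero hl₂0 hw) p₁']
      linear_combination -h3
    rw [h4]
    exact ⟨by rw [Complex.ofReal_re]; positivity, Complex.ofReal_im _⟩
  obtain ⟨ρ, hρ⟩ : ∃ ρ, ρ = (l₁ / l₂).re := ⟨_, rfl⟩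
  have hρl : l₁ = ρ * l₂ := by
    have : l₁ / l₂ = ρ := Complex.ext (by simp [hρ]) (by simpa using hreal.2)
    rw [← this, div_mul_cancel₀ _ hl₂0]
  have hρ0 : 0 < ρ := by
    refine lt_of_le_of_ne (hρ ▸ hreal.1) ?_
    rintro rfl
    exact hl₁0 (by simpa using hρl)
  have key : ∀ {γ γ' : ℝ → M.carrier} {v v' l l' : ℂ} {κ κ' : ℝ} {G G' : ℂ → M.carrier},
      M.IsPrimitive x y γ → M.IsPrimitive x y γ' → M.IsDiamond x y γ v κ G →
      M.IsDiamond x y γ' v' κ' G' → l ^ m = v → l' ^ m = v' →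
      (∀ᶠ u in 𝓝[rhombus κ] 0, G u ∈ φ.source ∧ φ (G u) = l * u ^ ((m : ℂ)⁻¹)) →
      (∀ᶠ u in 𝓝[rhombus κ'] 0, G' u ∈ φ.source ∧ φ (G' u) = l' * u ^ ((m : ℂ)⁻¹)) →
      ∀ r : ℝ, 0 < r → r ≤ 1 → l = r * l' → EqOn γ γ' (Icc 0 1) := by
    intro γ γ' v v' l l' κ κ' G G' h h' d d' hl hl' hL hL' r hr0 hr1 hll
    have hrm : 0 < r ^ m := pow_pos hr0 m
    -- A ratio `r` between the roots in the cone chart is a ratio `r ^ m` between the velocities.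
    refine h.eqOn_of_eventually h' d d' hrm (pow_le_one₀ hr0.le hr1) ?_ ?_
    · rw [← hl, ← hl', hll, mul_pow, Complex.ofReal_pow]
    · have hscale : Tendsto (fun t : ℝ => r ^ m * t) (𝓝[>] 0) (𝓝[>] 0) := by
        refine tendsto_nhdsWithin_iff.2 ⟨?_, ?_⟩
        · exact ((continuous_const.mul continuous_id).tendsto' 0 0 (by simp)).mono_left
            nhdsWithin_le_nhds
        · filter_upwards [self_mem_nhdsWithin] with t ht using mul_pos hrm ht
      filter_upwards [d.eventually_left hL, hscale.eventually (d'.eventually_left hL')]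
        with t a₁ a₂
      refine φ.injOn a₁.1 a₂.1 ?_
      rw [a₁.2, a₂.2, Complex.ofReal_mul, ofReal_mul_cpow hrm, hll]
      have : ((r ^ m : ℝ) : ℂ) ^ ((m : ℂ)⁻¹) = r := by
        have h3 := Real.pow_rpow_inv_natCast hr0.le hφ.ne_zero
        have h4 := Complex.ofReal_cpow hrm.le ((m : ℝ)⁻¹)
        rw [h3] at h4
        push_cast at h4 ⊢
        exact h4.symm
      rw [this]
      ring
  rcases le_total ρ 1 with h | h
  · exact key h₁ h₂ d₁ d₂ hl₁ hl₂ hL₁ hL₂ ρ hρ0 h hρl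
  · refine (key h₂ h₁ d₂ d₁ hl₂ hl₁ hL₂ hL₁ ρ⁻¹ (inv_pos.2 hρ0) (inv_le_one_of_one_le₀ h) ?_).symm
    have : (ρ : ℂ) ≠ 0 := by exact_mod_cast hρ0.ne'
    rw [hρl, Complex.ofReal_inv, inv_mul_cancel_left₀ this]

end SameDirection

end TranslationSurface

/-! ### Class blocking and its passage to limits. -/

namespace TranslationSurface

open Filter Set

variable {k : ℕ} {α : Fin k → ℕ}

/-- Among any three members of `C` two agree on `[0, 1]`. -/
def AtMostTwo {X : Type*} (C : Set (ℝ → X)) : Prop :=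
  ∀ γ₁ ∈ C, ∀ γ₂ ∈ C, ∀ γ₃ ∈ C, EqOn γ₁ γ₂ (Icc 0 1) ∨ EqOn γ₁ γ₃ (Icc 0 1) ∨ EqOn γ₂ γ₃ (Icc 0 1)

/-- For each pair of points the primitive trajectories fall into `n` classes, each of which has at
most two members or is blocked by a single point. Unlike bounded blocking with a given bound, this
property is closed. -/
def ClassBlocking (M : TranslationSurface α) (n : ℕ) : Prop :=
  ∀ x y : M.carrier, ∃ C : Fin n → Set (ℝ → M.carrier),
    (∀ γ, M.IsPrimitive x y γ → ∃ j, γ ∈ C j) ∧ ∀ j, (∀ γ ∈ C j, M.IsPrimitive x y γ) ∧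
      (AtMostTwo (C j) ∨ ∃ b, b ≠ x ∧ b ≠ y ∧ ∀ γ ∈ C j, b ∈ γ '' Icc 0 1)

theorem BoundedBlocking.exists_blockingSet {M : TranslationSurface α} {n : ℕ}
    (h : M.BoundedBlocking n) (x y : M.carrier) : ∃ B, M.IsBlockingSet x y B ∧ B.card ≤ n := by
  obtain ⟨⟨B₀, hB₀⟩, hn⟩ := h x y
  obtain ⟨B, hB, hBc⟩ := Nat.sInf_mem (s := {m | ∃ B, M.IsBlockingSet x y B ∧ B.card = m})
    ⟨_, B₀, hB₀, rfl⟩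
  exact ⟨B, hB, hBc.trans_le hn⟩

theorem boundedBlocking_of_exists {M : TranslationSurface α} {n : ℕ}
    (h : ∀ x y, ∃ B, M.IsBlockingSet x y B ∧ B.card ≤ n) : M.BoundedBlocking n := by
  intro x y
  obtain ⟨B, hB, hn⟩ := h x y
  have hmem : B.card ∈ {m | ∃ B, M.IsBlockingSet x y B ∧ B.card = m} := ⟨B, hB, rfl⟩
  exact ⟨⟨B, hB⟩, (Nat.sInf_le hmem).trans hn⟩

theorem IsTrajectory.of_act {M : TranslationSurface α} {g : Matrix.SpecialLinearGroup (Fin 2) ℝ}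
    {x y : M.carrier} {γ : ℝ → M.carrier} (h : (act g M).IsTrajectory x y γ) :
    M.IsTrajectory x y γ := by
  obtain ⟨v, hv, hs⟩ := h.straight
  have hinv : ∀ z, planeFun g⁻¹ (planeFun g z) = z := fun z => by
    rw [← planeFun_mul, inv_mul_cancel, planeFun_one]
  have hinv' : ∀ z, planeFun g (planeFun g⁻¹ z) = z := fun z => by
    rw [← planeFun_mul, mul_inv_cancel, planeFun_one]
  have hsmul : ∀ (s : ℝ) (z : ℂ), planeFun g⁻¹ (s * z) = s * planeFun g⁻¹ z := fun s z => by
    apply Complex.ext <;> simp [planeFun] <;> ring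
  refine ⟨h.continuousOn, h.source, h.target, h.nonsingular, planeFun g⁻¹ v, ?_, ?_⟩
  · intro h0
    apply hv
    rw [← hinv' v, h0]
    apply Complex.ext <;> simp [planeFun]
  · intro t ht e he hte
    obtain ⟨c, hc⟩ := hs t ht (e.transHomeomorph (planeHomeo g)) ⟨e, he, rfl⟩ hte
    refine ⟨planeFun g⁻¹ c, ?_⟩
    filter_upwards [hc] with s hs
    have hs : planeFun g (e (γ s)) = s * v + c := hs
    rw [← hinv (e (γ s)), hs, planeFun_add, hsmul]

/-- Applying `g⁻¹` to velocities shows that trajectories of `g M` are trajectories of `M`, so the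
same blocking sets serve. -/
theorem BoundedBlocking.act {M : TranslationSurface α} {n : ℕ} (h : M.BoundedBlocking n)
    (g : Matrix.SpecialLinearGroup (Fin 2) ℝ) : (act g M).BoundedBlocking n :=
  boundedBlocking_of_exists fun x y => by
    obtain ⟨B, hB, hn⟩ := h.exists_blockingSet x y
    exact ⟨B, ⟨hB.left_notMem, hB.right_notMem, fun γ hγ => hB.meets γ hγ.of_act⟩, hn⟩

/-- Class `j` consists of the primitive trajectories through the `j`-th point of a blocking set;
indices beyond its cardinality give empty classes. -/
theorem BoundedBlocking.classBlocking {M : TranslationSurface α} {n : ℕ}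
    (h : M.BoundedBlocking n) : M.ClassBlocking n := by
  intro x y
  obtain ⟨B, hB, hn⟩ := h.exists_blockingSet x y
  refine ⟨fun j => {γ | M.IsPrimitive x y γ ∧ ∃ b ∈ B.toList[(j : ℕ)]?, b ∈ γ '' Icc 0 1}, ?_, ?_⟩
  · intro γ hγ
    obtain ⟨t, ht, hb⟩ := hB.meets γ hγ.isTrajectory
    obtain ⟨i, hi, hib⟩ := List.getElem_of_mem (Finset.mem_toList.2 hb)
    rw [Finset.length_toList] at hi
    refine ⟨⟨i, hi.trans_le hn⟩, hγ, γ t, ?_, ⟨t, ht, rfl⟩⟩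
    rw [Option.mem_def, List.getElem?_eq_some_iff]
    exact ⟨by rwa [Finset.length_toList], hib⟩
  · intro j
    refine ⟨fun γ hγ => hγ.1, ?_⟩
    rcases hj : B.toList[(j : ℕ)]? with _ | b
    · left
      rintro γ ⟨-, b, hb, -⟩
      rw [hj] at hb
      exact absurd hb (by simp)
    · right
      have hbB : b ∈ B := Finset.mem_toList.1 (List.mem_of_getElem? hj)
      refine ⟨b, fun h => hB.left_notMem (h ▸ hbB), fun h => hB.right_notMem (h ▸ hbB), ?_⟩
      rintro γ ⟨-, b', hb', hb''⟩
      rw [hj, Option.mem_def, Option.some.injEq] at hb'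
      rwa [hb']

theorem IsTrajectory.restrict {M : TranslationSurface α} {x y : M.carrier} {γ : ℝ → M.carrier}
    (h : M.IsTrajectory x y γ) {a b : ℝ} (ha : 0 ≤ a) (hab : a < b) (hb : b ≤ 1) :
    M.IsTrajectory (γ a) (γ b) (fun t => γ (a + t * (b - a))) := by
  obtain ⟨v, hv, hd⟩ := h.exists_isDevAt
  have hba : 0 < b - a := sub_pos.2 hab
  have hdev : ∀ t ∈ Ioo (0 : ℝ) 1, M.IsDevAt (fun s : ℝ => (s : ℂ) * (((b - a : ℝ) : ℂ) * v))
      (fun t => γ (a + t * (b - a))) t := by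
    intro t ht
    refine (IsDevAt.comp (s := fun t : ℝ => a + t * (b - a))
      (hd _ ⟨by nlinarith [ht.1], by nlinarith [ht.1, ht.2]⟩) (by fun_prop)).congr
      (EventuallyEq.refl _ _) ⟨a * v, Eventually.of_forall fun s => ?_⟩
    simp only [Function.comp]
    push_cast
    ring
  refine ⟨h.continuousOn.comp (by fun_prop) fun t ht =>
    ⟨by nlinarith [ht.1], by nlinarith [ht.1, ht.2]⟩, by simp, by simp,
    fun t ht => (hdev t ht).nonsingular, ((b - a : ℝ) : ℂ) * v,
    mul_ne_zero (by exact_mod_cast hba.ne') hv, fun t ht => (hdev t ht).local_eq⟩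

theorem IsTrajectory.eventually_ne {M : TranslationSurface α} {x y : M.carrier}
    {γ : ℝ → M.carrier} (h : M.IsTrajectory x y γ) (z : M.carrier) :
    ∀ᶠ t in 𝓝[>] (0 : ℝ), γ t ≠ z := by
  by_cases hz : z = x
  · subst hz
    obtain ⟨v, hv, hd⟩ := h.exists_isDevAt
    obtain ⟨φ, m, hφ⟩ := M.exists_isConeChart z
    obtain ⟨ε, hε, l, hl, hs⟩ := exists_root_of_isDevAt hd h.tendsto_left hφ
    filter_upwards [Ioo_mem_nhdsGT hε] with t ht heq
    have h1 := (hs t ht).2.2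
    rw [heq, hφ.map_self] at h1
    rcases mul_eq_zero.1 h1.symm with h2 | h2
    · rw [h2, zero_pow hφ.ne_zero] at hl
      exact hv hl.symm
    · have h3 := ((Complex.cpow_eq_zero_iff _ _).1 h2).1
      exact ht.1.ne' (by exact_mod_cast h3)
  · exact h.tendsto_left.eventually_ne (Ne.symm hz)

/-- Every trajectory contains a primitive one. -/
theorem IsTrajectory.exists_isPrimitive {M : TranslationSurface α} {x y : M.carrier}
    {γ : ℝ → M.carrier} (h : M.IsTrajectory x y γ) :
    ∃ γ', M.IsPrimitive x y γ' ∧ γ' '' Icc 0 1 ⊆ γ '' Icc 0 1 := by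
  obtain ⟨ε, hε, hεy⟩ := mem_nhdsGT_iff_exists_Ioo_subset.1 (h.eventually_ne y)
  have hε : 0 < ε := hε
  have hcl : ∀ z : M.carrier, ∀ c d : ℝ, 0 ≤ c → d ≤ 1 → IsCompact (Icc c d ∩ γ ⁻¹' {z}) := by
    intro z c d hc hd
    refine isCompact_Icc.of_isClosed_subset ?_ inter_subset_left
    exact (h.continuousOn.mono (Icc_subset_Icc hc hd)).preimage_isClosed_of_isClosed isClosed_Icc
      isClosed_singleton
  -- The first visit to `y` after time `0`. It exists because the path avoids `y` on `(0, ε)`, which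
  -- reduces the search to a compact interval.
  obtain ⟨b, ⟨hb, hby⟩, hbmin⟩ : ∃ b, (b ∈ Ioc (0 : ℝ) 1 ∧ γ b = y) ∧
      ∀ t ∈ Ioo 0 b, γ t ≠ y := by
    obtain ⟨ε', hε', hε1, hεε⟩ : ∃ ε' > 0, ε' ≤ 1 ∧ ε' < ε :=
      ⟨min 1 (ε / 2), by positivity, min_le_left _ _, (min_le_right _ _).trans_lt (by linarith)⟩
    obtain ⟨b, hb, hmin⟩ := (hcl y ε' 1 hε'.le le_rfl).exists_isLeast ⟨1, ⟨hε1, le_rfl⟩, h.target⟩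
    refine ⟨b, ⟨⟨hε'.trans_le hb.1.1, hb.1.2⟩, hb.2⟩, fun t ht hty => ?_⟩
    rcases lt_or_ge t ε with h1 | h1
    · exact hεy ⟨ht.1, h1⟩ hty
    · exact (hmin ⟨⟨hεε.le.trans h1, ht.2.le.trans hb.1.2⟩, hty⟩).not_gt ht.2
  -- The last visit to `x` before `b`; when `x = y` there is none in between, and `a = 0` serves.
  obtain ⟨a, ha, hax, hamax⟩ : ∃ a ∈ Ico 0 b, γ a = x ∧ ∀ t ∈ Ioo a b, γ t ≠ x := by
    by_cases hxy : x = y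
    · exact ⟨0, ⟨le_rfl, hb.1⟩, h.source, fun t ht => hxy ▸ hbmin t ht⟩
    · obtain ⟨a, ha, hmax⟩ := (hcl x 0 b le_rfl hb.2).exists_isGreatest
        ⟨0, ⟨le_rfl, hb.1.le⟩, h.source⟩
      have hab : a ≠ b := by
        rintro rfl
        exact hxy (ha.2.symm.trans hby)
      exact ⟨a, ⟨ha.1.1, lt_of_le_of_ne ha.1.2 hab⟩, ha.2, fun t ht htx =>
        (hmax ⟨⟨ha.1.1.trans ht.1.le, ht.2.le⟩, htx⟩).not_gt ht.1⟩
  have hres := h.restrict ha.1 ha.2 hb.2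
  rw [hax, hby] at hres
  have hba : 0 < b - a := sub_pos.2 ha.2
  refine ⟨_, ⟨hres, fun t ht => hamax _ ⟨by nlinarith [ht.1], by nlinarith [ht.2]⟩,
    fun t ht => hbmin _ ⟨by nlinarith [ht.1, ha.1], by nlinarith [ht.2]⟩⟩, ?_⟩
  rintro _ ⟨t, ht, rfl⟩
  exact ⟨_, ⟨by nlinarith [ht.1, ha.1], by nlinarith [ht.2, hb.2]⟩, rfl⟩

/-- Midpoints are chosen because a midpoint of a primitive trajectory is never an endpoint. -/
theorem AtMostTwo.exists_finset {X : Type*} {C : Set (ℝ → X)} (h : AtMostTwo C) :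
    ∃ B : Finset X, B.card ≤ 2 ∧ (∀ γ ∈ C, γ (1 / 2) ∈ B) ∧ ∀ b ∈ B, ∃ γ ∈ C, γ (1 / 2) = b := by
  classical
  have hmid : (1 / 2 : ℝ) ∈ Icc (0 : ℝ) 1 := ⟨by norm_num, by norm_num⟩
  rcases C.eq_empty_or_nonempty with rfl | ⟨γ₁, h₁⟩
  · exact ⟨∅, by simp, by simp, by simp⟩
  by_cases hall : ∀ γ ∈ C, γ (1 / 2) = γ₁ (1 / 2)
  · exact ⟨{γ₁ (1 / 2)}, by simp, by simpa using hall, by simpa using ⟨γ₁, h₁, rfl⟩⟩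
  · push Not at hall
    obtain ⟨γ₂, h₂, hne⟩ := hall
    refine ⟨{γ₁ (1 / 2), γ₂ (1 / 2)}, Finset.card_le_two, fun γ hγ => ?_, fun b hb => ?_⟩
    · rw [Finset.mem_insert, Finset.mem_singleton]
      rcases h γ₁ h₁ γ₂ h₂ γ hγ with h | h | h
      · exact absurd (h hmid).symm hne
      · exact Or.inl (h hmid).symm
      · exact Or.inr (h hmid).symm
    · rw [Finset.mem_insert, Finset.mem_singleton] at hb
      rcases hb with rfl | rfl
      · exact ⟨γ₁, h₁, rfl⟩
      · exact ⟨γ₂, h₂, rfl⟩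

theorem ClassBlocking.boundedBlocking {M : TranslationSurface α} {n : ℕ}
    (h : M.ClassBlocking n) : M.BoundedBlocking (n * 2) := by
  classical
  refine boundedBlocking_of_exists fun x y => ?_
  obtain ⟨C, hcov, hC⟩ := h x y
  have hmid : (1 / 2 : ℝ) ∈ Ioo (0 : ℝ) 1 := ⟨by norm_num, by norm_num⟩
  have key : ∀ j, ∃ B : Finset M.carrier, B.card ≤ 2 ∧ x ∉ B ∧ y ∉ B ∧
      ∀ γ ∈ C j, ∃ b ∈ B, b ∈ γ '' Icc 0 1 := by
    intro j
    obtain ⟨hprim, h2 | ⟨b, hbx, hby, hb⟩⟩ := hC j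
    · obtain ⟨B, hB2, hB, hB'⟩ := h2.exists_finset
      refine ⟨B, hB2, fun hx => ?_, fun hy => ?_,
        fun γ hγ => ⟨_, hB γ hγ, _, Ioo_subset_Icc_self hmid, rfl⟩⟩
      · obtain ⟨γ, hγ, hγx⟩ := hB' x hx
        exact (hprim γ hγ).ne_left _ hmid hγx
      · obtain ⟨γ, hγ, hγy⟩ := hB' y hy
        exact (hprim γ hγ).ne_right _ hmid hγy
    · exact ⟨{b}, by simp, by simpa using hbx.symm, by simpa using hby.symm,
        fun γ hγ => ⟨b, by simp, hb γ hγ⟩⟩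
  choose B hB2 hBx hBy hB using key
  refine ⟨Finset.univ.biUnion B, ⟨by simpa using hBx, by simpa using hBy, fun γ hγ => ?_⟩, ?_⟩
  · obtain ⟨γ', hγ', hsub⟩ := hγ.exists_isPrimitive
    obtain ⟨j, hj⟩ := hcov γ' hγ'
    obtain ⟨b, hb, hbγ⟩ := hB j γ' hj
    obtain ⟨t, ht, rfl⟩ := hsub hbγ
    exact ⟨t, ht, Finset.mem_biUnion.2 ⟨j, Finset.mem_univ _, hb⟩⟩
  · simpa using Finset.card_biUnion_le_card_mul Finset.univ B 2 fun j _ => hB2 j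

/-- The class blocking property passes to limits. -/
theorem ClassBlocking.of_isNearTranslation {N : TranslationSurface α} {n : ℕ}
    {M : ℕ → TranslationSurface α} {η : ℕ → ℝ} {f : ∀ i, N.carrier ≃ₜ (M i).carrier}
    (hη0 : ∀ i, 0 ≤ η i) (hη : Tendsto η atTop (𝓝 0))
    (hf : ∀ i, IsNearTranslation N (M i) (η i) (f i)) (hM : ∀ i, (M i).ClassBlocking n) :
    N.ClassBlocking n := by
  intro x y
  -- An ultrafilter settles finite alternatives and provides limits in compact spaces for all
  -- trajectories at once, where a subsequence would handle only countably many.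
  let U : Ultrafilter ℕ := Ultrafilter.of atTop
  have hηU : Tendsto η U (𝓝 0) := hη.mono_left (Ultrafilter.of_le _)
  have h3η : Tendsto (fun i => 3 * η i) U (𝓝 0) := by simpa using hηU.const_mul 3
  choose C hcov hC using fun i => hM i (f i x) (f i y)
  have htr : ∀ γ, N.IsPrimitive x y γ → ∃ v κ G, N.IsDiamond x y γ v κ G ∧ ∃ ζ : ℕ → ℝ → ℂ,
      ∀ᶠ i in U, ζ i 0 = 0 ∧ ζ i 1 = 1 ∧ (∀ t ∈ Ioo (0 : ℝ) 1, ζ i t ∈ rhombus κ) ∧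
      (∀ t ∈ Icc (0 : ℝ) 1, ‖ζ i t - t‖ ≤ 3 * η i * t ∧ ‖ζ i t - t‖ ≤ 3 * η i * (1 - t)) ∧
      (M i).IsPrimitive (f i x) (f i y) (fun t => f i (G (ζ i t))) := by
    intro γ hγ
    obtain ⟨v, κ, G, hD⟩ := hγ.exists_isDiamond
    have hκ := hD.pos
    have hev : ∀ᶠ i in (U : Filter ℕ), 3 * η i < 1 ∧ 3 * η i * (1 + κ / 2) < κ / 2 := by
      refine (h3η.eventually (gt_mem_nhds one_pos)).and ?_
      have : Tendsto (fun i => 3 * η i * (1 + κ / 2)) U (𝓝 0) := by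
        simpa using h3η.mul_const (1 + κ / 2)
      exact this.eventually (gt_mem_nhds (by linarith))
    have hch : ∀ i, ∃ ζ : ℝ → ℂ, (3 * η i < 1 ∧ 3 * η i * (1 + κ / 2) < κ / 2) → ζ 0 = 0 ∧
        ζ 1 = 1 ∧ (∀ t ∈ Ioo (0 : ℝ) 1, ζ t ∈ rhombus κ) ∧
        (∀ t ∈ Icc (0 : ℝ) 1, ‖ζ t - t‖ ≤ 3 * η i * t ∧ ‖ζ t - t‖ ≤ 3 * η i * (1 - t)) ∧
        (M i).IsPrimitive (f i x) (f i y) (fun t => f i (G (ζ t))) := by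
      intro i
      by_cases hi : 3 * η i < 1 ∧ 3 * η i * (1 + κ / 2) < κ / 2
      · obtain ⟨ζ, hζ⟩ := hD.exists_transfer hγ.isTrajectory (hη0 i) hi.1 hi.2 (hf i)
        exact ⟨ζ, fun _ => hζ⟩
      · exact ⟨0, fun h => absurd h hi⟩
    choose ζ hζ using hch
    exact ⟨v, κ, G, hD, ζ, hev.mono fun i hi => hζ i hi⟩
  choose! v κ G hD ζ hζ using htr
  let T : ∀ i, (ℝ → N.carrier) → ℝ → (M i).carrier := fun i γ t => f i (G γ (ζ γ i t))
  -- Pulled back to `N`, the transferred trajectories converge to the original one, even at varying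
  -- parameters and up to the endpoints.
  have hlim : ∀ γ, N.IsPrimitive x y γ → ∀ (s : ℕ → ℝ) (s₀ : ℝ), (∀ᶠ i in U, s i ∈ Icc (0 : ℝ) 1) →
      Tendsto s U (𝓝 s₀) → Tendsto (fun i => G γ (ζ γ i (s i))) U (𝓝 (γ s₀)) := by
    intro γ hγ s s₀ hs hs₀
    have hs₀m : s₀ ∈ Icc (0 : ℝ) 1 := isClosed_Icc.mem_of_tendsto hs₀ hs
    have hκ := (hD γ hγ).pos
    have hins : ∀ᶠ i in (U : Filter ℕ), ζ γ i (s i) ∈ insert 0 (insert 1 (rhombus (κ γ))) := by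
      filter_upwards [hs, hζ γ hγ] with i hi hz
      rcases hi.1.eq_or_lt with h0 | h0
      · exact Or.inl (by rw [← h0, hz.1])
      rcases hi.2.eq_or_lt with h1 | h1
      · exact Or.inr (Or.inl (by rw [h1, hz.2.1]))
      · exact Or.inr (Or.inr (hz.2.2.1 _ ⟨h0, h1⟩))
    have hzl : Tendsto (fun i => ζ γ i (s i)) U (𝓝 (s₀ : ℂ)) := by
      have h1 : Tendsto (fun i => ζ γ i (s i) - s i) U (𝓝 0) := by
        rw [tendsto_zero_iff_norm_tendsto_zero]
        refine squeeze_zero' (Eventually.of_forall fun _ => norm_nonneg _) ?_ h3η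
        filter_upwards [hs, hζ γ hγ] with i hi hz
        refine (hz.2.2.2.1 _ hi).1.trans ?_
        have := hη0 i
        nlinarith [hi.1, hi.2]
      have h2 : Tendsto (fun i => (s i : ℂ)) U (𝓝 (s₀ : ℂ)) :=
        (Complex.continuous_ofReal.tendsto _).comp hs₀
      simpa using h1.add h2
    have hs₀r : (s₀ : ℂ) ∈ insert 0 (insert 1 (rhombus (κ γ))) := by
      rcases hs₀m.1.eq_or_lt with h0 | h0
      · exact Or.inl (by simp [← h0])
      rcases hs₀m.2.eq_or_lt with h1 | h1
      · exact Or.inr (Or.inl (by simp [h1]))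
      · exact Or.inr (Or.inr (ofReal_mem_rhombus hκ ⟨h0, h1⟩))
    have hc := (hD γ hγ).continuousOn hγ.isTrajectory.source hγ.isTrajectory.target _ hs₀r
    rw [ContinuousWithinAt, (hD γ hγ).real s₀ hs₀m] at hc
    exact hc.comp (tendsto_nhdsWithin_iff.2 ⟨hzl, hins⟩)
  -- A trajectory is put in class `j` when its transfers lie in class `j` for almost all indices.
  refine ⟨fun j => {γ | N.IsPrimitive x y γ ∧ ∀ᶠ i in U, T i γ ∈ C i j}, fun γ hγ => ?_,
    fun j => ⟨fun γ hγ => hγ.1, ?_⟩⟩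
  · have : ∀ᶠ i in (U : Filter ℕ), ∃ j, T i γ ∈ C i j :=
      (hζ γ hγ).mono fun i hi => hcov i _ hi.2.2.2.2
    obtain ⟨j, hj⟩ := Ultrafilter.eventually_exists_iff.1 this
    exact ⟨j, hγ, hj⟩
  have hU : ∀ᶠ i in (U : Filter ℕ), AtMostTwo (C i j) ∨
      ∃ b, b ≠ f i x ∧ b ≠ f i y ∧ ∀ γ ∈ C i j, b ∈ γ '' Icc 0 1 :=
    Eventually.of_forall fun i => (hC i j).2
  rcases Ultrafilter.eventually_or.1 hU with hU | hU
  · left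
    rintro γ₁ ⟨p₁, h₁⟩ γ₂ ⟨p₂, h₂⟩ γ₃ ⟨p₃, h₃⟩
    have heq : ∀ {γ γ'}, N.IsPrimitive x y γ → N.IsPrimitive x y γ' →
        (∀ᶠ i in (U : Filter ℕ), EqOn (T i γ) (T i γ') (Icc 0 1)) → EqOn γ γ' (Icc 0 1) := by
      intro γ γ' p p' h t ht
      refine tendsto_nhds_unique_of_eventuallyEq
        (hlim γ p (fun _ => t) t (Eventually.of_forall fun _ => ht) tendsto_const_nhds)
        (hlim γ' p' (fun _ => t) t (Eventually.of_forall fun _ => ht) tendsto_const_nhds) ?_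
      filter_upwards [h] with i hi using (f i).injective (hi ht)
    have hev : ∀ᶠ i in (U : Filter ℕ), EqOn (T i γ₁) (T i γ₂) (Icc 0 1) ∨
        EqOn (T i γ₁) (T i γ₃) (Icc 0 1) ∨ EqOn (T i γ₂) (T i γ₃) (Icc 0 1) := by
      filter_upwards [hU, h₁, h₂, h₃] with i hi a₁ a₂ a₃ using hi _ a₁ _ a₂ _ a₃
    rcases Ultrafilter.eventually_or.1 hev with h | h
    · exact Or.inl (heq p₁ p₂ h)
    rcases Ultrafilter.eventually_or.1 h with h | h
    · exact Or.inr (Or.inl (heq p₁ p₃ h))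
    · exact Or.inr (Or.inr (heq p₂ p₃ h))
  · have hch : ∀ i, ∃ b, (∃ b, b ≠ f i x ∧ b ≠ f i y ∧ ∀ γ ∈ C i j, b ∈ γ '' Icc 0 1) →
        b ≠ f i x ∧ b ≠ f i y ∧ ∀ γ ∈ C i j, b ∈ γ '' Icc 0 1 := by
      intro i
      by_cases h : ∃ b, b ≠ f i x ∧ b ≠ f i y ∧ ∀ γ ∈ C i j, b ∈ γ '' Icc 0 1
      · obtain ⟨b, hb⟩ := h
        exact ⟨b, fun _ => hb⟩
      · exact ⟨f i x, fun h' => absurd h' h⟩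
    choose b hb using hch
    replace hb := hU.mono fun i hi => hb i hi
    -- The limit of the blocking points exists by compactness of `N`, but it may be an endpoint.
    obtain ⟨b₀, -, hb₀⟩ := isCompact_univ.ultrafilter_le_nhds
      (U.map fun i => (f i).symm (b i)) (by simp)
    have hb₀ : Tendsto (fun i => (f i).symm (b i)) U (𝓝 b₀) := hb₀
    -- The meeting parameters lie strictly between `0` and `1`, since `b i` is not an endpoint; only
    -- their limit may be `0` or `1`.
    have hmeet : ∀ γ, N.IsPrimitive x y γ → (∀ᶠ i in (U : Filter ℕ), T i γ ∈ C i j) →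
        ∃ (s : ℕ → ℝ) (s₀ : ℝ), s₀ ∈ Icc (0 : ℝ) 1 ∧ Tendsto s U (𝓝 s₀) ∧ γ s₀ = b₀ ∧
          ∀ᶠ i in (U : Filter ℕ), s i ∈ Ioo (0 : ℝ) 1 ∧ (f i).symm (b i) = G γ (ζ γ i (s i)) := by
      intro γ p h
      have hex : ∀ i, ∃ s : ℝ, b i ∈ T i γ '' Icc 0 1 → s ∈ Icc (0 : ℝ) 1 ∧ T i γ s = b i := by
        intro i
        by_cases hi : b i ∈ T i γ '' Icc 0 1
        · obtain ⟨s, hs⟩ := hi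
          exact ⟨s, fun _ => hs⟩
        · exact ⟨0, fun h => absurd h hi⟩
      choose s hs using hex
      have hs' : ∀ᶠ i in (U : Filter ℕ), s i ∈ Icc (0 : ℝ) 1 ∧ T i γ (s i) = b i := by
        filter_upwards [hb, h] with i h1 h2 using hs i (h1.2.2 _ h2)
      obtain ⟨s₀, hs₀, hlims⟩ := isCompact_Icc.ultrafilter_le_nhds (U.map s)
        (le_principal_iff.2 (hs'.mono fun i hi => hi.1))
      have hlims : Tendsto s U (𝓝 s₀) := hlims
      have heq : ∀ᶠ i in (U : Filter ℕ), (f i).symm (b i) = G γ (ζ γ i (s i)) :=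
        hs'.mono fun i hi => by rw [← hi.2]; exact (f i).symm_apply_apply _
      refine ⟨s, s₀, hs₀, hlims, ?_, ?_⟩
      · exact tendsto_nhds_unique_of_eventuallyEq
          (hlim γ p s s₀ (hs'.mono fun i hi => hi.1) hlims) hb₀ (heq.mono fun i hi => hi.symm)
      · filter_upwards [hs', heq, hb, hζ γ p] with i h1 h2 h3 h4
        refine ⟨⟨lt_of_le_of_ne h1.1.1 ?_, lt_of_le_of_ne h1.1.2 ?_⟩, h2⟩
        · intro h0
          rw [← h0] at h1
          exact h3.1 (h1.2.symm.trans h4.2.2.2.2.isTrajectory.source)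
        · intro h0
          rw [h0] at h1
          exact h3.2.1 (h1.2.symm.trans h4.2.2.2.2.isTrajectory.target)
    by_cases hbx : b₀ ≠ x ∧ b₀ ≠ y
    · right
      refine ⟨b₀, hbx.1, hbx.2, ?_⟩
      rintro γ ⟨p, h⟩
      obtain ⟨s, s₀, hs₀, -, hγ, -⟩ := hmeet γ p h
      exact ⟨s₀, hs₀, hγ⟩
    -- Now `b₀` is an endpoint, so by primitivity the meeting parameters of each member tend to `0`
    -- or `1`.
    · left
      have hends : ∀ γ, N.IsPrimitive x y γ → (∀ᶠ i in (U : Filter ℕ), T i γ ∈ C i j) →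
          ∃ (s : ℕ → ℝ) (s₀ : ℝ), (s₀ = 0 ∨ s₀ = 1) ∧ Tendsto s U (𝓝 s₀) ∧
          ∀ᶠ i in (U : Filter ℕ), s i ∈ Ioo (0 : ℝ) 1 ∧ (f i).symm (b i) = G γ (ζ γ i (s i)) := by
        intro γ p h
        obtain ⟨s, s₀, hs₀, hs, hγ, hi⟩ := hmeet γ p h
        refine ⟨s, s₀, ?_, hs, hi⟩
        by_contra hne
        rw [not_or] at hne
        have hm : s₀ ∈ Ioo (0 : ℝ) 1 :=
          ⟨lt_of_le_of_ne hs₀.1 (Ne.symm hne.1), lt_of_le_of_ne hs₀.2 hne.2⟩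
        exact hbx ⟨fun h => p.ne_left s₀ hm (hγ.trans h), fun h => p.ne_right s₀ hm (hγ.trans h)⟩
      have hsame : ∀ {γ γ'}, N.IsPrimitive x y γ → N.IsPrimitive x y γ' →
          ∀ {s s' : ℕ → ℝ} {s₀ : ℝ}, (s₀ = 0 ∨ s₀ = 1) → Tendsto s U (𝓝 s₀) →
          Tendsto s' U (𝓝 s₀) → (∀ᶠ i in (U : Filter ℕ), s i ∈ Ioo (0 : ℝ) 1 ∧
            (f i).symm (b i) = G γ (ζ γ i (s i))) → (∀ᶠ i in (U : Filter ℕ), s' i ∈ Ioo (0 : ℝ) 1 ∧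
            (f i).symm (b i) = G γ' (ζ γ' i (s' i))) → EqOn γ γ' (Icc 0 1) := by
        intro γ γ' p p' s s' s₀ h01 hs hs' hi hi'
        have heq : ∀ᶠ i in (U : Filter ℕ), G γ (ζ γ i (s i)) = G γ' (ζ γ' i (s' i)) := by
          filter_upwards [hi, hi'] with i a a' using a.2.symm.trans a'.2
        rcases h01 with rfl | rfl
        · refine p.eqOn_of_tendsto p' (hD γ p) (hD γ' p') h3η hs hs' ?_ ?_ ?_ ?_ heq
          · filter_upwards [hi, hζ γ p] with i a z using
              ⟨a.1.1, (z.2.2.2.1 _ (Ioo_subset_Icc_self a.1)).1⟩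
          · filter_upwards [hi', hζ γ' p'] with i a z using
              ⟨a.1.1, (z.2.2.2.1 _ (Ioo_subset_Icc_self a.1)).1⟩
          · filter_upwards [hi, hζ γ p] with i a z using z.2.2.1 _ a.1
          · filter_upwards [hi', hζ γ' p'] with i a z using z.2.2.1 _ a.1
        -- Meetings near the terminal point reduce to the other case by reversing the trajectories.
        · have hrev : ∀ {s : ℕ → ℝ}, Tendsto s U (𝓝 1) → Tendsto (fun i => 1 - s i) U (𝓝 0) := by
            intro s hs
            simpa using hs.const_sub 1
          have hnear : ∀ {γ} {s : ℕ → ℝ}, N.IsPrimitive x y γ → (∀ᶠ i in (U : Filter ℕ), s i ∈ Ioo (0 : ℝ) 1 ∧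
              (f i).symm (b i) = G γ (ζ γ i (s i))) → ∀ᶠ i in (U : Filter ℕ), 0 < 1 - s i ∧
              ‖(1 - ζ γ i (s i)) - ((1 - s i : ℝ) : ℂ)‖ ≤ 3 * η i * (1 - s i) := by
            intro γ s p hi
            filter_upwards [hi, hζ γ p] with i a z
            refine ⟨sub_pos.2 a.1.2, ?_⟩
            have := (z.2.2.2.1 _ (Ioo_subset_Icc_self a.1)).2
            rw [norm_sub_rev] at this
            push_cast
            rwa [sub_sub_sub_cancel_left]
          have := p.reverse.eqOn_of_tendsto p'.reverse (hD γ p).reverse (hD γ' p').reverse h3η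
            (hrev hs) (hrev hs') (hnear p hi) (hnear p' hi')
            (by filter_upwards [hi, hζ γ p] with i a z using one_sub_mem_rhombus (z.2.2.1 _ a.1))
            (by filter_upwards [hi', hζ γ' p'] with i a z using
              one_sub_mem_rhombus (z.2.2.1 _ a.1))
            (by filter_upwards [heq] with i a; simpa using a)
          intro t ht
          simpa using this (x := 1 - t) ⟨by linarith [ht.2], by linarith [ht.1]⟩
      rintro γ₁ ⟨p₁, h₁⟩ γ₂ ⟨p₂, h₂⟩ γ₃ ⟨p₃, h₃⟩
      obtain ⟨s₁, r₁, e₁, t₁, a₁⟩ := hends γ₁ p₁ h₁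
      obtain ⟨s₂, r₂, e₂, t₂, a₂⟩ := hends γ₂ p₂ h₂
      obtain ⟨s₃, r₃, e₃, t₃, a₃⟩ := hends γ₃ p₃ h₃
      -- Of three trajectories two share the limit parameter; this is the reason for the number two
      -- in `AtMostTwo`.
      have hpig : r₁ = r₂ ∨ r₁ = r₃ ∨ r₂ = r₃ := by
        rcases e₁ with rfl | rfl <;> rcases e₂ with rfl | rfl <;> rcases e₃ with rfl | rfl <;> simp
      rcases hpig with rfl | rfl | rfl
      · exact Or.inl (hsame p₁ p₂ e₁ t₁ t₂ a₁ a₂)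
      · exact Or.inr (Or.inl (hsame p₁ p₃ e₁ t₁ t₃ a₁ a₃))
      · exact Or.inr (Or.inr (hsame p₂ p₃ e₂ t₂ t₃ a₂ a₃))

/-- A constant sequence with error zero is a special case of the passage to limits. -/
theorem ClassBlocking.of_isTranslationIso {M N : TranslationSurface α} {n : ℕ}
    {f : N.carrier ≃ₜ M.carrier} (h : M.ClassBlocking n) (hf : IsTranslationIso N M f) :
    N.ClassBlocking n :=
  ClassBlocking.of_isNearTranslation (M := fun _ => M) (η := fun _ => 0) (f := fun _ => f)
    (fun _ => le_rfl) tendsto_const_nhds (fun _ => hf.isNearTranslation le_rfl) fun _ => h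

end TranslationSurface

/-! ### Closedness in the stratum and orbit closures. -/

/-- The class blocking surfaces form a closed subset of the stratum. -/
theorem Stratum.isClosed_classBlocking {k : ℕ} (α : Fin k → ℕ) (n : ℕ) :
    IsClosed {s : Stratum α | ∃ M : TranslationSurface α, Stratum.mk M = s ∧ M.ClassBlocking n} := by
  refine ⟨?_⟩
  intro N hN T τ w hτ
  by_contra hcon
  push Not at hcon
  -- If the complement were not open at `N`, each tolerance `1 / (i + 1)` would be met by a class
  -- blocking surface, and these surfaces would approach `N`.
  choose ε hε hnear using fun i : ℕ =>
    hτ.exists_isNearTranslation (Nat.one_div_pos_of_nat (α := ℝ) (n := i))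
  choose M' f w' hl hτ' hw hmem using fun i => hcon (ε i) (hε i)
  have hmem' : ∀ i, ∃ M : TranslationSurface α, Stratum.mk M = Stratum.mk (M' i) ∧
      M.ClassBlocking n := fun i => not_not.1 (hmem i)
  choose M hM hcb using hmem'
  choose g hg using fun i => (Quotient.exact (hM i)).imp fun _ h => h
  exact hN ⟨N, rfl, TranslationSurface.ClassBlocking.of_isNearTranslation
    (η := fun i : ℕ => 1 / ((i : ℝ) + 1)) (fun i => by positivity)
    tendsto_one_div_add_atTop_nhds_zero_nat
    (fun i => (hnear i _ _ _ (hl i) (hτ' i) (hw i)).trans (hg i).symm) hcb⟩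

theorem corollary3p2 (n a : ℕ) :
    ∃ ℓ : ℕ, ∀ (k : ℕ) (α : Fin k → ℕ), k ≠ 0 → (∀ i, α i ≤ a) →
      ∀ M : TranslationSurface α, M.BoundedBlocking n →
        ∀ N : TranslationSurface α,
          Stratum.mk N ∈ closure (MulAction.orbit (Matrix.SpecialLinearGroup (Fin 2) ℝ)
            (Stratum.mk M)) →
          N.BoundedBlocking ℓ := by
  -- Each of the `n` classes on the limit surface costs at most two blocking points.
  refine ⟨n * 2, fun k α _ _ M hM N hN => ?_⟩
  have hsub : MulAction.orbit (Matrix.SpecialLinearGroup (Fin 2) ℝ) (Stratum.mk M) ⊆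
      {s : Stratum α | ∃ M : TranslationSurface α, Stratum.mk M = s ∧ M.ClassBlocking n} := by
    rintro _ ⟨g, rfl⟩
    exact ⟨TranslationSurface.act g M, rfl, (hM.act g).classBlocking⟩
  obtain ⟨N', hN', hcb⟩ := closure_minimal hsub (Stratum.isClosed_classBlocking α n) hN
  obtain ⟨f, hf⟩ := Quotient.exact hN'
  exact (hcb.of_isTranslationIso hf.symm).boundedBlocking
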